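/- The model is a randomized catalytic word-RAM: a fixed (uniform) finite program with finitely many work registers, each holding one word of $O(\log n)$ bits, and random access to the individual bits of a catalytic tape $R$ whose initial content $\tau$ is arbitrary. One time step performs one operation: word arithmetic or copying, a jump, reading one number of the input, tossing a fair coin, reading or writing one bit of $R$, or one query to a read-only oracle for the input graph; the oracle returns in-degrees, out-degrees, and the $i$-th in- or out-neighbour of a vertex of $\{0,\dots,n-1\}$, neighbours being listed in an arbitrary order. The program decides a problem in the one-sided-error catalytic sense if, for every input, every $\tau$ and every outcome of the coins, it halts within the stated time with $R$ restored to $\tau$; on a no-instance it always answers no; and on a yes-instance it answers yes with probability at least $1/2$ for every $\tau$. It is locally revertible in time $q$ if there is a query routine such that whenever an execution with initial tape $\tau$ is paused, after any step, and queried on any index $i$, the routine, started from the paused memory contents, returns $\tau_i$ within $q$ steps and leaves the work registers and $R$ exactly as they were at the pause, so that the execution can continue. **Theorem.** There is a randomized catalytic algorithm that, given a simple directed graph (no loops, no parallel edges) with $n$ vertices and $m\ge n$ edges together with vertices $s,t$, decides whether there exists a directed path from $s$ to $t$. The algorithm uses $O(\log n)$ bits of workspace and $\widetilde O(n^3)$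 bits of catalytic space, and runs in time $\widetilde O(nm)$. Moreover, the same algorithm is locally revertible in time $\mathrm{polylog}(n)$. Here $\widetilde O(f)$ means $O(f\cdot \mathrm{polylog}(n))$, and the workspace of the query routine is included in the $O(\log n)$ bound. -/

import Mathlib

namespace Catalytic

/-- A simple directed graph (no loops, no parallel edges) on the vertex set `{0, …, n-1}`, together
with the data that oracle access to it exposes: for every vertex, its in-neighbours and its
out-neighbours, each listed once and in an arbitrary order. -/
structure OracleDigraph (n : ℕ) extends Digraph (Fin n) where
  loopless : ∀ v, ¬ Adj v v
  inList : Fin n → List (Fin n)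
  outList : Fin n → List (Fin n)
  inList_nodup : ∀ v, (inList v).Nodup
  outList_nodup : ∀ v, (outList v).Nodup
  mem_inList : ∀ u v, u ∈ inList v ↔ Adj u v
  mem_outList : ∀ u v, u ∈ outList v ↔ Adj v u

namespace OracleDigraph

variable {n : ℕ} (G : OracleDigraph n)

/-- The number of (directed) edges. -/
noncomputable def numEdges : ℕ := {e : Fin n × Fin n | G.Adj e.1 e.2}.ncard

/-- There is a directed path (possibly of length zero) from `s` to `t`. -/
def Reaches (s t : Fin n) : Prop := Relation.ReflTransGen G.Adj s t

/-- Oracle query: the in-degree of `v` (`0` if `v` is not a vertex). -/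
def inDeg (v : ℕ) : ℕ := if h : v < n then (G.inList ⟨v, h⟩).length else 0

/-- Oracle query: the out-degree of `v` (`0` if `v` is not a vertex). -/
def outDeg (v : ℕ) : ℕ := if h : v < n then (G.outList ⟨v, h⟩).length else 0

/-- Oracle query: the `i`-th in-neighbour of `v`, counted from `0`. The answer `⊥` (there is no such
neighbour) is represented by the number `n`, which is not a vertex. -/
def inNbr (v i : ℕ) : ℕ :=
  if h : v < n then ((G.inList ⟨v, h⟩)[i]?).elim n (fun u => (u : ℕ)) else n

/-- Oracle query: the `i`-th out-neighbour of `v`, counted from `0`; `⊥` is represented by `n`. -/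
def outNbr (v i : ℕ) : ℕ :=
  if h : v < n then ((G.outList ⟨v, h⟩)[i]?).elim n (fun u => (u : ℕ)) else n

end OracleDigraph

/-- Binary arithmetic operations on words. -/
inductive Op where
  | add | sub | mul | div | mod

/-- The value of an operation on natural numbers (`sub` truncates at `0`; `x / 0 = 0` and
`x mod 0 = x`). The machine reduces the result modulo `2 ^ w`, where `w` is the word length. -/
def Op.eval : Op → ℕ → ℕ → ℕ
  | .add, x, y => x + y
  | .sub, x, y => x - y
  | .mul, x, y => x * y
  | .div, x, y => x / y
  | .mod, x, y => x % y

/-- Instructions of a randomized catalytic word-RAM whose work registers are named by `R`. -/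
inductive Instr (R : Type) where
  /-- load a constant -/
  | const (dst : R) (a : ℕ)
  /-- load the `j`-th number of the read-only input -/
  | arg (dst : R) (j : ℕ)
  /-- copy a register -/
  | copy (dst src : R)
  /-- word arithmetic -/
  | arith (o : Op) (dst x y : R)
  /-- unconditional jump -/
  | jump (target : ℕ)
  /-- jump if `x < y` -/
  | jumpLt (x y : R) (target : ℕ)
  /-- jump if `x = y` -/
  | jumpEq (x y : R) (target : ℕ)
  /-- read the bit of the catalytic tape whose address is in `addr` -/
  | catRead (dst addr : R)
  /-- overwrite the bit of the catalytic tape whose address is in `addr` -/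
  | catWrite (addr src : R)
  /-- toss a fair coin -/
  | coin (dst : R)
  /-- graph oracle: in-degree -/
  | inDeg (dst v : R)
  /-- graph oracle: out-degree -/
  | outDeg (dst v : R)
  /-- graph oracle: in-neighbour number `i` of `v` -/
  | inNbr (dst v i : R)
  /-- graph oracle: out-neighbour number `i` of `v` -/
  | outNbr (dst v i : R)
  /-- stop and output a bit -/
  | halt (b : Bool)

/-- A program: a finite list of instructions; jump targets are positions in the list. -/
abbrev Program (R : Type) : Type := List (Instr R)

/-- A configuration: program counter, work registers, and a catalytic tape of `W` bits. -/
structure Config (R : Type) (W : ℕ) where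
  pc : ℕ
  reg : R → ℕ
  cat : Fin W → Bool

/-- What a computation can consult but not change: the graph, the list of input numbers, and the
word length `w`. -/
structure Env (n : ℕ) where
  graph : OracleDigraph n
  args : List ℕ
  w : ℕ

section Semantics

variable {R : Type} [DecidableEq R] {W n : ℕ}

/-- Store the `w`-bit word `x mod 2 ^ w` in a register and move on to the next instruction. -/
def Config.put (w : ℕ) (c : Config R W) (dst : R) (x : ℕ) : Config R W :=
  { c with pc := c.pc + 1, reg := Function.update c.reg dst (x % 2 ^ w) }

/-- The effect of one instruction; `b` is the outcome of the coin available at this step. Addresses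
outside the catalytic tape read as `0`, and writing there has no effect. -/
def Instr.exec (E : Env n) (b : Bool) (c : Config R W) : Instr R → Config R W
  | .const dst a => c.put E.w dst a
  | .arg dst j => c.put E.w dst (E.args.getD j 0)
  | .copy dst src => c.put E.w dst (c.reg src)
  | .arith o dst x y => c.put E.w dst (o.eval (c.reg x) (c.reg y))
  | .jump target => { c with pc := target }
  | .jumpLt x y target => { c with pc := if c.reg x < c.reg y then target else c.pc + 1 }
  | .jumpEq x y target => { c with pc := if c.reg x = c.reg y then target else c.pc + 1 }
  | .catRead dst addr =>
      c.put E.w dst (if h : c.reg addr < W then (c.cat ⟨c.reg addr, h⟩).toNat else 0)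
  | .catWrite addr src =>
      { c with
        pc := c.pc + 1
        cat := if h : c.reg addr < W then
            Function.update c.cat ⟨c.reg addr, h⟩ (decide (c.reg src ≠ 0))
          else c.cat }
  | .coin dst => c.put E.w dst b.toNat
  | .inDeg dst v => c.put E.w dst (E.graph.inDeg (c.reg v))
  | .outDeg dst v => c.put E.w dst (E.graph.outDeg (c.reg v))
  | .inNbr dst v i => c.put E.w dst (E.graph.inNbr (c.reg v) (c.reg i))
  | .outNbr dst v i => c.put E.w dst (E.graph.outNbr (c.reg v) (c.reg i))
  | .halt _ => c

/-- One time step. A configuration whose program counter has left the program does not move (and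
never produces an output). -/
def Program.step (P : Program R) (E : Env n) (b : Bool) (c : Config R W) : Config R W :=
  match P[c.pc]? with
  | some i => i.exec E b c
  | none => c

/-- The configuration after a number of time steps, when the coin available at step `j` shows
`ω j`. -/
def Program.run (P : Program R) (E : Env n) (ω : ℕ → Bool) (c : Config R W) : ℕ → Config R W
  | 0 => c
  | j + 1 => P.step E (ω j) (Program.run P E ω c j)

/-- The output in a configuration: `some b` if the program has halted with output `b`, and `none`
if it has not halted. Halted configurations do not change any more. -/
def Program.output (P : Program R) (c : Config R W) : Option Bool :=
  match P[c.pc]? with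
  | some (.halt b) => some b
  | _ => none

end Semantics

/-- A randomized catalytic algorithm for graphs given by oracle access, equipped with a query
routine. There are finitely many work registers, and on `n`-vertex graphs each of them holds one word
of `wordFactor * ⌈log₂ n⌉` bits. The query routine works on the registers of the main program,
together with some further registers of its own. -/
structure Algorithm where
  wordFactor : ℕ
  mainRegs : ℕ
  queryRegs : ℕ
  main : Program (Fin mainRegs)
  query : Program (Fin mainRegs ⊕ Fin queryRegs)

namespace Algorithm

variable (A : Algorithm) {n : ℕ} (G : OracleDigraph n) (s t : Fin n) {W : ℕ}

/-- Word length in bits on graphs with `n` vertices. -/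
def wordLen (n : ℕ) : ℕ := A.wordFactor * Nat.clog 2 n

/-- Total number of bits of workspace on graphs with `n` vertices, for the main program and the
query routine together. -/
def workspace (n : ℕ) : ℕ := (A.mainRegs + A.queryRegs) * A.wordLen n

/-- The configuration of the main program on input `G, s, t` after `j` steps, when started with
cleared work registers and catalytic tape `τ`, with coin tosses `ω`. -/
def mainAt (τ : Fin W → Bool) (ω : ℕ → Bool) (j : ℕ) : Config (Fin A.mainRegs) W :=
  A.main.run ⟨G, [n, s, t], A.wordLen n⟩ ω ⟨0, fun _ => 0, τ⟩ j

/-- The output of the main program within `T` steps (`none` if it has not halted by then). -/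
def result (τ : Fin W → Bool) (ω : ℕ → Bool) (T : ℕ) : Option Bool :=
  A.main.output (A.mainAt G s t τ ω T)

/-- For all contents `τ` of the catalytic tape and all coin tosses, the algorithm halts within `T`
steps, and then the catalytic tape holds `τ` again. -/
def IsCatalytic (W T : ℕ) : Prop :=
  ∀ (τ : Fin W → Bool) (ω : ℕ → Bool),
    (A.result G s t τ ω T).isSome ∧ (A.mainAt G s t τ ω T).cat = τ

/-- The probability, over `T` independent fair coins, that the algorithm started with catalytic tape
`τ` outputs yes within `T` steps. -/
def acceptProb (τ : Fin W → Bool) (T : ℕ) : ℚ :=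
  ((Finset.univ.filter fun ω : Fin T → Bool =>
    A.result G s t τ (fun j => if h : j < T then ω ⟨j, h⟩ else false) T = some true).card : ℚ)
      / 2 ^ T

/-- The configuration of the query routine, `k` steps after the main program was paused in the
configuration `c` and queried on index `i`: it starts with the work registers and the catalytic tape
as they are in `c`, its own registers cleared, and it can read `n, s, t`, the index `i`, and the
program counter of the paused main program. -/
def queryAt (c : Config (Fin A.mainRegs) W) (i : Fin W) (ω : ℕ → Bool) (k : ℕ) :
    Config (Fin A.mainRegs ⊕ Fin A.queryRegs) W :=
  A.query.run ⟨G, [n, s, t, i, c.pc], A.wordLen n⟩ ω ⟨0, Sum.elim c.reg (fun _ => 0), c.cat⟩ k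

/-- Local revertibility in time `q`: whenever an execution with initial catalytic tape `τ` is paused
and queried on an index `i`, the query routine halts within `q` steps with output `τ i`, with the
work registers and the catalytic tape exactly as they were when the execution was paused (so that
the execution can continue). -/
def LocallyRevertible (W q : ℕ) : Prop :=
  ∀ (τ : Fin W → Bool) (ω : ℕ → Bool) (j : ℕ) (i : Fin W) (ω' : ℕ → Bool),
    let c := A.mainAt G s t τ ω j
    let d := A.queryAt G s t c i ω' q
    A.query.output d = some (τ i) ∧ (∀ r, d.reg (Sum.inl r) = c.reg r) ∧ d.cat = c.cat

end Algorithm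

end Catalytic

set_option autoImplicit false

namespace Catalytic

/-! ### Structured commands and their compilation -/

/-! Reachability is decided by counting walks. With lazy steps allowed, the number `walks G s (n -
1) t` of walks from `s` to `t` is positive once `t` is reachable (`walks_pos_of_reaches`). The
recursion for these numbers is laid out as a network of `n` layers whose nodes are words on the
tape. In a positive layer each vertex owns a chain of nodes, one for staying in place and one per
in-neighbour; each node takes the value of its predecessor in the chain and the value at the end of
a chain one layer below. Processing a node adds these values to its word modulo `2 ^ w`. The feeding
nodes have smaller addresses (`source_lt`), so processing in increasing order can be undone in
decreasing order by subtracting the same amounts, whatever the tape held. There are at most `n * (n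
+ m)` active nodes, and each costs `O(log n)` steps.

The unknown tape content is cancelled by comparing two passes, one of which adds `1` at `s` in layer
0. If `t` is not reachable, both passes see exactly the same value at `t`
(`Processed.nodeValue_eq`), so the error is one-sided. Otherwise randomness enters: a word `x` is
read as `(x + r) % 2 ^ w % q`, where `r` is a random word and `q = r % n ^ 1024 + 1`. If no addition
wraps around modulo `2 ^ w`, the two values at `t` differ by the number of walks modulo `q`
(`Processed.nodeValue_modEq`), so they are distinct unless `q` divides that number.

Both failures are rare. The shift by `r` brings a fixed word close to `2 ^ w` for few `r`
(`card_exists_shift_le`). The modulus need not be prime: if many numbers up to `K` divided `N`,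
their product would divide a power of `K!` only through primes of `N`, and Chebyshev's bound makes
those primes contribute too little (`card_divisors_le_lt`). Both events are counted over the same
`r`, so a union bound suffices and no independence is used (`card_bad_le`).

Local revertibility comes from the invariant `Inv`, which holds after every single instruction. At
any moment the original word of a node is on the tape, or in the register `org`, or equals the
present word minus an addend that can be recomputed from the present tape. The query routine finds
out which and computes it without writing to the tape (`queryCmd_spec`). To reason about single
instructions, programs are written as structured commands; `Run` carries an invariant through all
intermediate times, and `Run.compile` transfers it to the machine code. -/

/-- Memory contents of the machine: a configuration without its program counter. -/
structure St (R : Type) (W : ℕ) where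
  reg : R → ℕ
  cat : Fin W → Bool

/-- Tests available to structured commands. -/
inductive Cond (R : Type) where
  | lt (x y : R)
  | eq (x y : R)

/-- Structured commands over the instructions of the machine. -/
inductive Cmd (R : Type) where
  | skip
  | ins (i : Instr R)
  | seq (c d : Cmd R)
  | ite (b : Cond R) (c d : Cmd R)
  | loop (x y : R) (c : Cmd R)

namespace Cmd

/-- Sequential composition of a list of instructions. -/
def block {R : Type} : List (Instr R) → Cmd R
  | [] => skip
  | i :: L => seq (ins i) (block L)

/-- Sequential iteration. -/
def iter {R : Type} (c : Cmd R) : ℕ → Cmd R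
  | 0 => skip
  | k + 1 => seq (iter c k) c

end Cmd

infixr:60 " ;; " => Cmd.seq

section Framework

variable {R : Type} [DecidableEq R] {W n : ℕ}

/-- The jump instruction that tests a condition. -/
def Cond.jump : Cond R → ℕ → Instr R
  | .lt x y, a => .jumpLt x y a
  | .eq x y, a => .jumpEq x y a

/-- The truth value of a condition. -/
def Cond.Holds : Cond R → St R W → Prop
  | .lt x y, s => s.reg x < s.reg y
  | .eq x y, s => s.reg x = s.reg y

omit [DecidableEq R] in
@[simp] theorem Cond.holds_lt (x y : R) (s : St R W) :
    (Cond.lt x y).Holds s ↔ s.reg x < s.reg y := Iff.rfl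

omit [DecidableEq R] in
@[simp] theorem Cond.holds_eq (x y : R) (s : St R W) :
    (Cond.eq x y).Holds s ↔ s.reg x = s.reg y := Iff.rfl

/-- Instructions that neither jump nor halt. -/
def Instr.IsPlain : Instr R → Bool
  | .jump _ => false
  | .jumpLt _ _ _ => false
  | .jumpEq _ _ _ => false
  | .halt _ => false
  | _ => true

/-- The registers written by an instruction. -/
def Instr.writes : Instr R → List R
  | .const dst _ => [dst]
  | .arg dst _ => [dst]
  | .copy dst _ => [dst]
  | .arith _ dst _ _ => [dst]
  | .catRead dst _ => [dst]
  | .coin dst => [dst]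
  | .inDeg dst _ => [dst]
  | .outDeg dst _ => [dst]
  | .inNbr dst _ _ => [dst]
  | .outNbr dst _ _ => [dst]
  | _ => []

/-- Instructions that leave the catalytic tape alone. -/
def Instr.NoWrite : Instr R → Bool
  | .catWrite _ _ => false
  | _ => true

/-- Instructions whose effect does not depend on a coin. -/
def Instr.NoCoin : Instr R → Bool
  | .coin _ => false
  | _ => true

namespace Cmd

/-- The number of instructions of the compiled command. -/
def len : Cmd R → ℕ
  | skip => 0
  | ins _ => 1
  | seq c d => c.len + d.len
  | ite _ c d => d.len + c.len + 2
  | loop _ _ c => c.len + 3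

/-- Compilation to machine code placed at a given address. -/
def compile : Cmd R → ℕ → List (Instr R)
  | skip, _ => []
  | ins i, _ => [i]
  | seq c d, a => c.compile a ++ d.compile (a + c.len)
  | ite b c d, a =>
      b.jump (a + d.len + 2) :: (d.compile (a + 1) ++
        (.jump (a + d.len + c.len + 2) :: c.compile (a + d.len + 2)))
  | loop x y c, a =>
      .jumpLt x y (a + 2) :: .jump (a + c.len + 3) :: (c.compile (a + 2) ++ [.jump a])

omit [DecidableEq R] in
theorem length_compile (c : Cmd R) : ∀ a, (c.compile a).length = c.len := by
  induction c with
  | skip => simp [compile, len]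
  | ins i => simp [compile, len]
  | seq c d hc hd => simp [compile, len, hc, hd]
  | ite b c d hc hd => intro a; simp [compile, len, hc, hd]; omega
  | loop x y c hc => intro a; simp [compile, len, hc]

/-- The registers a command may change. -/
def writes : Cmd R → List R
  | skip => []
  | ins i => i.writes
  | seq c d => c.writes ++ d.writes
  | ite _ c d => c.writes ++ d.writes
  | loop _ _ c => c.writes

/-- Every primitive instruction of the command satisfies a boolean test. -/
def all (f : Instr R → Bool) : Cmd R → Bool
  | skip => true
  | ins i => f i
  | seq c d => c.all f && d.all f
  | ite _ c d => c.all f && d.all f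
  | loop _ _ c => c.all f

end Cmd

namespace St

/-- The configuration with the given program counter. -/
def withPc (s : St R W) (pc : ℕ) : Config R W := ⟨pc, s.reg, s.cat⟩

/-- Store a word in a register. -/
def set (w : ℕ) (s : St R W) (r : R) (x : ℕ) : St R W :=
  ⟨Function.update s.reg r (x % 2 ^ w), s.cat⟩

/-- The bit of the tape at an address (`false` outside the tape). -/
def bit (cat : Fin W → Bool) (a : ℕ) : Bool := if h : a < W then cat ⟨a, h⟩ else false

@[simp] theorem set_cat (w : ℕ) (s : St R W) (r : R) (x : ℕ) : (s.set w r x).cat = s.cat := rfl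

@[simp] theorem set_reg (w : ℕ) (s : St R W) (r : R) (x : ℕ) (r' : R) :
    (s.set w r x).reg r' = if r' = r then x % 2 ^ w else s.reg r' := by
  simp [set, Function.update_apply]

/-- The effect of an instruction on the memory. -/
def exec (E : Env n) (b : Bool) (s : St R W) (i : Instr R) : St R W :=
  ⟨(i.exec E b (s.withPc 0)).reg, (i.exec E b (s.withPc 0)).cat⟩

variable (E : Env n) (b : Bool) (s : St R W)

@[simp] theorem exec_const (dst : R) (a : ℕ) : s.exec E b (.const dst a) = s.set E.w dst a := rfl
@[simp] theorem exec_arg (dst : R) (j : ℕ) :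
    s.exec E b (.arg dst j) = s.set E.w dst (E.args.getD j 0) := rfl
@[simp] theorem exec_copy (dst src : R) :
    s.exec E b (.copy dst src) = s.set E.w dst (s.reg src) := rfl
@[simp] theorem exec_add (dst x y : R) :
    s.exec E b (.arith .add dst x y) = s.set E.w dst (s.reg x + s.reg y) := rfl
@[simp] theorem exec_sub (dst x y : R) :
    s.exec E b (.arith .sub dst x y) = s.set E.w dst (s.reg x - s.reg y) := rfl
@[simp] theorem exec_mul (dst x y : R) :
    s.exec E b (.arith .mul dst x y) = s.set E.w dst (s.reg x * s.reg y) := rfl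
@[simp] theorem exec_div (dst x y : R) :
    s.exec E b (.arith .div dst x y) = s.set E.w dst (s.reg x / s.reg y) := rfl
@[simp] theorem exec_mod (dst x y : R) :
    s.exec E b (.arith .mod dst x y) = s.set E.w dst (s.reg x % s.reg y) := rfl
@[simp] theorem exec_coin (dst : R) : s.exec E b (.coin dst) = s.set E.w dst b.toNat := rfl
@[simp] theorem exec_inDeg (dst v : R) :
    s.exec E b (.inDeg dst v) = s.set E.w dst (E.graph.inDeg (s.reg v)) := rfl
@[simp] theorem exec_inNbr (dst v i : R) :
    s.exec E b (.inNbr dst v i) = s.set E.w dst (E.graph.inNbr (s.reg v) (s.reg i)) := rfl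
@[simp] theorem exec_catRead (dst a : R) :
    s.exec E b (.catRead dst a) = s.set E.w dst (bit s.cat (s.reg a)).toNat := by
  by_cases h : s.reg a < W <;> simp [exec, Instr.exec, Config.put, withPc, set, bit, h]

theorem exec_catWrite_bit (a x : R) (i : ℕ) :
    bit (s.exec E b (.catWrite a x)).cat i =
      if i = s.reg a ∧ i < W then decide (s.reg x ≠ 0) else bit s.cat i := by
  by_cases hi : i < W
  · by_cases ha : s.reg a < W
    · simp [bit, hi, exec, Instr.exec, withPc, ha, Function.update_apply]
      split_ifs <;> first | rfl | (by_cases h0 : s.reg x = 0 <;> simp [h0])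
    · have : i ≠ s.reg a := by omega
      simp [bit, hi, exec, Instr.exec, withPc, ha, this]
  · simp [bit, hi]

theorem exec_withPc {i : Instr R} (hi : i.IsPlain = true) (pc : ℕ) :
    i.exec E b (s.withPc pc) = (s.exec E b i).withPc (pc + 1) := by
  cases i <;> first | rfl | simp [Instr.IsPlain] at hi

theorem exec_frame (i : Instr R) {r : R} (hr : r ∉ i.writes) :
    (s.exec E b i).reg r = s.reg r := by
  cases i <;> simp_all [Instr.writes, exec, Instr.exec, withPc, Config.put]

theorem exec_cat (i : Instr R) (hi : i.NoWrite = true) : (s.exec E b i).cat = s.cat := by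
  cases i <;> first | rfl | simp [Instr.NoWrite] at hi

theorem exec_lt (i : Instr R) (h : ∀ r, s.reg r < 2 ^ E.w) (r : R) :
    (s.exec E b i).reg r < 2 ^ E.w := by
  have : 0 < 2 ^ E.w := by positivity
  cases i <;> simp only [exec, Instr.exec, withPc, Config.put, Function.update_apply] <;>
    (try split_ifs) <;> first | exact Nat.mod_lt _ this | exact h r

theorem exec_noCoin (b b' : Bool) (i : Instr R) (hi : i.NoCoin = true) :
    s.exec E b i = s.exec E b' i := by
  cases i <;> first | rfl | simp [Instr.NoCoin] at hi

end St

/-- `Run E ω I c k s k' s'`: started at time `k` in memory `s`, the compiled command `c` ends at time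
`k'` in memory `s'`, and the memory satisfies `I` at every time from `k` to `k' - 1`. -/
inductive Run (E : Env n) (ω : ℕ → Bool) (I : St R W → Prop) :
    Cmd R → ℕ → St R W → ℕ → St R W → Prop
  | skip (k s) : Run E ω I .skip k s k s
  | ins (i k s) : i.IsPlain = true → I s → Run E ω I (.ins i) k s (k + 1) (s.exec E (ω k) i)
  | seq {c d k s k₁ s₁ k₂ s₂} : Run E ω I c k s k₁ s₁ → Run E ω I d k₁ s₁ k₂ s₂ →
      Run E ω I (.seq c d) k s k₂ s₂
  | iteTrue {b c d k s k₁ s₁} : b.Holds s → I s → Run E ω I c (k + 1) s k₁ s₁ →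
      Run E ω I (.ite b c d) k s k₁ s₁
  -- The compiled else branch comes first and ends with a jump over the then branch. This jump is
  -- the additional step, and it happens in memory `s₁`, where `I` is therefore needed.
  | iteFalse {b c d k s k₁ s₁} : ¬ b.Holds s → I s → Run E ω I d (k + 1) s k₁ s₁ → I s₁ →
      Run E ω I (.ite b c d) k s (k₁ + 1) s₁
  | loopTrue {x y c k s k₁ s₁ k₂ s₂} : s.reg x < s.reg y → I s → Run E ω I c (k + 1) s k₁ s₁ →
      I s₁ → Run E ω I (.loop x y c) (k₁ + 1) s₁ k₂ s₂ → Run E ω I (.loop x y c) k s k₂ s₂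
  | loopFalse {x y c k s} : ¬ s.reg x < s.reg y → I s →
      Run E ω I (.loop x y c) k s (k + 2) s

namespace Run

variable {E : Env n} {ω : ℕ → Bool} {I : St R W → Prop} {c : Cmd R} {k k' : ℕ} {s s' : St R W}

theorem frame (h : Run E ω I c k s k' s') : ∀ r, r ∉ c.writes → s'.reg r = s.reg r := by
  induction h with
  | skip => simp
  | ins i k s hi hI => intro r hr; exact s.exec_frame E _ i hr
  | seq h₁ h₂ ih₁ ih₂ =>
    intro r hr
    simp only [Cmd.writes, List.mem_append, not_or] at hr
    rw [ih₂ r hr.2, ih₁ r hr.1]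
  | iteTrue hb hI h ih =>
    intro r hr
    simp only [Cmd.writes, List.mem_append, not_or] at hr
    exact ih r hr.1
  | iteFalse hb hI h hI' ih =>
    intro r hr
    simp only [Cmd.writes, List.mem_append, not_or] at hr
    exact ih r hr.2
  | loopTrue hb hI h hI' h' ih ih' =>
    intro r hr
    rw [ih' r hr, ih r hr]
  | loopFalse => simp

theorem cat_eq (h : Run E ω I c k s k' s') (hc : c.all Instr.NoWrite = true) :
    s'.cat = s.cat := by
  induction h with
  | skip => rfl
  | ins i k s hi hI => exact s.exec_cat E _ i hc
  | seq h₁ h₂ ih₁ ih₂ =>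
    simp only [Cmd.all, Bool.and_eq_true] at hc
    rw [ih₂ hc.2, ih₁ hc.1]
  | iteTrue hb hI h ih =>
    simp only [Cmd.all, Bool.and_eq_true] at hc
    exact ih hc.1
  | iteFalse hb hI h hI' ih =>
    simp only [Cmd.all, Bool.and_eq_true] at hc
    exact ih hc.2
  | loopTrue hb hI h hI' h' ih ih' => rw [ih' hc, ih hc]
  | loopFalse => rfl

theorem reg_lt (h : Run E ω I c k s k' s') (hs : ∀ r, s.reg r < 2 ^ E.w) :
    ∀ r, s'.reg r < 2 ^ E.w := by
  induction h with
  | skip => exact hs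
  | ins i k s hi hI => exact s.exec_lt E _ i hs
  | seq h₁ h₂ ih₁ ih₂ => exact ih₂ (ih₁ hs)
  | iteTrue hb hI h ih => exact ih hs
  | iteFalse hb hI h hI' ih => exact ih hs
  | loopTrue hb hI h hI' h' ih ih' => exact ih' (ih hs)
  | loopFalse => exact hs

/-- An invariant can be added to the run of a command that respects what it depends on. -/
theorem strengthen (h : Run E ω (fun _ => True) c k s k' s') (hc : c.all Instr.NoWrite = true)
    {L : List R} (hL : ∀ r ∈ c.writes, r ∈ L)
    (hI : ∀ s'' : St R W, s''.cat = s.cat → (∀ r, r ∉ L → s''.reg r = s.reg r) → I s'') :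
    Run E ω I c k s k' s' := by
  induction h with
  | skip => exact .skip _ _
  | ins i k s hi _ => exact .ins _ _ _ hi (hI s rfl fun _ _ => rfl)
  | seq h₁ h₂ ih₁ ih₂ =>
    simp only [Cmd.all, Bool.and_eq_true] at hc
    simp only [Cmd.writes, List.mem_append] at hL
    refine .seq (ih₁ hc.1 (fun r hr => hL r (.inl hr)) hI)
      (ih₂ hc.2 (fun r hr => hL r (.inr hr)) fun s'' h1 h2 => hI s'' ?_ ?_)
    · rw [h1, h₁.cat_eq hc.1]
    · intro r hr
      rw [h2 r hr, h₁.frame r fun hr' => hr (hL r (.inl hr'))]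
  | iteTrue hb _ h ih =>
    simp only [Cmd.all, Bool.and_eq_true] at hc
    simp only [Cmd.writes, List.mem_append] at hL
    exact .iteTrue hb (hI _ rfl fun _ _ => rfl) (ih hc.1 (fun r hr => hL r (.inl hr)) hI)
  | iteFalse hb _ h _ ih =>
    simp only [Cmd.all, Bool.and_eq_true] at hc
    simp only [Cmd.writes, List.mem_append] at hL
    exact .iteFalse hb (hI _ rfl fun _ _ => rfl) (ih hc.2 (fun r hr => hL r (.inr hr)) hI)
      (hI _ (h.cat_eq hc.2) fun r hr => h.frame r fun hr' => hr (hL r (.inr hr')))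
  | loopTrue hb _ h _ h' ih ih' =>
    refine .loopTrue hb (hI _ rfl fun _ _ => rfl) (ih hc hL hI)
      (hI _ (h.cat_eq hc) fun r hr => h.frame r fun hr' => hr (hL r hr'))
      (ih' hc hL fun s'' h1 h2 => hI s'' ?_ ?_)
    · rw [h1, h.cat_eq hc]
    · intro r hr
      rw [h2 r hr, h.frame r fun hr' => hr (hL r hr')]
  | loopFalse hb _ => exact .loopFalse hb (hI _ rfl fun _ _ => rfl)

end Run

/-- The code `L` stands in the program `P` at address `a`. -/
def CodeAt (P : Program R) (a : ℕ) (L : List (Instr R)) : Prop :=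
  ∀ i x, L[i]? = some x → P[a + i]? = some x

namespace CodeAt

variable {P : Program R} {a : ℕ} {L L' : List (Instr R)} {x : Instr R}

omit [DecidableEq R] in
theorem head (h : CodeAt P a (x :: L)) : P[a]? = some x := h 0 x rfl

omit [DecidableEq R] in
theorem tail (h : CodeAt P a (x :: L)) : CodeAt P (a + 1) L := by
  intro i y hy
  rw [show a + 1 + i = a + (i + 1) by ring]
  exact h (i + 1) y (by simpa using hy)

omit [DecidableEq R] in
theorem left (h : CodeAt P a (L ++ L')) : CodeAt P a L := by
  intro i y hy
  refine h i y ?_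
  rw [List.getElem?_append_left]
  · exact hy
  · exact (List.getElem?_eq_some_iff.1 hy).1

omit [DecidableEq R] in
theorem right (h : CodeAt P a (L ++ L')) : CodeAt P (a + L.length) L' := by
  intro i y hy
  rw [add_assoc]
  refine h _ y ?_
  rw [List.getElem?_append_right (by omega)]
  simpa using hy

end CodeAt

/-- The compiled code behaves as the structured command. -/
theorem Run.compile {E : Env n} {ω : ℕ → Bool} {I : St R W → Prop} {c : Cmd R} {k k' : ℕ}
    {s s' : St R W} (h : Run E ω I c k s k' s') {P : Program R} {C : Config R W} :
    ∀ {a : ℕ}, CodeAt P a (c.compile a) → P.run E ω C k = s.withPc a →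
      P.run E ω C k' = s'.withPc (a + c.len) ∧
        ∀ j, k ≤ j → j < k' → ∃ s₀ pc, I s₀ ∧ P.run E ω C j = s₀.withPc pc := by
  have hstep : ∀ {k : ℕ} {s : St R W} {pc : ℕ} {i : Instr R},
      P.run E ω C k = s.withPc pc → P[pc]? = some i →
        P.run E ω C (k + 1) = i.exec E (ω k) (s.withPc pc) := by
    intro k s pc i h1 h2
    rw [Program.run, h1]
    simp only [Program.step, St.withPc, h2]
  have hjump : ∀ {k : ℕ} {s : St R W} {pc a : ℕ},
      P.run E ω C k = s.withPc pc → P[pc]? = some (.jump a) →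
        P.run E ω C (k + 1) = s.withPc a := by
    intro k s pc a h1 h2
    rw [hstep h1 h2]; rfl
  have hcond : ∀ {k : ℕ} {s : St R W} {pc a : ℕ} {b : Cond R},
      P.run E ω C k = s.withPc pc → P[pc]? = some (b.jump a) → b.Holds s →
        P.run E ω C (k + 1) = s.withPc a := by
    intro k s pc a b h1 h2 h3
    rw [hstep h1 h2]
    cases b <;> simp_all [Cond.jump, Instr.exec, St.withPc]
  have hncond : ∀ {k : ℕ} {s : St R W} {pc a : ℕ} {b : Cond R},
      P.run E ω C k = s.withPc pc → P[pc]? = some (b.jump a) → ¬ b.Holds s →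
        P.run E ω C (k + 1) = s.withPc (pc + 1) := by
    intro k s pc a b h1 h2 h3
    rw [hstep h1 h2]
    cases b <;> simp_all [Cond.jump, Instr.exec, St.withPc, not_lt.2]
  induction h with
  | skip k s => intro a _ h; exact ⟨h, fun j h1 h2 => absurd h1 (by omega)⟩
  | ins i k s hi hI =>
    intro a hcode h
    refine ⟨by rw [hstep h hcode.head, s.exec_withPc E _ hi]; rfl, fun j h1 h2 => ?_⟩
    obtain rfl : j = k := by omega
    exact ⟨s, a, hI, h⟩
  | @seq c d k s k₁ s₁ k₂ s₂ h₁ h₂ ih₁ ih₂ =>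
    intro a hcode h
    obtain ⟨e1, i1⟩ := ih₁ hcode.left h
    have hr := hcode.right
    rw [Cmd.length_compile] at hr
    obtain ⟨e2, i2⟩ := ih₂ hr e1
    refine ⟨by rw [e2, Cmd.len, add_assoc], fun j h1 h2 => ?_⟩
    rcases lt_or_ge j k₁ with hj | hj
    · exact i1 j h1 hj
    · exact i2 j hj h2
  | @iteTrue b c d k s k₁ s₁ hb hI h' ih =>
    intro a hcode h
    have hr := hcode.tail.right.tail
    rw [Cmd.length_compile, show a + 1 + d.len + 1 = a + d.len + 2 by ring] at hr
    obtain ⟨e1, i1⟩ := ih hr (hcond h hcode.head hb)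
    refine ⟨by rw [e1, Cmd.len]; congr 1; ring, fun j h1 h2 => ?_⟩
    rcases eq_or_lt_of_le h1 with rfl | hj
    · exact ⟨s, a, hI, h⟩
    · exact i1 j hj h2
  | @iteFalse b c d k s k₁ s₁ hb hI h' hI' ih =>
    intro a hcode h
    obtain ⟨e1, i1⟩ := ih hcode.tail.left (hncond h hcode.head hb)
    have hr := hcode.tail.right.head
    rw [Cmd.length_compile] at hr
    have e2 := hjump e1 hr
    refine ⟨by rw [e2, Cmd.len]; congr 1; ring, fun j h1 h2 => ?_⟩
    rcases eq_or_lt_of_le h1 with rfl | hj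
    · exact ⟨s, a, hI, h⟩
    · rcases lt_or_ge j k₁ with hj' | hj'
      · exact i1 j hj hj'
      · obtain rfl : j = k₁ := by omega
        exact ⟨s₁, _, hI', e1⟩
  | @loopTrue x y c k s k₁ s₁ k₂ s₂ hb hI h₁ hI' h₂ ih₁ ih₂ =>
    intro a hcode h
    obtain ⟨e1, i1⟩ := ih₁ hcode.tail.tail.left (hcond (b := .lt x y) h hcode.head hb)
    have hr := hcode.tail.tail.right.head
    rw [Cmd.length_compile] at hr
    have e2 := hjump e1 hr
    obtain ⟨e3, i3⟩ := ih₂ hcode e2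
    refine ⟨e3, fun j h1 h2 => ?_⟩
    rcases eq_or_lt_of_le h1 with rfl | hj
    · exact ⟨s, a, hI, h⟩
    · rcases lt_or_ge j k₁ with hj' | hj'
      · exact i1 j hj hj'
      · rcases eq_or_lt_of_le hj' with rfl | hj''
        · exact ⟨s₁, _, hI', e1⟩
        · exact i3 j hj'' h2
  | @loopFalse x y c k s hb hI =>
    intro a hcode h
    have e1 := hncond (b := .lt x y) h hcode.head hb
    have e2 := hjump e1 hcode.tail.head
    refine ⟨by rw [e2, Cmd.len]; rfl, fun j h1 h2 => ?_⟩
    rcases eq_or_lt_of_le h1 with rfl | hj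
    · exact ⟨s, a, hI, h⟩
    · obtain rfl : j = k + 1 := by omega
      exact ⟨s, _, hI, e1⟩

/-! ### Renaming registers -/

section Map

variable {R' : Type} [DecidableEq R']

/-- Rename the registers of an instruction. -/
def Instr.map (f : R → R') : Instr R → Instr R'
  | .const dst a => .const (f dst) a
  | .arg dst j => .arg (f dst) j
  | .copy dst src => .copy (f dst) (f src)
  | .arith o dst x y => .arith o (f dst) (f x) (f y)
  | .jump a => .jump a
  | .jumpLt x y a => .jumpLt (f x) (f y) a
  | .jumpEq x y a => .jumpEq (f x) (f y) a
  | .catRead dst a => .catRead (f dst) (f a)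
  | .catWrite a src => .catWrite (f a) (f src)
  | .coin dst => .coin (f dst)
  | .inDeg dst v => .inDeg (f dst) (f v)
  | .outDeg dst v => .outDeg (f dst) (f v)
  | .inNbr dst v i => .inNbr (f dst) (f v) (f i)
  | .outNbr dst v i => .outNbr (f dst) (f v) (f i)
  | .halt b => .halt b

/-- Rename the registers of a condition. -/
def Cond.map (f : R → R') : Cond R → Cond R'
  | .lt x y => .lt (f x) (f y)
  | .eq x y => .eq (f x) (f y)

/-- Rename the registers of a command. -/
def Cmd.map (f : R → R') : Cmd R → Cmd R'
  | .skip => .skip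
  | .ins i => .ins (i.map f)
  | .seq c d => .seq (c.map f) (d.map f)
  | .ite b c d => .ite (b.map f) (c.map f) (d.map f)
  | .loop x y c => .loop (f x) (f y) (c.map f)

/-- The part of the memory seen through a renaming. -/
def St.comap (f : R → R') (s : St R' W) : St R W := ⟨fun r => s.reg (f r), s.cat⟩

theorem St.comap_exec {f : R → R'} (hf : Function.Injective f) (E : Env n) (b : Bool)
    (s : St R' W) (i : Instr R) :
    (s.exec E b (i.map f)).comap f = (s.comap f).exec E b i := by
  have h : ∀ (g : R' → ℕ) (r : R) (v : ℕ),
      (fun x => Function.update g (f r) v (f x)) = Function.update (fun x => g (f x)) r v := by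
    intro g r v; funext x; simp [Function.update_apply, hf.eq_iff]
  cases i <;> simp [exec, comap, Instr.map, Instr.exec, Config.put, withPc, h] <;> rfl

omit [DecidableEq R] in
theorem St.exec_map_of_notMem {f : R → R'} (E : Env n) (b : Bool) (s : St R' W) (i : Instr R)
    {r : R'} (hr : r ∉ Set.range f) : (s.exec E b (i.map f)).reg r = s.reg r := by
  have hr' : ∀ x, r ≠ f x := fun x h => hr ⟨x, h.symm⟩
  cases i <;> simp [exec, Instr.map, Instr.exec, Config.put, withPc, hr']

omit [DecidableEq R] [DecidableEq R'] in
theorem Cond.holds_map {f : R → R'} (b : Cond R) (s : St R' W) :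
    (b.map f).Holds s ↔ b.Holds (s.comap f) := by
  cases b <;> rfl

/-- A run of a command gives a run of the renamed command. -/
theorem Run.map {E : Env n} {ω : ℕ → Bool} {I : St R W → Prop} {c : Cmd R} {k k' : ℕ}
    {s s' : St R W} (h : Run E ω I c k s k' s') {f : R → R'} (hf : Function.Injective f) :
    ∀ {S : St R' W}, S.comap f = s → ∃ S' : St R' W,
      Run E ω (fun S => I (S.comap f)) (c.map f) k S k' S' ∧ S'.comap f = s' ∧
        ∀ r, r ∉ Set.range f → S'.reg r = S.reg r := by
  induction h with
  | skip k s => rintro S rfl; exact ⟨S, .skip _ _, rfl, fun _ _ => rfl⟩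
  | ins i k s hi hI =>
    rintro S rfl
    refine ⟨_, .ins _ _ _ ?_ hI, S.comap_exec hf E _ i, fun r hr => S.exec_map_of_notMem E _ i hr⟩
    cases i <;> simp_all [Instr.IsPlain, Instr.map]
  | seq h₁ h₂ ih₁ ih₂ =>
    rintro S hS
    obtain ⟨S₁, r1, e1, f1⟩ := ih₁ hS
    obtain ⟨S₂, r2, e2, f2⟩ := ih₂ e1
    exact ⟨S₂, .seq r1 r2, e2, fun r hr => by rw [f2 r hr, f1 r hr]⟩
  | iteTrue hb hI h ih =>
    rintro S rfl
    obtain ⟨S₁, r1, e1, f1⟩ := ih rfl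
    exact ⟨S₁, .iteTrue ((Cond.holds_map _ _).2 hb) hI r1, e1, f1⟩
  | iteFalse hb hI h hI' ih =>
    rintro S rfl
    obtain ⟨S₁, r1, e1, f1⟩ := ih rfl
    exact ⟨S₁, .iteFalse (fun h => hb ((Cond.holds_map _ _).1 h)) hI r1
      (by subst e1; exact hI'), e1, f1⟩
  | loopTrue hb hI h hI' h' ih ih' =>
    rintro S rfl
    obtain ⟨S₁, r1, e1, f1⟩ := ih rfl
    obtain ⟨S₂, r2, e2, f2⟩ := ih' e1
    exact ⟨S₂, .loopTrue hb hI r1 (by subst e1; exact hI') r2, e2,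
      fun r hr => by rw [f2 r hr, f1 r hr]⟩
  | loopFalse hb hI => rintro S rfl; exact ⟨S, .loopFalse hb hI, rfl, fun _ _ => rfl⟩

end Map

/-! ### Verification rules -/

/-- From memory `s` the command `c` terminates within `t` steps, whatever the coins, in a memory
that satisfies `Q`, and `I` holds all the time before. -/
def WP (E : Env n) (I : St R W → Prop) (c : Cmd R) (t : ℕ) (s : St R W) (Q : St R W → Prop) :
    Prop :=
  ∃ d s', d ≤ t ∧ Q s' ∧ ∀ ω k, Run E ω I c k s (k + d) s'

namespace WP

variable {E : Env n} {I : St R W → Prop} {c d : Cmd R} {t t' : ℕ} {s : St R W}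
  {Q Q' : St R W → Prop}

theorem skip (h : Q s) : WP E I .skip t s Q := ⟨0, s, by omega, h, fun _ _ => .skip _ _⟩

theorem ins {i : Instr R} (hi : (i.IsPlain && i.NoCoin) = true) (hI : I s)
    (h : Q (s.exec E false i)) (ht : 1 ≤ t) :
    WP E I (.ins i) t s Q := by
  simp only [Bool.and_eq_true] at hi
  exact ⟨1, _, ht, h, fun ω k => by
    rw [s.exec_noCoin E false (ω k) i hi.2]; exact .ins _ _ _ hi.1 hI⟩

theorem imp (h : WP E I c t s Q) (ht : t ≤ t') (hQ : ∀ s, Q s → Q' s) : WP E I c t' s Q' := by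
  obtain ⟨d, s', h1, h2, h3⟩ := h
  exact ⟨d, s', h1.trans ht, hQ _ h2, h3⟩

theorem seq {t₁ t₂ : ℕ} (h : WP E I c t₁ s fun s' => WP E I d t₂ s' Q) (ht : t₁ + t₂ ≤ t) :
    WP E I (.seq c d) t s Q := by
  obtain ⟨d₁, s₁, h1, ⟨d₂, s₂, h4, h5, h6⟩, h3⟩ := h
  refine ⟨d₁ + d₂, s₂, by omega, h5, fun ω k => .seq (h3 ω k) ?_⟩
  rw [← add_assoc]; exact h6 ω _

theorem ite {b : Cond R} (hI : I s) (h : b.Holds s → WP E I c t s Q)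
    (h' : ¬ b.Holds s → WP E I d t s fun s' => I s' ∧ Q s') (ht : t + 2 ≤ t') :
    WP E I (.ite b c d) t' s Q := by
  by_cases hb : b.Holds s
  · obtain ⟨d₁, s₁, h1, h2, h3⟩ := h hb
    refine ⟨d₁ + 1, s₁, by omega, h2, fun ω k => .iteTrue hb hI ?_⟩
    rw [add_comm d₁, ← add_assoc]; exact h3 _ _
  · obtain ⟨d₁, s₁, h1, h2, h3⟩ := h' hb
    refine ⟨d₁ + 2, s₁, by omega, h2.2, fun ω k => ?_⟩
    rw [show k + (d₁ + 2) = (k + 1 + d₁) + 1 by ring]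
    exact .iteFalse hb hI (h3 _ _) h2.1

/-- A loop whose body lowers a counter. -/
theorem loop {x y : R} (J : ℕ → St R W → Prop) (tb : ℕ)
    (hstep : ∀ j s, J (j + 1) s → I s ∧ s.reg x < s.reg y ∧
      WP E I c tb s fun s' => I s' ∧ J j s')
    (hend : ∀ s, J 0 s → I s ∧ ¬ s.reg x < s.reg y ∧ Q s) :
    ∀ (N : ℕ) (s : St R W), J N s → N * (tb + 2) + 2 ≤ t → WP E I (.loop x y c) t s Q := by
  intro N
  induction N generalizing t with
  | zero =>
    intro s hs ht
    obtain ⟨h1, h2, h3⟩ := hend s hs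
    exact ⟨2, s, by omega, h3, fun ω k => .loopFalse h2 h1⟩
  | succ N ih =>
    intro s hs ht
    obtain ⟨h1, h2, d₁, s₁, h3, h4, h5⟩ := hstep N s hs
    obtain ⟨d₂, s₂, h6, h7, h8⟩ := ih (t := N * (tb + 2) + 2) s₁ h4.2 le_rfl
    refine ⟨1 + d₁ + 1 + d₂, s₂, ?_, h7, fun ω k => ?_⟩
    · have : (N + 1) * (tb + 2) = N * (tb + 2) + (tb + 2) := by ring
      omega
    · rw [show k + (1 + d₁ + 1 + d₂) = (k + 1 + d₁ + 1) + d₂ by ring]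
      exact .loopTrue h2 h1 (h5 _ _) h4.1 (h8 _ _)

/-- A loop whose body lowers a measure. -/
theorem loop_measure {x y : R} (J : St R W → Prop) (μ : St R W → ℕ) (tb : ℕ)
    (hI : ∀ s, J s → I s)
    (hstep : ∀ s, J s → s.reg x < s.reg y → WP E I c tb s fun s' => J s' ∧ μ s' < μ s)
    (hend : ∀ s, J s → ¬ s.reg x < s.reg y → Q s) :
    ∀ (N : ℕ) (s : St R W), μ s ≤ N → J s → N * (tb + 2) + 2 ≤ t →
      WP E I (.loop x y c) t s Q := by
  intro N
  induction N generalizing t with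
  | zero =>
    intro s hN hs ht
    by_cases h : s.reg x < s.reg y
    · obtain ⟨d, s', -, h2, -⟩ := hstep s hs h
      omega
    · exact ⟨2, s, by omega, hend s hs h, fun ω k => .loopFalse h (hI s hs)⟩
  | succ N ih =>
    intro s hN hs ht
    have e : (N + 1) * (tb + 2) = N * (tb + 2) + (tb + 2) := by ring
    by_cases h : s.reg x < s.reg y
    · obtain ⟨d₁, s₁, h3, h4, h5⟩ := hstep s hs h
      obtain ⟨d₂, s₂, h6, h7, h8⟩ := ih (t := N * (tb + 2) + 2) s₁ (by omega) h4.1 le_rfl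
      refine ⟨1 + d₁ + 1 + d₂, s₂, by omega, h7, fun ω k => ?_⟩
      rw [show k + (1 + d₁ + 1 + d₂) = (k + 1 + d₁ + 1) + d₂ by ring]
      exact .loopTrue h (hI s hs) (h5 _ _) (hI _ h4.1) (h8 _ _)
    · exact ⟨2, s, by omega, hend s hs h, fun ω k => .loopFalse h (hI s hs)⟩

/-- Straight-line code is verified by symbolic execution: the final memory is an explicit fold,
which `simp` evaluates. -/
theorem block (L : List (Instr R)) (hL : (L.all fun i => i.IsPlain && i.NoCoin) = true)
    (h : Q (L.foldl (fun s i => s.exec E false i) s)) (ht : L.length ≤ t) :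
    WP E (fun _ => True) (.block L) t s Q := by
  induction L generalizing s t with
  | nil => exact .skip h
  | cons i L ih =>
    simp only [List.all_cons, Bool.and_eq_true] at hL
    simp only [List.length_cons] at ht
    exact .seq (t₁ := 1) (t₂ := t - 1)
      (.ins (by simp [hL.1]) trivial (ih hL.2 h (by omega)) le_rfl) (by omega)

theorem frame (h : WP E I c t s Q) : WP E I c t s fun s' =>
    Q s' ∧ (∀ r, r ∉ c.writes → s'.reg r = s.reg r) ∧
      ((∀ r, s.reg r < 2 ^ E.w) → ∀ r, s'.reg r < 2 ^ E.w) ∧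
      (c.all Instr.NoWrite = true → s'.cat = s.cat) := by
  obtain ⟨d, s', h1, h2, h3⟩ := h
  have h4 := h3 (fun _ => false) 0
  exact ⟨d, s', h1, ⟨h2, h4.frame, h4.reg_lt, h4.cat_eq⟩, h3⟩

theorem seq_frame {t₁ t₂ : ℕ} {P : St R W → Prop} (h : WP E I c t₁ s P)
    (h' : ∀ s', P s' → (∀ r, r ∉ c.writes → s'.reg r = s.reg r) →
      ((∀ r, s.reg r < 2 ^ E.w) → ∀ r, s'.reg r < 2 ^ E.w) →
      (c.all Instr.NoWrite = true → s'.cat = s.cat) → WP E I d t₂ s' Q) (ht : t₁ + t₂ ≤ t) :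
    WP E I (.seq c d) t s Q :=
  .seq (h.frame.imp le_rfl fun s' ⟨h1, h2, h3, h4⟩ => h' s' h1 h2 h3 h4) ht

theorem strengthen (h : WP E (fun _ => True) c t s Q) (hc : c.all Instr.NoWrite = true)
    {L : List R} (hL : ∀ r ∈ c.writes, r ∈ L)
    (hI : ∀ s'' : St R W, s''.cat = s.cat → (∀ r, r ∉ L → s''.reg r = s.reg r) → I s'') :
    WP E I c t s fun s' => Q s' ∧ I s' := by
  obtain ⟨d, s', h1, h2, h3⟩ := h
  have h4 := h3 (fun _ => false) 0
  exact ⟨d, s', h1, ⟨h2, hI s' (h4.cat_eq hc) fun r hr => h4.frame r fun h => hr (hL r h)⟩,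
    fun ω k => (h3 ω k).strengthen hc hL hI⟩

theorem map {R' : Type} [DecidableEq R'] {f : R → R'} (hf : Function.Injective f) {S : St R' W}
    (h : WP E I c t (S.comap f) Q) :
    WP E (fun S => I (S.comap f)) (c.map f) t S fun S' =>
      Q (S'.comap f) ∧ ∀ r, r ∉ Set.range f → S'.reg r = S.reg r := by
  obtain ⟨d, s', h1, h2, h3⟩ := h
  obtain ⟨S', -, e1, f1⟩ := (h3 (fun _ => false) 0).map hf (S := S) rfl
  refine ⟨d, S', h1, ⟨e1 ▸ h2, f1⟩, fun ω k => ?_⟩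
  obtain ⟨S'', r2, e2, f2⟩ := (h3 ω k).map hf (S := S) rfl
  -- `WP` demands one final memory for all coins, while `Run.map` yields one for each `ω`. They
  -- agree: the image of `f` is fixed by `s'`, and registers outside it never change.
  have : S'' = S' := by
    have hr : S''.reg = S'.reg := by
      funext r
      by_cases hr : r ∈ Set.range f
      · obtain ⟨x, rfl⟩ := hr
        exact congrFun (congrArg St.reg (e2.trans e1.symm)) x
      · rw [f2 r hr, f1 r hr]
    have hc : S''.cat = S'.cat := congrArg (fun s => s.cat) (e2.trans e1.symm)
    cases S''; cases S'; simp_all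
  rwa [this] at r2

end WP

/-! ### Complete programs -/

/-- The program that executes `c` and then answers whether two registers differ. -/
def Cmd.toProgram (c : Cmd R) (x y : R) : Program R :=
  c.compile 0 ++ [.jumpEq x y (c.len + 2), .halt true, .halt false]

theorem Run.toProgram {E : Env n} {ω : ℕ → Bool} {I : St R W → Prop} {c : Cmd R} {k : ℕ}
    {s s' : St R W} (h : Run E ω I c 0 s k s') (x y : R) (hI : I s') :
    (∀ T, k + 1 ≤ T → (c.toProgram x y).output ((c.toProgram x y).run E ω (s.withPc 0) T) =
        some (decide (s'.reg x ≠ s'.reg y)) ∧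
      ((c.toProgram x y).run E ω (s.withPc 0) T).reg = s'.reg ∧
      ((c.toProgram x y).run E ω (s.withPc 0) T).cat = s'.cat) ∧
    ∀ j, ∃ s₀ pc, I s₀ ∧ (c.toProgram x y).run E ω (s.withPc 0) j = s₀.withPc pc := by
  set P := c.toProgram x y with hP
  have hcode : CodeAt P 0 (c.compile 0 ++ [.jumpEq x y (c.len + 2), .halt true, .halt false]) := by
    intro i z hz
    rw [zero_add]; exact hz
  have htail := hcode.right
  rw [Cmd.length_compile, zero_add] at htail
  obtain ⟨e1, i1⟩ := h.compile hcode.left (C := s.withPc 0) rfl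
  rw [zero_add] at e1
  set pc := if s'.reg x = s'.reg y then c.len + 2 else c.len + 1 with hpc
  have hat : P[pc]? = some (.halt (decide (s'.reg x ≠ s'.reg y))) := by
    by_cases hxy : s'.reg x = s'.reg y
    · simpa [hpc, hxy] using htail.tail.tail.head
    · simpa [hpc, hxy] using htail.tail.head
  have e2 : ∀ d, P.run E ω (s.withPc 0) (k + 1 + d) = s'.withPc pc := by
    intro d
    induction d with
    | zero =>
      rw [add_zero, Program.run, e1]
      simp only [Program.step, St.withPc, htail.head, Instr.exec, hpc]
      rfl
    | succ d ih =>
      rw [← add_assoc, Program.run, ih]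
      simp only [Program.step, St.withPc, hat, Instr.exec]
  have e3 : ∀ T, k + 1 ≤ T → P.run E ω (s.withPc 0) T = s'.withPc pc := fun T hT => by
    have := e2 (T - (k + 1))
    rwa [Nat.add_sub_cancel' hT] at this
  refine ⟨fun T hT => ?_, fun j => ?_⟩
  · rw [e3 T hT]
    refine ⟨?_, rfl, rfl⟩
    simp only [Program.output, St.withPc, hat]
  · rcases lt_or_ge j k with hj | hj
    · exact i1 j (by omega) hj
    · rcases eq_or_lt_of_le hj with rfl | hj
      · exact ⟨s', _, hI, e1⟩
      · exact ⟨s', _, hI, e3 j hj⟩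

end Framework

end Catalytic

namespace Catalytic

/-! ### Words on the catalytic tape -/

section Word

variable {W : ℕ}

/-- The `y`-th block of `w` bits of the tape, read as a binary number. -/
def word (w : ℕ) (cat : Fin W → Bool) (y : ℕ) : ℕ :=
  Nat.ofBits fun b : Fin w => St.bit cat (y * w + b)

theorem word_lt (w : ℕ) (cat : Fin W → Bool) (y : ℕ) : word w cat y < 2 ^ w :=
  Nat.ofBits_lt_two_pow _

theorem testBit_word {w b : ℕ} (hb : b < w) (cat : Fin W → Bool) (y : ℕ) :
    (word w cat y).testBit b = St.bit cat (y * w + b) :=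
  Nat.testBit_ofBits_lt _ _ hb

theorem word_congr {w : ℕ} {cat cat' : Fin W → Bool} {y : ℕ}
    (h : ∀ b < w, St.bit cat (y * w + b) = St.bit cat' (y * w + b)) :
    word w cat y = word w cat' y := by
  simp only [word]
  congr 1
  funext b
  exact h b b.2

/-- Position `i` lies in block `i / w`. All block indices are allowed, so the unused end of the tape
and a partial last block are covered as well. -/
theorem cat_eq_of_word_eq {w : ℕ} (hw : 0 < w) {cat cat' : Fin W → Bool}
    (h : ∀ y, word w cat y = word w cat' y) : cat = cat' := by
  funext i
  have hb := Nat.mod_lt i.1 hw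
  have h1 := testBit_word hb cat (i / w)
  rw [h, testBit_word hb, Nat.div_add_mod'] at h1
  simpa [St.bit] using h1.symm

/-- The Horner step for `readWord`, which collects bits from the most significant one downwards. -/
theorem div_two_pow_eq_testBit (x j : ℕ) :
    x / 2 ^ j = 2 * (x / 2 ^ (j + 1)) + (x.testBit j).toNat := by
  rw [Nat.toNat_testBit, pow_succ, ← Nat.div_div_eq_div_mul]
  omega

end Word

/-! ### Registers and subroutines -/

/-- The work registers. -/
inductive Reg where
  | n | s | t | one | two | zero | wl | m1 | n2 | n3 | sn | tn
  | rnd | p | dl | fr | cur | org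
  | res | prv
  | a | e | b | acc | sum | x | y | u | v | j | d | nx | base | ow | nw | big | qi | qb
  deriving DecidableEq

open Reg

/-- Compute the constants that depend on the input. -/
def setup : Cmd Reg :=
  .block [.arg n 0, .arg s 1, .arg t 2, .const one 1, .const two 2, .const a 1] ;;
  .loop zero a (.block [.arith .add a a a, .arith .add wl wl one, .arith .add m1 m1 m1,
    .arith .add m1 m1 one]) ;;
  .block [.arith .mul n2 n n, .arith .mul n3 n2 n, .inDeg d s, .arith .mul sn s n,
    .arith .add sn sn d, .inDeg d t, .arith .mul tn t n, .arith .add tn tn d, .arith .sub y n3 n2,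
    .arith .add tn tn y]

/-- `acc :=` the word at node `y`. -/
def readWord : Cmd Reg :=
  .block [.arith .mul a y wl, .arith .add e a wl, .copy acc zero] ;;
  .loop a e (.block [.arith .sub e e one, .catRead b e, .arith .add acc acc acc,
    .arith .add acc acc b])

/-- Write the word `nw` at node `x`. -/
def writeWord : Cmd Reg :=
  .block [.arith .mul a x wl, .arith .add e a wl, .copy u nw] ;;
  .loop a e (.ins (.arith .mod b u two) ;; .ins (.catWrite a b) ;; .ins (.arith .div u u two) ;;
    .ins (.arith .add a a one))

/-- Add the value of node `y` to `sum`. -/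
def addValue : Cmd Reg :=
  readWord ;;
  .block [.arith .add acc acc rnd, .arith .mod acc acc p, .arith .add sum sum acc] ;;
  .ite (.eq y sn) (.block [.arith .add sum sum dl]) .skip

/-- `sum :=` the total value of the nodes that feed node `x`. -/
def computeAddend : Cmd Reg :=
  .block [.arith .div d x n, .arith .mod v d n, .arith .mod j x n, .arith .div base x n2,
    .arith .sub base base one, .arith .mul base base n2, .copy sum zero, .copy u v] ;;
  .ite (.lt zero j)
    (.block [.arith .sub d j one, .inNbr u v d, .arith .sub y x one] ;; addValue) .skip ;;
  .block [.inDeg d u, .arith .mul y u n, .arith .add y y d, .arith .add y base y] ;;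
  addValue

/-- `nx :=` the node after the active node `fr`. -/
def computeNext : Cmd Reg :=
  .block [.arith .mod j fr n, .arith .div v fr n, .arith .add nx v one, .arith .mul nx nx n,
    .arith .mod v v n, .inDeg d v] ;;
  .ite (.lt j d) (.block [.arith .add nx fr one]) .skip

/-- `x :=` the active node before `fr`. -/
def computePrev : Cmd Reg :=
  .block [.arith .mod j fr n, .arith .sub x fr one] ;;
  .ite (.eq j zero) (.block [.arith .div v fr n, .arith .sub v v one, .arith .mul x v n,
    .arith .mod v v n, .inDeg d v, .arith .add x x d]) .skip

/-! ### The layered network -/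

section Network

variable {n : ℕ} (G : OracleDigraph n)

/-- A node `(i * n + v) * n + j` stands for the `j`-th position in the chain of in-neighbours of
vertex `v` in layer `i`; it is active if that position exists and the layer is positive. -/
def Active (x : ℕ) : Prop := n ^ 2 ≤ x ∧ x < n ^ 3 ∧ x % n ≤ G.inDeg (x / n % n)

/-- The node of the previous layer that feeds a node. -/
def source (x : ℕ) : ℕ :=
  let u := if 0 < x % n then G.inNbr (x / n % n) (x % n - 1) else x / n % n
  (x / n ^ 2 - 1) * n ^ 2 + (u * n + G.inDeg u)

/-- The value of node `y` when the tape holds the words `g`. -/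
def nodeValue (w rnd p dl sn : ℕ) (g : ℕ → ℕ) (y : ℕ) : ℕ :=
  (g y + rnd) % 2 ^ w % p + if y = sn then dl else 0

/-- What is added to the word of an active node `x`. -/
def addend (w rnd p dl sn : ℕ) (g : ℕ → ℕ) (x : ℕ) : ℕ :=
  (if 0 < x % n then nodeValue w rnd p dl sn g (x - 1) else 0) +
    nodeValue w rnd p dl sn g (source G x)

/-- The node after `x` in the order of processing. -/
def nextNode (x : ℕ) : ℕ := if x % n < G.inDeg (x / n % n) then x + 1 else (x / n + 1) * n

/-- The node before `x` in the order of processing. -/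
def prevNode (x : ℕ) : ℕ :=
  if x % n = 0 then (x / n - 1) * n + G.inDeg ((x / n - 1) % n) else x - 1

/-- The last node of the chain of vertex `v` in layer `i`. -/
def topNode (i v : ℕ) : ℕ := (i * n + v) * n + G.inDeg v

/-- Simplicity enters here: in-neighbours are distinct and differ from `v`. Hence the positions `0,
…, inDeg v` of a chain fit into `n` slots. -/
theorem OracleDigraph.inDeg_lt (hn : 0 < n) (v : ℕ) : G.inDeg v < n := by
  unfold OracleDigraph.inDeg
  split
  · rename_i h
    have h1 : (G.inList ⟨v, h⟩).toFinset ⊆ Finset.univ.erase ⟨v, h⟩ := by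
      intro u hu
      rw [List.mem_toFinset, G.mem_inList] at hu
      refine Finset.mem_erase.2 ⟨?_, Finset.mem_univ _⟩
      rintro rfl
      exact G.loopless _ hu
    have h2 := Finset.card_le_card h1
    rw [List.toFinset_card_of_nodup (G.inList_nodup _), Finset.card_erase_of_mem (Finset.mem_univ _),
      Finset.card_univ, Fintype.card_fin] at h2
    omega
  · exact hn

theorem OracleDigraph.inNbr_lt {v i : ℕ} (hv : v < n) (hi : i < G.inDeg v) : G.inNbr v i < n := by
  unfold OracleDigraph.inDeg at hi
  unfold OracleDigraph.inNbr
  rw [dif_pos hv] at hi ⊢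
  rw [List.getElem?_eq_getElem hi]
  exact Fin.is_lt _

variable {G}

/-- The feeding chain is in the layer below, and a layer occupies a full block of `n ^ 2` addresses.
This makes the network acyclic, so processing in address order is reversible. -/
theorem source_lt {x : ℕ} (hn : 0 < n) (hx : Active G x) : source G x < x := by
  obtain ⟨h1, h2, h3⟩ := hx
  set u := if 0 < x % n then G.inNbr (x / n % n) (x % n - 1) else x / n % n with hu
  have hv : x / n % n < n := Nat.mod_lt _ hn
  have hun : u < n := by
    rw [hu]; split
    · exact G.inNbr_lt hv (by omega)
    · exact hv
  have hd := G.inDeg_lt hn u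
  have h4 : u * n + G.inDeg u < n ^ 2 := by nlinarith
  have h5 : 0 < x / n ^ 2 := Nat.div_pos h1 (by positivity)
  have h6 := Nat.div_mul_le_self x (n ^ 2)
  have h7 : source G x = (x / n ^ 2 - 1) * n ^ 2 + (u * n + G.inDeg u) := rfl
  rw [h7]
  obtain ⟨q, hq⟩ : ∃ q, x / n ^ 2 = q + 1 := ⟨_, (Nat.succ_pred_eq_of_pos h5).symm⟩
  rw [hq] at h6 ⊢
  simp only [Nat.add_sub_cancel]
  nlinarith

end Network

/-- The word length suits the number of vertices and the length of the tape. -/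
structure Fits (n W w : ℕ) : Prop where
  two_le : 2 ≤ n
  cube_le : n ^ 3 * w ≤ W
  lt_pow : W + w < 2 ^ w
  big_lt : n ^ 1024 < 2 ^ w
  pos : 0 < w

/-- The memory holds the constants computed by `setup`. -/
structure Ready {n W : ℕ} (E : Env n) (s t : ℕ) (m : St Reg W) : Prop where
  n_eq : m.reg Reg.n = n
  one_eq : m.reg Reg.one = 1
  two_eq : m.reg Reg.two = 2
  zero_eq : m.reg Reg.zero = 0
  wl_eq : m.reg Reg.wl = E.w
  m1_eq : m.reg Reg.m1 = 2 ^ E.w - 1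
  n2_eq : m.reg Reg.n2 = n ^ 2
  n3_eq : m.reg Reg.n3 = n ^ 3
  sn_eq : m.reg Reg.sn = topNode E.graph 0 s
  tn_eq : m.reg Reg.tn = topNode E.graph (n - 1) t
  lt : ∀ r, m.reg r < 2 ^ E.w

theorem Ready.of_frame {n W : ℕ} {E : Env n} {s t : ℕ} {m m' : St Reg W} (h : Ready E s t m)
    {L : List Reg} (hf : ∀ r, r ∉ L → m'.reg r = m.reg r) (hlt : ∀ r, m'.reg r < 2 ^ E.w)
    (hL : (L.all fun r => decide (r ∉ [Reg.n, .one, .two, .zero, .wl, .m1, .n2, .n3, .sn, .tn])) =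
      true) : Ready E s t m' := by
  have h' : ∀ r, r ∈ [Reg.n, .one, .two, .zero, .wl, .m1, .n2, .n3, .sn, .tn] →
      m'.reg r = m.reg r := by
    intro r hr
    refine hf r fun hr' => ?_
    have := List.all_eq_true.1 hL r hr'
    simp only [decide_eq_true_eq] at this
    exact this hr
  constructor
  · rw [h' _ (by decide)]; exact h.n_eq
  · rw [h' _ (by decide)]; exact h.one_eq
  · rw [h' _ (by decide)]; exact h.two_eq
  · rw [h' _ (by decide)]; exact h.zero_eq
  · rw [h' _ (by decide)]; exact h.wl_eq
  · rw [h' _ (by decide)]; exact h.m1_eq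
  · rw [h' _ (by decide)]; exact h.n2_eq
  · rw [h' _ (by decide)]; exact h.n3_eq
  · rw [h' _ (by decide)]; exact h.sn_eq
  · rw [h' _ (by decide)]; exact h.tn_eq
  · exact hlt

/-! ### Correctness and running time of the subroutines -/

section Specs

variable {n W : ℕ} {E : Env n} {m : St Reg W}

theorem readWord_spec (hW : W + E.w < 2 ^ E.w) (hone : m.reg one = 1) (hzero : m.reg zero = 0)
    (hwl : m.reg wl = E.w) (hy : m.reg y * E.w ≤ W) :
    WP E (fun _ => True) readWord (6 * E.w + 5) m fun m' =>
      m'.reg acc = word E.w m.cat (m.reg y) := by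
  have hlt : m.reg y * E.w + E.w < 2 ^ E.w := by omega
  have hwd := word_lt E.w m.cat (m.reg y)
  have hmod1 : m.reg y * E.w % 2 ^ E.w = m.reg y * E.w := Nat.mod_eq_of_lt (by omega)
  have hmod2 := Nat.mod_eq_of_lt hlt
  refine WP.seq (t₁ := 3) (t₂ := 6 * E.w + 2) ?_ (by omega)
  refine WP.block _ rfl ?_ le_rfl
  -- With `j` bits still unread, `acc` holds the word without its `j` lowest bits.
  refine WP.loop (fun j m' => j ≤ E.w ∧ m'.reg a = m.reg y * E.w ∧ m'.reg e = m.reg y * E.w + j ∧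
    m'.reg one = 1 ∧ m'.cat = m.cat ∧ m'.reg acc = word E.w m.cat (m.reg y) / 2 ^ j) 4
    ?_ ?_ E.w _ ?_ (by omega)
  · rintro j m' ⟨hj, ha, he, ho, hc, hacc⟩
    refine ⟨trivial, by omega, WP.block _ rfl ?_ le_rfl⟩
    have h1 : word E.w m.cat (m.reg y) / 2 ^ j < 2 ^ E.w :=
      (Nat.div_le_self _ _).trans_lt hwd
    have h2 := div_two_pow_eq_testBit (word E.w m.cat (m.reg y)) j
    rw [testBit_word (by omega)] at h2
    have h3 : (m.reg y * E.w + j) % 2 ^ E.w = m.reg y * E.w + j := Nat.mod_eq_of_lt (by omega)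
    simp only [List.foldl_cons, List.foldl_nil, St.exec_sub, St.exec_catRead, St.exec_add,
      St.set_reg, St.set_cat, reduceCtorEq, if_true, if_false, ha, he, ho, hc, hacc, true_and,
      Nat.add_succ_sub_one, h3]
    refine ⟨by omega, ?_⟩
    rw [h2]
    simp only [Nat.add_mod_mod, Nat.mod_add_mod]
    rw [Nat.mod_eq_of_lt]
    · ring
    · omega
  · rintro m' ⟨-, ha, he, -, -, hacc⟩
    exact ⟨trivial, by omega, by simpa using hacc⟩
  · simp [hwl, hone, hzero, hmod1, hmod2, Nat.div_eq_of_lt hwd]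

theorem addValue_spec (hW : W + E.w < 2 ^ E.w) (hone : m.reg one = 1) (hzero : m.reg zero = 0)
    (hwl : m.reg wl = E.w) (hy : m.reg y * E.w ≤ W) :
    WP E (fun _ => True) addValue (6 * E.w + 11) m fun m' =>
      m'.reg sum = (m.reg sum + nodeValue E.w (m.reg rnd) (m.reg p) (m.reg dl) (m.reg sn)
        (word E.w m.cat) (m.reg y)) % 2 ^ E.w := by
  refine WP.seq (t₁ := 6 * E.w + 5) (t₂ := 6) ?_ (by omega)
  refine (readWord_spec hW hone hzero hwl hy).frame.imp le_rfl ?_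
  rintro m' ⟨hacc, hf, -, hc⟩
  refine WP.seq (t₁ := 3) (t₂ := 3) ?_ (by omega)
  refine WP.block _ rfl ?_ le_rfl
  have h1 : ∀ z, z % 2 ^ E.w % m.reg p % 2 ^ E.w = z % 2 ^ E.w % m.reg p := fun z =>
    Nat.mod_eq_of_lt ((Nat.mod_le _ _).trans_lt (Nat.mod_lt _ (by positivity)))
  have f1 := hf .y (by decide)
  have f2 := hf .sn (by decide)
  have f3 := hf .dl (by decide)
  have f4 := hf .p (by decide)
  have f5 := hf .rnd (by decide)
  have f6 := hf .sum (by decide)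
  refine WP.ite (t := 1) trivial (fun h => WP.block _ rfl ?_ le_rfl) (fun h => WP.skip ⟨trivial, ?_⟩)
    le_rfl
  · simp [f1, f2] at h
    simp [hacc, f3, f4, f5, f6, nodeValue, h, h1, add_assoc]
  · simp [f1, f2] at h
    simp [hacc, f4, f5, f6, nodeValue, h, h1]

theorem computeAddend_spec {s t : ℕ} (hfit : Fits n W E.w) (hm : Ready E s t m)
    (hx : Active E.graph (m.reg x)) :
    WP E (fun _ => True) computeAddend (12 * E.w + 50) m fun m' =>
      m'.reg sum = addend E.graph E.w (m.reg rnd) (m.reg p) (m.reg dl) (topNode E.graph 0 s)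
        (word E.w m.cat) (m.reg x) % 2 ^ E.w := by
  have hW := hfit.lt_pow
  have hn : 0 < n := by have := hfit.two_le; omega
  have hle : ∀ z, z < n ^ 3 → z * E.w ≤ W := fun z hz =>
    (Nat.mul_le_mul_right _ hz.le).trans hfit.cube_le
  have hn3 : n ^ 3 ≤ W := by
    have := hfit.cube_le; have := hfit.pos; nlinarith [pow_pos hn 3]
  have hxl := hx.2.1
  have hsrc := source_lt hn hx
  have hmod : ∀ z, z ≤ W → z % 2 ^ E.w = z := fun z hz => Nat.mod_eq_of_lt (by omega)
  have hv : m.reg x / n % n < n := Nat.mod_lt _ hn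
  have hj := Nat.mod_lt (m.reg x) hn
  have hnn : n ≤ n ^ 3 := by nlinarith [sq_nonneg n]
  have hb0 : (m.reg x / n ^ 2 - 1) * n ^ 2 ≤ m.reg x :=
    (Nat.mul_le_mul_right _ (Nat.sub_le _ _)).trans (Nat.div_mul_le_self _ _)
  have hd1 : m.reg x / n ≤ m.reg x := Nat.div_le_self _ _
  have hd2 : m.reg x / n ^ 2 ≤ m.reg x := Nat.div_le_self _ _
  set u₀ := if 0 < m.reg x % n then E.graph.inNbr (m.reg x / n % n) (m.reg x % n - 1)
    else m.reg x / n % n with hu0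
  have hu : u₀ < n := by
    rw [hu0]; split
    · exact E.graph.inNbr_lt hv (by have := hx.2.2; omega)
    · exact hv
  have hsrc' : source E.graph (m.reg x) =
    (m.reg x / n ^ 2 - 1) * n ^ 2 + (u₀ * n + E.graph.inDeg u₀) := rfl
  refine WP.seq (t₁ := 8) (t₂ := 12 * E.w + 42) ?_ (by omega)
  refine WP.block _ rfl ?_ le_rfl
  have e1 : m.reg x / n % 2 ^ E.w = m.reg x / n := hmod _ (by omega)
  have e2 : m.reg x / n % n % 2 ^ E.w = m.reg x / n % n := hmod _ (by omega)
  have e3 : m.reg x % n % 2 ^ E.w = m.reg x % n := hmod _ (by omega)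
  have e4 : m.reg x / n ^ 2 % 2 ^ E.w = m.reg x / n ^ 2 := hmod _ (by omega)
  have e5 : (m.reg x / n ^ 2 - 1) % 2 ^ E.w = m.reg x / n ^ 2 - 1 := hmod _ (by omega)
  have e6 : (m.reg x / n ^ 2 - 1) * n ^ 2 % 2 ^ E.w = (m.reg x / n ^ 2 - 1) * n ^ 2 :=
    hmod _ (by omega)
  have e7 : (m.reg x % n - 1) % 2 ^ E.w = m.reg x % n - 1 := hmod _ (by omega)
  have e8 : (m.reg x - 1) % 2 ^ E.w = m.reg x - 1 := hmod _ (by omega)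
  simp only [List.foldl_cons, List.foldl_nil, St.exec_div, St.exec_mod, St.exec_sub, St.exec_mul,
    St.exec_copy, St.set_reg, reduceCtorEq, if_true, if_false, hm.n_eq, hm.n2_eq, hm.one_eq, hm.zero_eq, e1, e2,
    e3, e4, e5, e6, Nat.zero_mod]
  refine WP.seq (t₁ := 6 * E.w + 16) (t₂ := 6 * E.w + 15) (t := 12 * E.w + 42) ?_ (by omega)
  -- Both outcomes of the test `0 < j` lead to a memory of this description, so the second half,
  -- which adds the node from the layer below, is verified only once.
  suffices H : ∀ m₁ : St Reg W, m₁.cat = m.cat →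
      (∀ r, r ∉ computeAddend.writes → m₁.reg r = m.reg r) →
      m₁.reg base = (m.reg x / n ^ 2 - 1) * n ^ 2 → m₁.reg u = u₀ →
      m₁.reg sum = (if 0 < m.reg x % n then nodeValue E.w (m.reg rnd) (m.reg p) (m.reg dl)
        (topNode E.graph 0 s) (word E.w m.cat) (m.reg x - 1) else 0) % 2 ^ E.w →
      WP E (fun _ => True) (.block [.inDeg d u, .arith .mul y u Reg.n, .arith .add y y d,
        .arith .add y base y] ;; addValue) (6 * E.w + 15) m₁ fun m' =>
        m'.reg sum = addend E.graph E.w (m.reg rnd) (m.reg p) (m.reg dl) (topNode E.graph 0 s)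
          (word E.w m.cat) (m.reg x) % 2 ^ E.w by
    refine WP.ite (t := 6 * E.w + 14) trivial (fun h => ?_) (fun h => ?_) (by omega)
    · simp [hm.zero_eq, e3] at h
      refine WP.seq (t₁ := 3) (t₂ := 6 * E.w + 11) ?_ (by omega)
      refine WP.block _ rfl ?_ le_rfl
      refine (addValue_spec hW ?_ ?_ ?_ ?_).frame.imp le_rfl ?_
      · simp [hm.one_eq]
      · simp [hm.zero_eq]
      · simp [hm.wl_eq]
      · simp [hm.one_eq, e8]
        exact hle _ (by omega)
      · rintro m₁ ⟨hs, hf, -, hc⟩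
        have hnb : u₀ = E.graph.inNbr (m.reg x / n % n) (m.reg x % n - 1) := by simp [hu0, h]
        apply H
        · rw [hc rfl]; simp
        · intro r hr
          simp [computeAddend, Cmd.writes, Cmd.block, Instr.writes, addValue, readWord] at hr
          rw [hf r]
          · simp [hr]
          · simp [Cmd.writes, Cmd.block, Instr.writes, addValue, readWord, hr]
        · rw [hf _ (by decide)]; simp [e6]
        · rw [hf _ (by decide)]
          simp [hm.one_eq, e2, e3, e7]
          rw [← hnb]; exact hmod _ (by omega)
        · rw [hs]; simp [h, hm.one_eq, hm.sn_eq, e8]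
    · simp [hm.zero_eq, e3] at h
      refine WP.skip ⟨trivial, ?_⟩
      apply H
      · simp
      · intro r hr
        simp [computeAddend, Cmd.writes, Cmd.block, Instr.writes, addValue, readWord] at hr
        simp [hr]
      · simp [e6]
      · simp [hu0, h, e2]
      · simp [h]
  intro m₁ hc hf hbase hu1 hsum
  refine WP.seq (t₁ := 4) (t₂ := 6 * E.w + 11) ?_ (by omega)
  refine WP.block _ rfl ?_ le_rfl
  have e9 : E.graph.inDeg u₀ % 2 ^ E.w = E.graph.inDeg u₀ := hmod _ (by
    have := E.graph.inDeg_lt hn u₀; omega)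
  have g1 := hf .n (by decide)
  have g2 := hf .one (by decide)
  have g3 := hf .zero (by decide)
  have g4 := hf .wl (by decide)
  have g5 := hf .rnd (by decide)
  have g6 := hf .p (by decide)
  have g7 := hf .dl (by decide)
  have g8 := hf .sn (by decide)
  have ey : ((m.reg x / n ^ 2 - 1) * n ^ 2 + (u₀ * n + E.graph.inDeg u₀)) % 2 ^ E.w =
      source E.graph (m.reg x) := by rw [← hsrc']; exact hmod _ (by omega)
  refine (addValue_spec hW ?_ ?_ ?_ ?_).imp le_rfl ?_
  · simp [g2, hm.one_eq]
  · simp [g3, hm.zero_eq]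
  · simp [g4, hm.wl_eq]
  · simp [hu1, g1, hm.n_eq, hbase, e9, ey]
    exact hle _ (by omega)
  · intro m' h
    rw [h]
    simp [hu1, g1, hm.n_eq, hbase, e9, ey, hsum, g5, g6, g7, g8, hm.sn_eq, hc, addend]

theorem computeNext_spec {s t : ℕ} (hfit : Fits n W E.w) (hm : Ready E s t m)
    (hx : m.reg fr < n ^ 3) :
    WP E (fun _ => True) computeNext 9 m fun m' => m'.reg nx = nextNode E.graph (m.reg fr) := by
  have hW := hfit.lt_pow
  have h2 := hfit.two_le
  have hn : 0 < n := by omega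
  have hn3 : n ^ 3 * 1 ≤ W := (Nat.mul_le_mul_left _ hfit.pos).trans hfit.cube_le
  have hnn : n ≤ n ^ 3 := by nlinarith [sq_nonneg n]
  have hw := hfit.pos
  have hd := E.graph.inDeg_lt hn (m.reg fr / n % n)
  have h3 : m.reg fr / n < n ^ 2 := Nat.div_lt_of_lt_mul (by rw [← pow_succ']; exact hx)
  have h4 : (m.reg fr / n + 1) * n ≤ n ^ 3 := by
    rw [pow_succ]; exact Nat.mul_le_mul_right _ h3
  have h5 : m.reg fr / n + 1 ≤ (m.reg fr / n + 1) * n := Nat.le_mul_of_pos_right _ hn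
  have hj := Nat.mod_lt (m.reg fr) hn
  have hj' := Nat.mod_lt (m.reg fr / n) hn
  have hmod : ∀ z, z ≤ W → z % 2 ^ E.w = z := fun z hz => Nat.mod_eq_of_lt (by omega)
  have e1 := hmod (m.reg fr % n) (by omega)
  have e2 := hmod (m.reg fr / n) (by omega)
  have e3 := hmod (m.reg fr / n + 1) (by omega)
  have e4 := hmod ((m.reg fr / n + 1) * n) (by omega)
  have e5 := hmod (m.reg fr / n % n) (by omega)
  have e6 := hmod (E.graph.inDeg (m.reg fr / n % n)) (by omega)
  have e7 := hmod (m.reg fr + 1) (by omega)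
  refine WP.seq (t₁ := 6) (t₂ := 3) ?_ (by omega)
  refine WP.block _ rfl ?_ le_rfl
  refine WP.ite (t := 1) trivial (fun h => WP.block _ rfl ?_ le_rfl) (fun h => WP.skip ⟨trivial, ?_⟩)
    le_rfl
  · simp [hm.n_eq, hm.one_eq, e1, e2, e5, e6] at h
    simp [hm.n_eq, hm.one_eq, nextNode, h, e7]
  · simp [hm.n_eq, hm.one_eq, e1, e2, e5, e6, -not_lt] at h
    simp [hm.n_eq, hm.one_eq, nextNode, h, e2, e4]

theorem computePrev_spec {s t : ℕ} (hfit : Fits n W E.w) (hm : Ready E s t m)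
    (hx : m.reg fr ≤ n ^ 3) (hx0 : n ≤ m.reg fr) :
    WP E (fun _ => True) computePrev 10 m fun m' => m'.reg x = prevNode E.graph (m.reg fr) := by
  have hW := hfit.lt_pow
  have h2 := hfit.two_le
  have hn : 0 < n := by omega
  have hn3 : n ^ 3 * 1 ≤ W := (Nat.mul_le_mul_left _ hfit.pos).trans hfit.cube_le
  have hnn : n ≤ n ^ 3 := by nlinarith [sq_nonneg n]
  have hd := E.graph.inDeg_lt hn ((m.reg fr / n - 1) % n)
  have hj := Nat.mod_lt (m.reg fr) hn
  have hj' := Nat.mod_lt (m.reg fr / n - 1) hn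
  have h3 : m.reg fr / n ≤ m.reg fr := Nat.div_le_self _ _
  have h4 : m.reg fr / n * n ≤ m.reg fr := Nat.div_mul_le_self _ _
  have h5 : 0 < m.reg fr / n := Nat.div_pos hx0 hn
  have h6 : (m.reg fr / n - 1) * n + n ≤ m.reg fr := by
    rw [← Nat.succ_mul, Nat.succ_eq_add_one, Nat.sub_add_cancel h5]; exact h4
  have hmod : ∀ z, z ≤ W → z % 2 ^ E.w = z := fun z hz => Nat.mod_eq_of_lt (by omega)
  have e1 := hmod (m.reg fr % n) (by omega)
  have e2 := hmod (m.reg fr / n) (by omega)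
  have e3 := hmod (m.reg fr / n - 1) (by omega)
  have e4 := hmod ((m.reg fr / n - 1) * n) (by omega)
  have e5 := hmod ((m.reg fr / n - 1) % n) (by omega)
  have e6 := hmod (E.graph.inDeg ((m.reg fr / n - 1) % n)) (by omega)
  have e7 := hmod (m.reg fr - 1) (by omega)
  have e8 := hmod ((m.reg fr / n - 1) * n + E.graph.inDeg ((m.reg fr / n - 1) % n)) (by omega)
  refine WP.seq (t₁ := 2) (t₂ := 8) ?_ (by omega)
  refine WP.block _ rfl ?_ le_rfl
  refine WP.ite (t := 6) trivial (fun h => WP.block _ rfl ?_ le_rfl) (fun h => WP.skip ⟨trivial, ?_⟩)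
    le_rfl
  · simp [hm.n_eq, hm.zero_eq, e1] at h
    simp [hm.n_eq, hm.one_eq, prevNode, h, e2, e3, e5, e6, e8]
  · simp [hm.n_eq, hm.zero_eq, e1] at h
    simp [hm.one_eq, prevNode, h, e7]

end Specs

/-! ### The order of processing and the number of active nodes -/

section Order

variable {n : ℕ} {G : OracleDigraph n}

theorem lt_nextNode {x : ℕ} (hn : 0 < n) : x < nextNode G x := by
  unfold nextNode
  split
  · omega
  · exact Nat.lt_of_lt_of_eq (Nat.lt_mul_of_div_lt (Nat.lt_succ_self _) hn) rfl

/-- Addresses skipped between `x` and its successor lie in the chain of `x` beyond the in-degree, so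
they are inactive. Advancing the frontier thus adds only `x` to the processed nodes. -/
theorem le_of_active_of_lt_nextNode {x y : ℕ} (hn : 0 < n)
    (hy : Active G y) (hyx : y < nextNode G x) : y ≤ x := by
  unfold nextNode at hyx
  split at hyx
  · omega
  · rename_i h
    by_contra! hlt
    have h1 : y / n = x / n := by
      apply le_antisymm
      · exact Nat.lt_succ_iff.1 ((Nat.div_lt_iff_lt_mul hn).2 hyx)
      · exact Nat.div_le_div_right hlt.le
    have h2 := hy.2.2
    rw [h1] at h2
    have h3 := Nat.div_add_mod x n
    have h4 := Nat.div_add_mod y n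
    rw [h1] at h4
    omega

/-- The possible positions of the frontier. -/
def Stop (G : OracleDigraph n) (x : ℕ) : Prop := Active G x ∨ x = n ^ 3

theorem active_mul {z : ℕ} (hn : 0 < n) (h1 : n ≤ z) (h2 : z < n ^ 2) : Active G (z * n) := by
  refine ⟨?_, ?_, ?_⟩
  · rw [pow_two]; exact Nat.mul_le_mul_right _ h1
  · rw [pow_succ]; exact Nat.mul_lt_mul_of_pos_right h2 hn
  · simp

theorem stop_sq (hn : 2 ≤ n) : Stop G (n ^ 2) := by
  left
  rw [pow_two]
  exact active_mul (by omega) le_rfl (by nlinarith)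

/-- At the end of a chain the successor is position 0 of the next chain, which is always active.
Since `x / n` encodes layer and vertex together, adding one to it also passes from layer to layer;
after the last chain it gives `n ^ 3`. -/
theorem stop_nextNode {x : ℕ} (hn : 0 < n) (hx : Active G x) : Stop G (nextNode G x) := by
  obtain ⟨h1, h2, h3⟩ := hx
  unfold nextNode
  split
  · rename_i h
    left
    have hd := G.inDeg_lt hn (x / n % n)
    have e : x + 1 = (x % n + 1) + n * (x / n) := by have := Nat.mod_add_div x n; omega
    have h4 : (x + 1) / n = x / n := by
      rw [e, Nat.add_mul_div_left _ _ hn, Nat.div_eq_of_lt (by omega), zero_add]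
    have h5 : (x + 1) % n = x % n + 1 := by
      rw [e, Nat.add_mul_mod_self_left, Nat.mod_eq_of_lt (by omega)]
    refine ⟨by omega, ?_, by rw [h4, h5]; omega⟩
    have h6 : x / n < n ^ 2 := Nat.div_lt_of_lt_mul (by rw [← pow_succ']; exact h2)
    have h7 : (x / n + 1) * n ≤ n ^ 3 := by
      rw [pow_succ]; exact Nat.mul_le_mul_right _ h6
    have h8 : (x / n + 1) * n = n * (x / n) + n := by ring
    omega
  · have h6 : x / n < n ^ 2 := Nat.div_lt_of_lt_mul (by rw [← pow_succ']; exact h2)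
    have h7 : n ≤ x / n := (Nat.le_div_iff_mul_le hn).2 (by rw [← pow_two]; exact h1)
    rcases eq_or_lt_of_le (Nat.succ_le_of_lt h6) with h | h
    · right
      rw [show x / n + 1 = n ^ 2 from h, ← pow_succ]
    · left
      exact active_mul hn (by omega) h

/-- At position 0, or at the end `n ^ 3`, the predecessor is the last node of the preceding chain;
otherwise it is the preceding address. The bound `n ^ 2 < x` keeps it out of layer 0. -/
theorem prevNode_spec {x : ℕ} (hn : 2 ≤ n) (hx : Stop G x) (hx2 : n ^ 2 < x) :
    Active G (prevNode G x) ∧ prevNode G x < x ∧ ∀ y, Active G y → y < x → y ≤ prevNode G x := by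
  have hn0 : 0 < n := by omega
  have hx3 : x ≤ n ^ 3 := by rcases hx with h | h; exacts [h.2.1.le, h.le]
  unfold prevNode
  split
  · rename_i h
    obtain ⟨q, rfl⟩ := Nat.dvd_of_mod_eq_zero h
    rw [Nat.mul_div_cancel_left _ hn0]
    have hq : n < q := by
      rw [pow_two] at hx2; exact lt_of_mul_lt_mul_left hx2 (Nat.zero_le _)
    have hq' : q ≤ n ^ 2 := by
      rw [pow_succ'] at hx3; exact le_of_mul_le_mul_left hx3 hn0
    obtain ⟨z, rfl⟩ : ∃ z, q = z + 1 := ⟨q - 1, by omega⟩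
    simp only [Nat.add_sub_cancel]
    have hd := G.inDeg_lt hn0 (z % n)
    have e1 : (z * n + G.inDeg (z % n)) / n = z := by
      rw [add_comm, Nat.add_mul_div_right _ _ hn0, Nat.div_eq_of_lt hd, zero_add]
    have e2 : (z * n + G.inDeg (z % n)) % n = G.inDeg (z % n) := by
      rw [add_comm, Nat.add_mul_mod_self_right, Nat.mod_eq_of_lt hd]
    refine ⟨⟨?_, ?_, ?_⟩, ?_, ?_⟩
    · nlinarith
    · have : (z + 1) * n ≤ n ^ 2 * n := Nat.mul_le_mul_right _ hq'
      have e3 : n ^ 3 = n ^ 2 * n := by ring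
      have e4 : (z + 1) * n = z * n + n := by ring
      omega
    · rw [e1, e2]
    · have e4 : n * (z + 1) = z * n + n := by ring
      omega
    · intro y hy hyx
      have h1 : y / n < z + 1 := (Nat.div_lt_iff_lt_mul hn0).2 (by rw [mul_comm]; exact hyx)
      have h2 := Nat.mod_add_div y n
      rcases eq_or_lt_of_le (Nat.lt_succ_iff.1 h1) with h3 | h3
      · have h4 := hy.2.2
        rw [h3] at h4 h2
        have : n * z = z * n := by ring
        omega
      · have : n * (y / n) + n ≤ z * n := by
          calc n * (y / n) + n = (y / n + 1) * n := by ring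
            _ ≤ z * n := Nat.mul_le_mul_right _ h3
        have := Nat.mod_lt y hn0
        omega
  · rename_i h
    rcases hx with hx | hx
    · have h1 : 0 < x % n := Nat.pos_of_ne_zero h
      have hj := Nat.mod_lt x hn0
      have e : x - 1 = (x % n - 1) + n * (x / n) := by have := Nat.mod_add_div x n; omega
      have h4 : (x - 1) / n = x / n := by
        rw [e, Nat.add_mul_div_left _ _ hn0, Nat.div_eq_of_lt (by omega), zero_add]
      have h5 : (x - 1) % n = x % n - 1 := by
        rw [e, Nat.add_mul_mod_self_left, Nat.mod_eq_of_lt (by omega)]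
      obtain ⟨-, hx4, hx5⟩ := hx
      exact ⟨⟨by omega, by omega, by rw [h4, h5]; omega⟩, by omega, fun y _ hy => by omega⟩
    · exact absurd (by rw [hx, pow_succ]; simp) h

open Classical in
/-- The number of active nodes. -/
noncomputable def numActive (G : OracleDigraph n) : ℕ :=
  ((Finset.range (n ^ 3)).filter (Active G)).card

theorem numEdges_eq_sum : G.numEdges = ∑ v, (G.inList v).length := by
  classical
  have h : {e : Fin n × Fin n | G.Adj e.1 e.2} =
      ((Finset.univ.sigma fun v => (G.inList v).toFinset).image fun p => (p.2, p.1) :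
        Finset (Fin n × Fin n)) := by
    ext ⟨u, v⟩
    simp [G.mem_inList]
  rw [OracleDigraph.numEdges, h, Set.ncard_coe_finset, Finset.card_image_of_injective,
    Finset.card_sigma]
  · exact Finset.sum_congr rfl fun v _ => List.toFinset_card_of_nodup (G.inList_nodup v)
  · rintro ⟨a, b⟩ ⟨c, d⟩ h
    simp only [Prod.mk.injEq] at h
    simp [h]

/-- Splitting an address into layer, vertex and position is injective, and vertex `v` offers `inDeg
v + 1` positions in each of at most `n` layers. The in-degrees sum to the number of edges. -/
theorem numActive_le (hn : 0 < n) : numActive G ≤ n * (n + G.numEdges) := by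
  classical
  have h : ((Finset.range (n ^ 3)).filter (Active G)).card ≤
      ((Finset.range n) ×ˢ (Finset.univ.sigma fun v : Fin n =>
        Finset.range (G.inDeg v + 1))).card := by
    refine Finset.card_le_card_of_injOn
      (fun x => (x / n / n, ⟨⟨x / n % n, Nat.mod_lt _ hn⟩, x % n⟩)) ?_ ?_
    · intro x hx
      simp only [Finset.coe_filter, Set.mem_ofPred_eq] at hx
      obtain ⟨-, h1, h2, h3⟩ := hx
      simp only [Finset.coe_product, Set.mem_prod, Finset.coe_range, Set.mem_Iio, Finset.mem_coe,
        Finset.mem_sigma, Finset.mem_univ, Finset.mem_range, true_and]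
      refine ⟨?_, by omega⟩
      rw [Nat.div_div_eq_div_mul]
      exact Nat.div_lt_of_lt_mul (by nlinarith)
    · intro x _ y _ hxy
      simp only [Prod.mk.injEq, Sigma.mk.injEq, Fin.mk.injEq, heq_eq_eq] at hxy
      obtain ⟨h1, h2, h3⟩ := hxy
      have h4 := Nat.div_add_mod (x / n) n
      have h5 := Nat.div_add_mod (y / n) n
      rw [h1, h2, h5] at h4
      have h6 := Nat.div_add_mod x n
      have h7 := Nat.div_add_mod y n
      rw [← h4, h3, h7] at h6
      exact h6.symm
  refine h.trans (le_of_eq ?_)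
  rw [Finset.card_product, Finset.card_range, Finset.card_sigma, numEdges_eq_sum]
  simp only [Finset.card_range, Finset.sum_add_distrib, Finset.sum_const, Finset.card_univ,
    Fintype.card_fin, smul_eq_mul, mul_one]
  rw [add_comm n]
  congr 2
  exact Finset.sum_congr rfl fun v _ => by simp [OracleDigraph.inDeg]

open Classical in
/-- The number of active nodes from `x` on. -/
noncomputable def numFrom (G : OracleDigraph n) (x : ℕ) : ℕ :=
  ((Finset.range (n ^ 3)).filter fun y => Active G y ∧ x ≤ y).card

open Classical in
/-- The number of active nodes before `x`. -/
noncomputable def numBefore (G : OracleDigraph n) (x : ℕ) : ℕ :=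
  ((Finset.range (n ^ 3)).filter fun y => Active G y ∧ y < x).card

theorem numFrom_le (x : ℕ) : numFrom G x ≤ numActive G :=
  Finset.card_le_card fun y hy => by simp_all

theorem numBefore_le (x : ℕ) : numBefore G x ≤ numActive G :=
  Finset.card_le_card fun y hy => by simp_all

/-- Termination measure of the forward loop; `numBefore_lt` plays this role for the backward loop.
-/
theorem numFrom_nextNode {x : ℕ} (hn : 0 < n) (hx : Active G x) :
    numFrom G (nextNode G x) < numFrom G x := by
  apply Finset.card_lt_card
  refine Finset.ssubset_iff_subset_ne.2 ⟨?_, ?_⟩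
  · intro y hy
    simp only [Finset.mem_filter] at hy ⊢
    have := lt_nextNode (G := G) (x := x) hn
    exact ⟨hy.1, hy.2.1, by omega⟩
  · intro h
    have h1 := (Finset.ext_iff.1 h x).2 (by simp [hx, hx.2.1])
    simp only [Finset.mem_filter] at h1
    have := lt_nextNode (G := G) (x := x) hn
    omega

theorem numBefore_lt {x z : ℕ} (hz : Active G z) (hzx : z < x) :
    numBefore G z < numBefore G x := by
  apply Finset.card_lt_card
  refine Finset.ssubset_iff_subset_ne.2 ⟨?_, ?_⟩
  · intro y hy
    simp only [Finset.mem_filter] at hy ⊢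
    exact ⟨hy.1, hy.2.1, by omega⟩
  · intro h
    have h1 := (Finset.ext_iff.1 h z).2 (by simp [hz, hz.2.1, hzx])
    simp at h1

end Order

/-! ### Writing a word, and computing the constants -/

section WriteSetup

variable {n W : ℕ} {E : Env n} {m : St Reg W}

/-- While the bits are written one by one, the word at `x` is a mixture of old and new bits. The
invariant must therefore tolerate any content of that word and of the scratch registers, which is
what `hI` asks. -/
theorem writeWord_spec {I : St Reg W → Prop} (hW : W + E.w < 2 ^ E.w) (hw : 0 < E.w)
    (hone : m.reg one = 1) (htwo : m.reg two = 2)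
    (hwl : m.reg wl = E.w) (hx : (m.reg x + 1) * E.w ≤ W) (hnw : m.reg nw < 2 ^ E.w)
    (hI : ∀ m' : St Reg W, (∀ r, r ∉ [Reg.a, .e, .b, .u] → m'.reg r = m.reg r) →
      (∀ y, y ≠ m.reg x → word E.w m'.cat y = word E.w m.cat y) → I m') :
    WP E I writeWord (6 * E.w + 5) m fun m' => I m' ∧
      (∀ r, r ∉ [Reg.a, .e, .b, .u] → m'.reg r = m.reg r) ∧
      (∀ y, y ≠ m.reg x → word E.w m'.cat y = word E.w m.cat y) ∧
      word E.w m'.cat (m.reg x) = m.reg nw := by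
  have hxw : m.reg x * E.w + E.w ≤ W := by rw [Nat.succ_mul] at hx; exact hx
  have h2w : 2 < 2 ^ E.w := by omega
  set M := m.reg x * E.w with hM
  -- The tape after the `k` lowest bits of the new word have been written.
  let T : ℕ → (Fin W → Bool) → Prop := fun k cat => ∀ i, St.bit cat i =
    if M ≤ i ∧ i < M + k then (m.reg nw).testBit (i - M) else St.bit m.cat i
  have hTw : ∀ k cat, k ≤ E.w → T k cat → ∀ y, y ≠ m.reg x →
      word E.w cat y = word E.w m.cat y := by
    intro k cat hk hT y hy
    refine word_congr fun b hb => ?_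
    rw [hT, if_neg]
    rintro ⟨h1, h2⟩
    rcases lt_or_gt_of_ne hy with h | h
    · have : (y + 1) * E.w ≤ M := Nat.mul_le_mul_right _ h
      rw [Nat.succ_mul] at this
      omega
    · have : (m.reg x + 1) * E.w ≤ y * E.w := Nat.mul_le_mul_right _ h
      rw [Nat.succ_mul] at this
      omega
  have hJ : ∀ k (m' : St Reg W), k ≤ E.w → (∀ r, r ∉ [Reg.a, .e, .b, .u] → m'.reg r = m.reg r) →
      T k m'.cat → I m' := fun k m' hk h1 h2 => hI m' h1 (hTw k _ hk h2)
  have hT0 : T 0 m.cat := by intro i; rw [if_neg]; omega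
  have e1 : M % 2 ^ E.w = M := Nat.mod_eq_of_lt (by omega)
  have e2 : (M + E.w) % 2 ^ E.w = M + E.w := Nat.mod_eq_of_lt (by omega)
  have e3 : m.reg nw % 2 ^ E.w = m.reg nw := Nat.mod_eq_of_lt hnw
  refine WP.seq (t₁ := 3) (t₂ := 6 * E.w + 2) ?_ (by omega)
  have hpre : WP E (fun _ => True) (.block [.arith .mul a x wl, .arith .add e a wl, .copy u nw]) 3 m
      fun m' => m'.reg a = M ∧ m'.reg e = M + E.w ∧ m'.reg u = m.reg nw := by
    refine WP.block _ rfl ?_ le_rfl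
    simp [hwl, ← hM, e1, e2, e3]
  refine ((hpre.strengthen (I := I) (L := [Reg.a, .e, .b, .u]) rfl (by decide) ?_).frame).imp
    le_rfl ?_
  · intro m' h1 h2
    exact hJ 0 m' (by omega) h2 (by rw [h1]; exact hT0)
  rintro m₁ ⟨⟨⟨ha, he, hu⟩, hI1⟩, hf, -, hc⟩
  have hf' : ∀ r, r ∉ [Reg.a, .e, .b, .u] → m₁.reg r = m.reg r := fun r hr => hf r (by
    simp [Cmd.writes, Cmd.block, Instr.writes] at hr ⊢; tauto)
  refine WP.loop (fun j m' => ∃ k, k + j = E.w ∧ T k m'.cat ∧ m'.reg a = M + k ∧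
    m'.reg e = M + E.w ∧ m'.reg u = m.reg nw / 2 ^ k ∧
    ∀ r, r ∉ [Reg.a, .e, .b, .u] → m'.reg r = m.reg r) 4 ?_ ?_ E.w _ ?_ (by omega)
  · rintro j m' ⟨k, hk, hT, ha, he, hu, hf⟩
    have hbit : m.reg nw / 2 ^ k % 2 % 2 ^ E.w = ((m.reg nw).testBit k).toNat := by
      rw [Nat.mod_eq_of_lt (by omega), Nat.toNat_testBit]
    have hII : ∀ m'' : St Reg W, m''.cat = m'.cat →
        (∀ r, r ∉ [Reg.a, .e, .b, .u] → m''.reg r = m'.reg r) → I m'' := fun m'' h1 h2 =>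
      hJ k m'' (by omega) (fun r hr => by rw [h2 r hr, hf r hr]) (by rw [h1]; exact hT)
    refine ⟨hII m' rfl fun _ _ => rfl, by omega, ?_⟩
    refine WP.seq (t₁ := 1) (t₂ := 3) (WP.ins rfl (hII m' rfl fun _ _ => rfl) ?_ le_rfl) (by omega)
    refine WP.seq (t₁ := 1) (t₂ := 2) (WP.ins rfl (hII _ rfl ?_) ?_ le_rfl) (by omega)
    · intro r hr; simp at hr; simp [hr]
    set m₂ := (m'.exec E false (.arith .mod b u two)) with hm2
    have hb2 : m₂.reg b = ((m.reg nw).testBit k).toNat := by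
      simp [hm2, hu, hf .two (by decide), htwo, hbit]
    have hr2 : ∀ r, r ≠ b → m₂.reg r = m'.reg r := fun r hr => by simp [hm2, hr]
    set m₃ := (m₂.exec E false (.catWrite a b)) with hm3
    have hr3 : m₃.reg = m₂.reg := rfl
    have hT3 : T (k + 1) m₃.cat := by
      intro i
      rw [hm3, St.exec_catWrite_bit, hb2, hr2 _ (by decide), ha, show m₂.cat = m'.cat from rfl, hT i]
      by_cases hi : i = M + k
      · subst hi
        rw [if_pos ⟨rfl, by omega⟩, if_pos ⟨by omega, by omega⟩]
        simp
      · rw [if_neg (by tauto)]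
        congr 1
        simp only [eq_iff_iff]
        omega
    have hf3 : ∀ r, r ∉ [Reg.a, .e, .b, .u] → m₃.reg r = m.reg r := by
      intro r hr
      rw [hr3, hr2 r (by simp at hr; tauto), hf r hr]
    have hI3 : ∀ m'' : St Reg W, m''.cat = m₃.cat →
        (∀ r, r ∉ [Reg.a, .e, .b, .u] → m''.reg r = m₃.reg r) → I m'' := fun m'' h1 h2 =>
      hJ (k + 1) m'' (by omega) (fun r hr => by rw [h2 r hr, hf3 r hr]) (by rw [h1]; exact hT3)
    refine WP.seq (t₁ := 1) (t₂ := 1) (WP.ins rfl (hI3 _ rfl fun _ _ => rfl) ?_ le_rfl) (by omega)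
    refine WP.ins rfl (hI3 _ rfl ?_) ⟨hI3 _ rfl ?_, k + 1, by omega, hT3, ?_, ?_, ?_, ?_⟩ le_rfl
    · intro r hr; simp at hr; simp [hr]
    · intro r hr; simp at hr; simp [hr]
    · have : (M + k + 1) % 2 ^ E.w = M + k + 1 := Nat.mod_eq_of_lt (by omega)
      simp [hf3 .one (by decide), hone, hr3, hr2, ha, this, ← add_assoc]
    · simp [hr3, hr2, he]
    · have : m.reg nw / 2 ^ (k + 1) % 2 ^ E.w = m.reg nw / 2 ^ (k + 1) :=
        Nat.mod_eq_of_lt ((Nat.div_le_self _ _).trans_lt hnw)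
      have h3 : m.reg nw / 2 ^ k / 2 = m.reg nw / 2 ^ (k + 1) := by
        rw [Nat.div_div_eq_div_mul, pow_succ]
      simp [hr3, hr2, hu, hf3 .two (by decide), htwo, h3, this]
    · intro r hr
      have := hf3 r hr
      simp at hr
      simp [hr, this]
  · rintro m' ⟨k, hk, hT, ha, he, hu, hf⟩
    obtain rfl : k = E.w := by omega
    have hI' : I m' := hJ _ m' le_rfl hf hT
    refine ⟨hI', by omega, hI', hf, hTw _ _ le_rfl hT, ?_⟩
    apply Nat.eq_of_testBit_eq
    intro b
    rcases lt_or_ge b E.w with hb | hb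
    · rw [testBit_word hb, hT, if_pos ⟨by omega, by omega⟩]
      congr 1
      omega
    · have h1 : 2 ^ E.w ≤ 2 ^ b := Nat.pow_le_pow_right (by omega) hb
      rw [Nat.testBit_lt_two_pow ((word_lt _ _ _).trans_le h1),
        Nat.testBit_lt_two_pow (hnw.trans_le h1)]
  · exact ⟨0, by omega, by rw [hc rfl]; exact hT0, by omega, he, by simpa using hu, hf'⟩

set_option maxHeartbeats 1000000 in
theorem setup_spec (s₀ t₀ : Fin n) (hfit : Fits n W E.w) (hn : E.args.getD 0 0 = n)
    (hs : E.args.getD 1 0 = s₀) (ht : E.args.getD 2 0 = t₀) (hwl₀ : m.reg wl = 0)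
    (hm₀ : m.reg m1 = 0) (hz₀ : m.reg zero = 0) (hlt₀ : ∀ r, m.reg r < 2 ^ E.w) :
    WP E (fun _ => True) setup (6 * E.w + 18) m fun m' => Ready E s₀ t₀ m' := by
  have hW := hfit.lt_pow
  have h2 := hfit.two_le
  have hw := hfit.pos
  have hn3 : n ^ 3 * 1 ≤ W := (Nat.mul_le_mul_left _ hfit.pos).trans hfit.cube_le
  have hnn : n ≤ n ^ 2 := by nlinarith
  have hnnn : n ^ 2 ≤ n ^ 3 := Nat.pow_le_pow_right (by omega) (by omega)
  have hwpow : 2 * E.w ≤ 2 ^ E.w := by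
    obtain ⟨q, hq⟩ : ∃ q, E.w = q + 1 := ⟨E.w - 1, by omega⟩
    rw [hq, pow_succ]
    have := Nat.lt_two_pow_self (n := q)
    omega
  have hmod : ∀ z, z ≤ W → z % 2 ^ E.w = z := fun z hz => Nat.mod_eq_of_lt (by omega)
  have hns : n % 2 ^ E.w = n := hmod _ (by omega)
  have hss : (s₀ : ℕ) % 2 ^ E.w = s₀ := hmod _ (by omega)
  have hts : (t₀ : ℕ) % 2 ^ E.w = t₀ := hmod _ (by omega)
  have h1s : 1 % 2 ^ E.w = 1 := Nat.mod_eq_of_lt (by omega)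
  have h2s : 2 % 2 ^ E.w = 2 := Nat.mod_eq_of_lt (by omega)
  refine WP.imp (Q := fun m' => (∀ r, m'.reg r < 2 ^ E.w) ∧ ((∀ r, m'.reg r < 2 ^ E.w) →
    Ready E s₀ t₀ m')) ?_ le_rfl fun m' h => h.2 h.1
  refine WP.imp (WP.frame (t := 6 * E.w + 18)
    (Q := fun m' => (∀ r, m'.reg r < 2 ^ E.w) → Ready E s₀ t₀ m') ?_) le_rfl
    fun m' h => ⟨h.2.2.1 hlt₀, h.1⟩
  refine WP.seq (t₁ := 6) (t₂ := 6 * E.w + 12) ?_ (by omega)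
  refine WP.block _ rfl ?_ le_rfl
  refine WP.seq (t₁ := 6 * E.w + 2) (t₂ := 10) ?_ (by omega)
  -- The program learns its word length by overflow: doubling `1` gives the word `0` after exactly
  -- `w` rounds. The reduction modulo `2 ^ E.w` matters only in the last round.
  refine WP.loop (fun j m' => ∃ k, k + j = E.w ∧ m'.reg a = 2 ^ k % 2 ^ E.w ∧ m'.reg wl = k ∧
    m'.reg m1 = 2 ^ k - 1 ∧ m'.reg Reg.n = n ∧ m'.reg Reg.s = s₀ ∧ m'.reg Reg.t = t₀ ∧
    m'.reg one = 1 ∧ m'.reg two = 2 ∧ m'.reg zero = 0) 4 ?_ ?_ E.w _ ?_ (by omega)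
  · rintro j m' ⟨k, hk, ha, hwl, hm1, hn', hs', ht', ho, htw, hz⟩
    have hklt : 2 ^ k < 2 ^ E.w := Nat.pow_lt_pow_right (by omega) (by omega)
    have hkle : 2 ^ (k + 1) ≤ 2 ^ E.w := Nat.pow_le_pow_right (by omega) (by omega)
    have hkpos : 0 < 2 ^ k := by positivity
    rw [Nat.mod_eq_of_lt hklt] at ha
    refine ⟨trivial, by omega, WP.block _ rfl ?_ le_rfl⟩
    have h3 : (k + 1) % 2 ^ E.w = k + 1 := Nat.mod_eq_of_lt (by omega)
    have h4 : 2 ^ k - 1 + (2 ^ k - 1) + 1 = 2 ^ (k + 1) - 1 := by rw [pow_succ]; omega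
    have h5 : (2 ^ k - 1 + (2 ^ k - 1) + 1) % 2 ^ E.w = 2 ^ (k + 1) - 1 := by
      rw [h4]; exact Nat.mod_eq_of_lt (by omega)
    have h6 : 2 ^ k + 2 ^ k = 2 ^ (k + 1) := by ring
    refine ⟨trivial, k + 1, by omega, ?_⟩
    simp [ha, hwl, hm1, hn', hs', ht', ho, htw, hz, h3, h5, h6]
  · rintro m' ⟨k, hk, ha, hwl, hm1, hn', hs', ht', ho, htw, hz⟩
    obtain rfl : k = E.w := by omega
    refine ⟨trivial, by simp [ha, hz], WP.block _ rfl ?_ le_rfl⟩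
    have hds := E.graph.inDeg_lt (by omega) s₀
    have hdt := E.graph.inDeg_lt (by omega) t₀
    have e1 : n ^ 2 % 2 ^ E.w = n ^ 2 := hmod _ (by omega)
    have e2 : n ^ 3 % 2 ^ E.w = n ^ 3 := hmod _ (by omega)
    have e3 : n * n = n ^ 2 := by ring
    have e4 : n ^ 2 * n = n ^ 3 := by ring
    have e5 : ∀ v : Fin n, (v : ℕ) * n + E.graph.inDeg v < n ^ 2 := fun v => by
      have := E.graph.inDeg_lt (by omega) v
      have := v.2
      nlinarith
    have e6 : ((s₀ : ℕ) * n + E.graph.inDeg s₀) % 2 ^ E.w = s₀ * n + E.graph.inDeg s₀ :=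
      hmod _ (by have := e5 s₀; omega)
    have e7 : ((t₀ : ℕ) * n + E.graph.inDeg t₀ + (n ^ 3 - n ^ 2)) % 2 ^ E.w =
      t₀ * n + E.graph.inDeg t₀ + (n ^ 3 - n ^ 2) := hmod _ (by have := e5 t₀; omega)
    have e8 : (t₀ : ℕ) * n + E.graph.inDeg t₀ + (n ^ 3 - n ^ 2) = topNode E.graph (n - 1) t₀ := by
      obtain ⟨q, hq⟩ : ∃ q, n = q + 1 := ⟨n - 1, by omega⟩
      have : n ^ 3 - n ^ 2 = (n - 1) * n * n := by
        generalize n = z at hq ⊢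
        subst hq
        rw [Nat.add_sub_cancel, Nat.sub_eq_of_eq_add]; ring
      rw [this, topNode]; ring
    rw [e8] at e7
    intro hlt
    refine ⟨?_, ?_, ?_, ?_, ?_, ?_, ?_, ?_, ?_, ?_, hlt⟩
    · simp [hn']
    · simp [ho]
    · simp [htw]
    · simp [hz]
    · simp [hwl]
    · simp [hm1]
    · simp [hn', e3, e1]
    · simp [hn', e3, e4, e1, e2]
    · simp [hn', hs', e6, topNode]
    · simp [hn', ht', e3, e4, e7, e1, e2, e8]
  · refine ⟨0, by omega, ?_⟩
    simp only [List.getD_eq_getElem?_getD] at hn hs ht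
    simp [hwl₀, hm₀, hz₀, hns, hss, hts, h1s, h2s, hn, hs, ht]

end WriteSetup

/-! ### The main program -/

/-- `ow :=` the word at node `x`, `sum :=` the total value of the nodes that feed `x`. -/
def fetch : Cmd Reg :=
  .block [.copy y x] ;; readWord ;; .block [.copy ow acc] ;; computeAddend

/-- Process the active node `fr` and advance the frontier. -/
def forwardStep : Cmd Reg :=
  (.block [.copy x fr] ;; fetch ;; .block [.arith .add nw ow sum] ;; computeNext) ;;
  .ins (.copy org ow) ;; .ins (.copy cur x) ;; writeWord ;; .ins (.copy fr nx) ;;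
  .ins (.copy cur zero)

/-- Move the frontier back by one active node and restore its word. -/
def backwardStep : Cmd Reg :=
  (computePrev ;; fetch ;; .block [.arith .mul sum m1 sum, .arith .add nw ow sum]) ;;
  .ins (.copy org nw) ;; .ins (.copy cur x) ;; .ins (.copy fr x) ;; writeWord ;;
  .ins (.copy cur zero)

/-- Read the value of the target node. -/
def readTarget : Cmd Reg :=
  .block [.copy y tn, .copy sum zero, .copy prv res] ;; addValue ;; .block [.copy res sum]

/-- Propagate values through the whole network, read the target and undo everything. -/
def pass : Cmd Reg :=
  .loop fr n3 forwardStep ;; readTarget ;; .loop n2 fr backwardStep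

/-- Fill the register `rnd` with random bits. -/
def sample : Cmd Reg :=
  .ins (.copy j zero) ;;
  .loop j wl (.ins (.coin b) ;; .ins (.arith .add rnd rnd rnd) ;; .ins (.arith .add rnd rnd b) ;;
    .ins (.arith .add j j one))

/-- Derive the modulus from the random word. -/
def computeModulus : Cmd Reg :=
  .block [.copy big n] ;; .iter (.ins (.arith .mul big big big)) 10 ;;
  .block [.arith .mod p rnd big, .arith .add p p one]

/-- The main program. -/
def mainCmd : Cmd Reg :=
  setup ;; sample ;; computeModulus ;; .ins (.copy fr n2) ;; pass ;; .ins (.copy dl one) ;; pass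

/-- The query routine, after the relevant registers of the main program have been copied. -/
def queryCmd : Cmd Reg :=
  setup ;;
  .block [.arg qi 3, .arith .div x qi wl, .arith .mod qb qi wl, .copy y x] ;;
  readWord ;;
  .block [.copy ow acc] ;;
  .ite (.lt x n2) .skip
    (.ite (.eq x cur) (.block [.copy ow org])
      (.ite (.lt x fr)
        (.ite (.lt x n3)
          (.block [.arith .div v x n, .arith .mod v v n, .inDeg d v, .arith .mod j x n] ;;
            .ite (.lt d j) .skip
              (computeAddend ;; .block [.arith .mul sum m1 sum, .arith .add ow ow sum]))
          .skip)
        .skip)) ;;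
  .loop zero qb (.block [.arith .div ow ow two, .arith .sub qb qb one]) ;;
  .block [.arith .mod ow ow two]

/-- The invariant that makes the computation locally revertible: words of active nodes before the
frontier have been processed, the word of node `cur` (if `cur ≠ 0`) is being overwritten and
its original content is in `org`, and all other words are the original ones. -/
structure Inv {n W : ℕ} (G : OracleDigraph n) (w sn : ℕ) (τ : Fin W → Bool) (m : St Reg W) :
    Prop where
  untouched : ∀ y, (y = m.reg cur → m.reg cur = 0) → ¬ (Active G y ∧ y < m.reg fr) →
    word w m.cat y = word w τ y
  done : ∀ y, Active G y → y < m.reg fr → y ≠ m.reg cur → word w m.cat y =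
    (word w τ y + addend G w (m.reg rnd) (m.reg p) (m.reg dl) sn (word w m.cat) y) % 2 ^ w
  current : m.reg cur ≠ 0 → Active G (m.reg cur) ∧ m.reg org = word w τ (m.reg cur) ∧
    ∀ y, Active G y → y < m.reg fr → y ≤ m.reg cur

/-- The registers on which the invariant depends. -/
def invRegs : List Reg := [rnd, p, dl, fr, cur, org]

/-! ### Stability of the invariant -/

section

variable {n W : ℕ} {G : OracleDigraph n} {w sn : ℕ} {τ : Fin W → Bool} {m m' : St Reg W}

theorem Active.pos (hn : 0 < n) {y : ℕ} (h : Active G y) : y ≠ 0 := by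
  have := h.1
  have : 0 < n ^ 2 := by positivity
  omega

/-- Both nodes that feed `y` precede it, so changing the word at `y` or later does not affect the
addend of `y`. -/
theorem addend_congr (hn : 0 < n) {r p d y : ℕ} {g g' : ℕ → ℕ} (hy : Active G y)
    (h : ∀ z < y, g z = g' z) : addend G w r p d sn g y = addend G w r p d sn g' y := by
  have h0 := hy.pos hn
  unfold addend nodeValue
  rw [h _ (source_lt hn hy), h (y - 1) (by omega)]

theorem Inv.congr (h : Inv G w sn τ m) (hc : m'.cat = m.cat)
    (hr : ∀ r ∈ invRegs, m'.reg r = m.reg r) : Inv G w sn τ m' := by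
  have h1 := hr rnd (by decide)
  have h2 := hr p (by decide)
  have h3 := hr dl (by decide)
  have h4 := hr fr (by decide)
  have h5 := hr cur (by decide)
  have h6 := hr org (by decide)
  constructor
  · rw [hc, h4, h5]; exact h.untouched
  · rw [hc, h1, h2, h3, h4, h5]; exact h.done
  · rw [h4, h5, h6]; exact h.current

/-- As long as nothing has been processed, the invariant says that the tape is the original one. -/
theorem Inv.of_start (hc : ∀ y, word w m.cat y = word w τ y) (hcur : m.reg cur = 0)
    (hfr : m.reg fr ≤ n ^ 2) : Inv G w sn τ m := by
  refine ⟨fun y _ _ => hc y, fun y h1 h2 => ?_, fun h => absurd hcur h⟩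
  have := h1.1
  omega

theorem Inv.word_eq (h : Inv G w sn τ m) (hcur : m.reg cur = 0) (hfr : m.reg fr ≤ n ^ 2) (y : ℕ) :
    word w m.cat y = word w τ y := by
  refine h.untouched y (fun _ => hcur) fun h' => ?_
  have := h'.1.1
  omega

/-- The current node may be overwritten. -/
theorem Inv.overwrite (hn : 0 < n) (h : Inv G w sn τ m) (hcur : Active G (m.reg cur))
    (hr : ∀ r ∈ invRegs, m'.reg r = m.reg r)
    (hw : ∀ y, y ≠ m.reg cur → word w m'.cat y = word w m.cat y) : Inv G w sn τ m' := by
  have h1 := hr rnd (by decide)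
  have h2 := hr p (by decide)
  have h3 := hr dl (by decide)
  have h4 := hr fr (by decide)
  have h5 := hr cur (by decide)
  have h6 := hr org (by decide)
  have h0 := hcur.pos hn
  constructor
  · rw [h4, h5]
    intro y hy hy'
    rw [hw y fun h => h0 (hy h)]
    exact h.untouched y hy hy'
  · rw [h1, h2, h3, h4, h5]
    intro y hy hy' hne
    have hle := (h.current h0).2.2 y hy hy'
    rw [hw y hne, h.done y hy hy' hne]
    congr 2
    exact addend_congr hn hy fun z hz => (hw z (by omega)).symm
  · rw [h4, h5, h6]; exact h.current

/-- Computation in scratch registers, with the tape only read, cannot disturb the invariant at any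
intermediate time. Only the few instructions that write to the tape or to `invRegs` need individual
care. -/
theorem WP.pure {E : Env n} {c : Cmd Reg} {t : ℕ} {Q : St Reg W → Prop}
    (h : WP E (fun _ => True) c t m Q) (hI : Inv G w sn τ m)
    (hc : c.all Instr.NoWrite = true) (hp : ∀ r ∈ c.writes, r ∉ invRegs) :
    WP E (Inv G w sn τ) c t m fun m' => Q m' ∧ Inv G w sn τ m' ∧ m'.cat = m.cat ∧
      (∀ r, r ∉ c.writes → m'.reg r = m.reg r) ∧
      ((∀ r, m.reg r < 2 ^ E.w) → ∀ r, m'.reg r < 2 ^ E.w) := by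
  refine (WP.frame (h.strengthen hc (L := c.writes) (fun r hr => hr) ?_)).imp le_rfl ?_
  · intro m' h1 h2
    exact hI.congr h1 fun r hr => h2 r fun h => hp r h hr
  · rintro m' ⟨⟨h1, h2⟩, h3, h4, h5⟩
    exact ⟨h1, h2, h5 hc, h3, h4⟩

/-- Machine subtraction truncates at `0`, so an addend is removed by adding its product with `2 ^ w
- 1`, which is `-1` modulo `2 ^ w`. -/
theorem add_sub_word {M t a : ℕ} (ht : t < M) : ((t + a) % M + (M - 1) * (a % M) % M) % M = t := by
  have hM : 0 < M := by omega
  rw [← Nat.add_mod]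
  have h1 : (t + a + (M - 1) * (a % M)) ≡ t [MOD M] := by
    have : t + a + (M - 1) * (a % M) ≡ t + a % M + (M - 1) * (a % M) [MOD M] :=
      Nat.ModEq.add_right _ (Nat.ModEq.add_left _ (Nat.mod_modEq _ _).symm)
    refine this.trans ?_
    have e : t + a % M + (M - 1) * (a % M) = t + M * (a % M) := by
      obtain ⟨q, rfl⟩ : ∃ q, M = q + 1 := ⟨M - 1, by omega⟩
      rw [Nat.add_sub_cancel]; ring
    rw [e]
    simp [Nat.ModEq]
  rw [Nat.ModEq] at h1
  rw [h1, Nat.mod_eq_of_lt ht]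

end

/-! ### One forward step -/

section Steps

variable {n W : ℕ} {E : Env n} {m : St Reg W} {s t : ℕ} {τ : Fin W → Bool}

theorem node_mul_le (hfit : Fits n W E.w) {z : ℕ} (hz : z < n ^ 3) : (z + 1) * E.w ≤ W :=
  (Nat.mul_le_mul_right _ hz).trans hfit.cube_le

theorem fetch_spec (hfit : Fits n W E.w) (hm : Ready E s t m) (hx : Active E.graph (m.reg x)) :
    WP E (fun _ => True) fetch (18 * E.w + 60) m fun m' =>
      m'.reg ow = word E.w m.cat (m.reg x) ∧
      m'.reg sum = addend E.graph E.w (m.reg rnd) (m.reg p) (m.reg dl) (topNode E.graph 0 s)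
        (word E.w m.cat) (m.reg x) % 2 ^ E.w := by
  have hle := node_mul_le hfit hx.2.1
  rw [Nat.succ_mul] at hle
  have hxm : m.reg x % 2 ^ E.w = m.reg x := Nat.mod_eq_of_lt (hm.lt _)
  refine WP.seq_frame (t₁ := 1) (t₂ := 18 * E.w + 59) (P := fun m' => m'.reg y = m.reg x)
    (WP.block _ rfl (by simp [hxm]) le_rfl) (fun m₁ hy₁ hf₁ hlt₁ hc₁ => ?_) (by omega)
  have hm₁ := hm.of_frame hf₁ (hlt₁ hm.lt) (by decide)
  refine WP.seq_frame (t₁ := 6 * E.w + 5) (t₂ := 12 * E.w + 51)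
    (readWord_spec hfit.lt_pow hm₁.one_eq hm₁.zero_eq hm₁.wl_eq (by rw [hy₁]; omega))
    (fun m₂ hacc hf₂ hlt₂ hc₂ => ?_) (by omega)
  have hm₂ := hm₁.of_frame hf₂ (hlt₂ hm₁.lt) (by decide)
  refine WP.seq_frame (t₁ := 1) (t₂ := 12 * E.w + 50)
    (P := fun m' => m'.reg ow = word E.w m.cat (m.reg x))
    (WP.block _ rfl ?_ le_rfl) (fun m₃ how hf₃ hlt₃ hc₃ => ?_) (by omega)
  · simp [hacc, hc₁ rfl, hy₁, Nat.mod_eq_of_lt (word_lt _ _ _)]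
  have hm₃ := hm₂.of_frame hf₃ (hlt₃ hm₂.lt) (by decide)
  have hcat : m₃.cat = m.cat := by rw [hc₃ rfl, hc₂ rfl, hc₁ rfl]
  have hx₃ : m₃.reg x = m.reg x := by
    rw [hf₃ _ (by decide), hf₂ _ (by decide), hf₁ _ (by decide)]
  refine (computeAddend_spec hfit hm₃ (by rw [hx₃]; exact hx)).frame.imp le_rfl ?_
  rintro m₄ ⟨hs, hf₄, -, -⟩
  refine ⟨by rw [hf₄ _ (by decide), how], ?_⟩
  rw [hs, hcat, hx₃, hf₃ rnd (by decide), hf₂ rnd (by decide), hf₁ rnd (by decide),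
    hf₃ p (by decide), hf₂ p (by decide), hf₁ p (by decide),
    hf₃ dl (by decide), hf₂ dl (by decide), hf₁ dl (by decide)]

/-- What the processing steps leave unchanged. -/
def Same (m m' : St Reg W) : Prop :=
  ∀ r ∈ [Reg.rnd, .p, .dl, .res, .prv], m'.reg r = m.reg r

/-- The invariant must survive each instruction, which dictates their order. The original word is
saved in `org` while `cur = 0` makes `org` irrelevant; setting `cur` then exempts the node from all
claims about its tape word; after the write the frontier passes the node; finally `cur` is cleared,
and only then must the new word be the correct one. -/
theorem forwardStep_spec (hfit : Fits n W E.w) (hm : Ready E s t m)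
    (hinv : Inv E.graph E.w (topNode E.graph 0 s) τ m) (hcur : m.reg cur = 0)
    (hfr : Active E.graph (m.reg fr)) :
    WP E (Inv E.graph E.w (topNode E.graph 0 s) τ) forwardStep (24 * E.w + 90) m fun m' =>
      Ready E s t m' ∧ Inv E.graph E.w (topNode E.graph 0 s) τ m' ∧ m'.reg cur = 0 ∧
      m'.reg fr = nextNode E.graph (m.reg fr) ∧ Same m m' := by
  have hn : 0 < n := by have := hfit.two_le; omega
  have hx0 := hfr.pos hn
  refine WP.imp (WP.frame (Q := fun m' => Inv E.graph E.w (topNode E.graph 0 s) τ m' ∧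
      m'.reg cur = 0 ∧ m'.reg fr = nextNode E.graph (m.reg fr)) (t := 24 * E.w + 90) ?_) le_rfl ?_
  swap
  · rintro m' ⟨⟨h1, h2, h3⟩, h4, h5, -⟩
    refine ⟨hm.of_frame h4 (h5 hm.lt) (by decide), h1, h2, h3, fun r hr => h4 r ?_⟩
    revert r; decide
  refine WP.seq (t₁ := 18 * E.w + 80) (t₂ := 6 * E.w + 10) ?_ (by omega)
  have hpre : WP E (fun _ => True) (.block [.copy x fr] ;; fetch ;; .block [.arith .add nw ow sum] ;;
      computeNext) (18 * E.w + 80) m fun m' => m'.reg x = m.reg fr ∧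
        m'.reg ow = word E.w m.cat (m.reg fr) ∧ m'.reg nw = (word E.w m.cat (m.reg fr) +
          addend E.graph E.w (m.reg rnd) (m.reg p) (m.reg dl) (topNode E.graph 0 s)
            (word E.w m.cat) (m.reg fr)) % 2 ^ E.w ∧ m'.reg nx = nextNode E.graph (m.reg fr) := by
    refine WP.seq_frame (t₁ := 1) (t₂ := 18 * E.w + 79) (P := fun m' => m'.reg x = m.reg fr)
      (WP.block _ rfl (by simp [Nat.mod_eq_of_lt (hm.lt _)]) le_rfl)
      (fun m₁ hx₁ hf₁ hlt₁ hc₁ => ?_) (by omega)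
    have hm₁ := hm.of_frame hf₁ (hlt₁ hm.lt) (by decide)
    refine WP.seq_frame (t₁ := 18 * E.w + 60) (t₂ := 19)
      (fetch_spec hfit hm₁ (by rw [hx₁]; exact hfr)) (fun m₂ h₂ hf₂ hlt₂ hc₂ => ?_) (by omega)
    have hm₂ := hm₁.of_frame hf₂ (hlt₂ hm₁.lt) (by decide)
    rw [hx₁, hc₁ rfl, hf₁ rnd (by decide), hf₁ p (by decide), hf₁ dl (by decide)] at h₂
    refine WP.seq_frame (t₁ := 1) (t₂ := 9) (P := fun m' => m'.reg nw =
      (word E.w m.cat (m.reg fr) + addend E.graph E.w (m.reg rnd) (m.reg p) (m.reg dl)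
        (topNode E.graph 0 s) (word E.w m.cat) (m.reg fr)) % 2 ^ E.w)
      (WP.block _ rfl (by simp [h₂]) le_rfl) (fun m₃ hnw hf₃ hlt₃ hc₃ => ?_) (by omega)
    have hm₃ := hm₂.of_frame hf₃ (hlt₃ hm₂.lt) (by decide)
    have hfr₃ : m₃.reg fr = m.reg fr := by
      rw [hf₃ _ (by decide), hf₂ _ (by decide), hf₁ _ (by decide)]
    refine (computeNext_spec hfit hm₃ (by rw [hfr₃]; exact hfr.2.1)).frame.imp le_rfl ?_
    rintro m₄ ⟨hnx, hf₄, -, -⟩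
    refine ⟨?_, ?_, ?_, ?_⟩
    · rw [hf₄ _ (by decide), hf₃ _ (by decide), hf₂ _ (by decide), hx₁]
    · rw [hf₄ _ (by decide), hf₃ _ (by decide), h₂.1]
    · rw [hf₄ _ (by decide), hnw]
    · rw [hnx, hfr₃]
  refine (hpre.pure hinv rfl (by decide)).imp le_rfl ?_
  rintro m₁ ⟨⟨hx₁, how₁, hnw₁, hnx₁⟩, hinv₁, hc₁, hf₁, hlt₁⟩
  have hm₁ := hm.of_frame hf₁ (hlt₁ hm.lt) (by decide)
  have hcur₁ : m₁.reg cur = 0 := by rw [hf₁ _ (by decide), hcur]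
  have hfr₁ : m₁.reg fr = m.reg fr := hf₁ _ (by decide)
  -- The frontier is not strictly before itself, so its word is still the original one.
  have hword₁ : word E.w m₁.cat (m.reg fr) = word E.w τ (m.reg fr) :=
    hinv₁.untouched _ (fun _ => hcur₁) (by omega)
  -- Announce the node that is going to be overwritten.
  refine WP.seq_frame (t₁ := 1) (t₂ := 6 * E.w + 9) (P := fun m' =>
    Inv E.graph E.w (topNode E.graph 0 s) τ m' ∧ m'.reg org = word E.w τ (m.reg fr))
    (WP.ins rfl hinv₁ ?_ le_rfl) (fun m₂ h₂ hf₂ hlt₂ hc₂ => ?_) (by omega)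
  · have horg : (m₁.reg ow) % 2 ^ E.w = word E.w τ (m.reg fr) := by
      rw [Nat.mod_eq_of_lt (hm₁.lt _), how₁, ← hc₁, hword₁]
    refine ⟨⟨?_, ?_, ?_⟩, by simp [horg]⟩
    · simpa using hinv₁.untouched
    · simpa using hinv₁.done
    · simp [hcur₁]
  have hm₂ := hm₁.of_frame hf₂ (hlt₂ hm₁.lt) (by decide)
  obtain ⟨hinv₂, horg₂⟩ := h₂
  have hcat₂ : m₂.cat = m.cat := by rw [hc₂ rfl, hc₁]
  have hcur₂ : m₂.reg cur = 0 := by rw [hf₂ _ (by decide), hcur₁]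
  have hfr₂ : m₂.reg fr = m.reg fr := by rw [hf₂ _ (by decide), hfr₁]
  have hx₂ : m₂.reg x = m.reg fr := by rw [hf₂ _ (by decide), hx₁]
  refine WP.seq_frame (t₁ := 1) (t₂ := 6 * E.w + 8) (P := fun m' =>
    Inv E.graph E.w (topNode E.graph 0 s) τ m' ∧ m'.reg cur = m.reg fr)
    (WP.ins rfl hinv₂ ?_ le_rfl) (fun m₃ h₃ hf₃ hlt₃ hc₃ => ?_) (by omega)
  · have hxm : m₂.reg x % 2 ^ E.w = m.reg fr := by rw [Nat.mod_eq_of_lt (hm₂.lt _), hx₂]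
    refine ⟨⟨?_, ?_, ?_⟩, by simp [hxm]⟩
    · intro y _ hy
      refine hinv₂.untouched y (fun _ => hcur₂) ?_
      simpa using hy
    · intro y hy hy' hne
      simp only [St.exec_copy, St.set_reg, St.set_cat, reduceCtorEq, if_false] at hy' ⊢
      exact hinv₂.done y hy hy' (by rw [hcur₂]; exact hy.pos hn)
    · intro _
      simp only [St.exec_copy, St.set_reg, reduceCtorEq, if_true, if_false, hxm, hfr₂]
      exact ⟨hfr, horg₂, fun y _ hy => hy.le⟩
  have hm₃ := hm₂.of_frame hf₃ (hlt₃ hm₂.lt) (by decide)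
  obtain ⟨hinv₃, hcur₃⟩ := h₃
  have hx₃ : m₃.reg x = m.reg fr := by rw [hf₃ _ (by decide), hx₂]
  refine WP.seq_frame (t₁ := 6 * E.w + 5) (t₂ := 3) (writeWord_spec hfit.lt_pow hfit.pos hm₃.one_eq
    hm₃.two_eq hm₃.wl_eq (by rw [hx₃]; exact node_mul_le hfit hfr.2.1) (hm₃.lt _) ?_)
    (fun m₄ h₄ hf₄ hlt₄ _ => ?_) (by omega)
  · intro m' h1 h2
    refine hinv₃.overwrite hn (by rw [hcur₃]; exact hfr) (fun r hr => h1 r ?_)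
      (by rw [hcur₃, ← hx₃]; exact h2)
    revert r; decide
  have hm₄ := hm₃.of_frame hf₄ (hlt₄ hm₃.lt) (by decide)
  obtain ⟨hinv₄, -, hoth₄, hwr₄⟩ := h₄
  rw [hx₃] at hwr₄ hoth₄
  rw [hf₃ _ (by decide), hf₂ _ (by decide), hnw₁] at hwr₄
  have hcat₃ : m₃.cat = m.cat := by rw [hc₃ rfl, hcat₂]
  rw [hcat₃] at hoth₄
  have hcur₄ : m₄.reg cur = m.reg fr := by rw [hf₄ _ (by decide), hcur₃]
  have hfr₄ : m₄.reg fr = m.reg fr := by rw [hf₄ _ (by decide), hf₃ _ (by decide), hfr₂]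
  have hnx₄ : m₄.reg nx = nextNode E.graph (m.reg fr) := by
    rw [hf₄ _ (by decide), hf₃ _ (by decide), hf₂ _ (by decide), hnx₁]
  have hpar₄ : ∀ r ∈ [Reg.rnd, .p, .dl], m₄.reg r = m.reg r := by
    intro r hr
    rw [hf₄ r (by revert r; decide), hf₃ r (by revert r; decide), hf₂ r (by revert r; decide),
      hf₁ r (by revert r; decide)]
  have hcurr₄ := hinv₄.current (by rw [hcur₄]; exact hx0)
  rw [hcur₄] at hcurr₄
  -- Advance the frontier.
  refine WP.seq_frame (t₁ := 1) (t₂ := 2) (P := fun m' =>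
    Inv E.graph E.w (topNode E.graph 0 s) τ m' ∧ m'.reg fr = nextNode E.graph (m.reg fr))
    (WP.ins rfl hinv₄ ?_ le_rfl) (fun m₅ h₅ hf₅ hlt₅ hc₅ => ?_) (by omega)
  · have hxm : m₄.reg nx % 2 ^ E.w = nextNode E.graph (m.reg fr) := by
      rw [Nat.mod_eq_of_lt (hm₄.lt _), hnx₄]
    have hlt := lt_nextNode (G := E.graph) (x := m.reg fr) hn
    refine ⟨⟨?_, ?_, ?_⟩, by simp [hxm]⟩
    · intro y hy hy'
      simp only [St.exec_copy, St.set_reg, St.set_cat, reduceCtorEq, if_true, if_false, hxm]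
        at hy hy' ⊢
      exact hinv₄.untouched y hy fun h => hy' ⟨h.1, by have := h.2; omega⟩
    · intro y hy hy' hne
      simp only [St.exec_copy, St.set_reg, St.set_cat, reduceCtorEq, if_true, if_false, hxm]
        at hy' hne ⊢
      have := le_of_active_of_lt_nextNode hn hy hy'
      exact hinv₄.done y hy (by omega) hne
    · intro _
      simp only [St.exec_copy, St.set_reg, reduceCtorEq, if_true, if_false, hxm, hcur₄]
      exact ⟨hfr, hcurr₄.2.1, fun y h1 h2 => le_of_active_of_lt_nextNode hn h1 h2⟩
  obtain ⟨hinv₅, hfr₅⟩ := h₅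
  have hm₅ := hm₄.of_frame hf₅ (hlt₅ hm₄.lt) (by decide)
  have hcur₅ : m₅.reg cur = m.reg fr := by rw [hf₅ _ (by decide), hcur₄]
  refine WP.ins rfl hinv₅ ⟨⟨?_, ?_, ?_⟩, by simp [hm₅.zero_eq], by simp [hfr₅]⟩ (by omega)
  · intro y _ hy'
    simp only [St.exec_copy, St.set_reg, St.set_cat, reduceCtorEq, if_false] at hy' ⊢
    by_cases hy : y = m.reg fr
    · exact absurd ⟨by rw [hy]; exact hfr, by rw [hfr₅, hy]; exact lt_nextNode hn⟩ hy'
    · exact hinv₅.untouched y (fun h => absurd (h.trans hcur₅) hy) hy'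
  · intro y hy hy' _
    simp only [St.exec_copy, St.set_reg, St.set_cat, reduceCtorEq, if_false] at hy' ⊢
    by_cases hyx : y = m.reg fr
    · subst hyx
      rw [hc₅ rfl, hwr₄, hf₅ rnd (by decide), hf₅ p (by decide), hf₅ dl (by decide),
        hpar₄ _ (by decide), hpar₄ _ (by decide), hpar₄ _ (by decide), ← hc₁, hword₁, hc₁]
      -- The addend was computed on the tape before the write, whereas the invariant speaks of the
      -- tape after it. They agree below the node.
      congr 2
      exact addend_congr hn hfr fun z hz => (hoth₄ z (by omega)).symm
    · exact hinv₅.done y hy hy' (by rw [hcur₅]; exact hyx)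
  · simp [hm₅.zero_eq]

end Steps

/-! ### One backward step, and a whole pass -/

section Passes

variable {n W : ℕ} {E : Env n} {m : St Reg W} {s t : ℕ} {τ : Fin W → Bool}

/-- Again the node is protected by `cur` and `org`, but now the frontier retreats before the write.
When `cur` is cleared, the node is no longer behind the frontier and its word is the original one
again. -/
theorem backwardStep_spec (hfit : Fits n W E.w) (hm : Ready E s t m)
    (hinv : Inv E.graph E.w (topNode E.graph 0 s) τ m) (hcur : m.reg cur = 0)
    (hfront : Stop E.graph (m.reg fr)) (hlt : n ^ 2 < m.reg fr) :
    WP E (Inv E.graph E.w (topNode E.graph 0 s) τ) backwardStep (24 * E.w + 90) m fun m' =>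
      Ready E s t m' ∧ Inv E.graph E.w (topNode E.graph 0 s) τ m' ∧ m'.reg cur = 0 ∧
      m'.reg fr = prevNode E.graph (m.reg fr) ∧ Same m m' := by
  have hn : 0 < n := by have := hfit.two_le; omega
  obtain ⟨hact, hprev, hgap⟩ := prevNode_spec hfit.two_le hfront hlt
  have hx0 := hact.pos hn
  set z := prevNode E.graph (m.reg fr) with hz
  have hfr3 : m.reg fr ≤ n ^ 3 := by rcases hfront with h | h; exacts [h.2.1.le, h.le]
  refine WP.imp (WP.frame (Q := fun m' => Inv E.graph E.w (topNode E.graph 0 s) τ m' ∧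
      m'.reg cur = 0 ∧ m'.reg fr = z) (t := 24 * E.w + 90) ?_) le_rfl ?_
  swap
  · rintro m' ⟨⟨h1, h2, h3⟩, h4, h5, -⟩
    refine ⟨hm.of_frame h4 (h5 hm.lt) (by decide), h1, h2, h3, fun r hr => h4 r ?_⟩
    revert r; decide
  refine WP.seq (t₁ := 18 * E.w + 80) (t₂ := 6 * E.w + 10) ?_ (by omega)
  have hpre : WP E (fun _ => True) (computePrev ;; fetch ;;
      .block [.arith .mul sum m1 sum, .arith .add nw ow sum]) (18 * E.w + 80) m fun m' =>
        m'.reg x = z ∧ m'.reg nw = word E.w τ z := by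
    refine WP.seq_frame (t₁ := 10) (t₂ := 18 * E.w + 70)
      (computePrev_spec hfit hm hfr3 (by nlinarith))
      (fun m₁ hx₁ hf₁ hlt₁ hc₁ => ?_) (by omega)
    have hm₁ := hm.of_frame hf₁ (hlt₁ hm.lt) (by decide)
    refine WP.seq_frame (t₁ := 18 * E.w + 60) (t₂ := 10)
      (fetch_spec hfit hm₁ (by rw [hx₁]; exact hact)) (fun m₂ h₂ hf₂ hlt₂ hc₂ => ?_) (by omega)
    have hm₂ := hm₁.of_frame hf₂ (hlt₂ hm₁.lt) (by decide)
    rw [← hz] at hx₁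
    rw [hx₁, hc₁ rfl, hf₁ rnd (by decide), hf₁ p (by decide), hf₁ dl (by decide)] at h₂
    have hx₂ : m₂.reg x = z := by rw [hf₂ _ (by decide), hx₁]
    -- The present word is the original one plus the addend evaluated on the present tape;
    -- subtracting the freshly computed addend recovers the original.
    have hdone := hinv.done z hact hprev (by rw [hcur]; exact hx0)
    rw [hdone] at h₂
    refine WP.block _ rfl ?_ (by simp)
    have key := add_sub_word (M := 2 ^ E.w) (t := word E.w τ z) (a := addend E.graph E.w (m.reg rnd)
      (m.reg p) (m.reg dl) (topNode E.graph 0 s) (word E.w m.cat) z) (word_lt _ _ _)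
    refine ⟨by simp [hx₂], ?_⟩
    simp only [List.foldl_cons, List.foldl_nil, St.exec_mul, St.exec_add, St.set_reg, reduceCtorEq,
      if_true, if_false, h₂, hm₂.m1_eq]
    exact key
  refine (hpre.pure hinv rfl (by decide)).imp le_rfl ?_
  rintro m₁ ⟨⟨hx₁, hnw₁⟩, hinv₁, hc₁, hf₁, hlt₁⟩
  have hm₁ := hm.of_frame hf₁ (hlt₁ hm.lt) (by decide)
  have hcur₁ : m₁.reg cur = 0 := by rw [hf₁ _ (by decide), hcur]
  have hfr₁ : m₁.reg fr = m.reg fr := hf₁ _ (by decide)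
  refine WP.seq_frame (t₁ := 1) (t₂ := 6 * E.w + 9) (P := fun m' =>
    Inv E.graph E.w (topNode E.graph 0 s) τ m' ∧ m'.reg org = word E.w τ z)
    (WP.ins rfl hinv₁ ?_ le_rfl) (fun m₂ h₂ hf₂ hlt₂ hc₂ => ?_) (by omega)
  · have horg : (m₁.reg nw) % 2 ^ E.w = word E.w τ z := by
      rw [Nat.mod_eq_of_lt (hm₁.lt _), hnw₁]
    refine ⟨⟨?_, ?_, ?_⟩, by simp [horg]⟩
    · simpa using hinv₁.untouched
    · simpa using hinv₁.done
    · simp [hcur₁]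
  have hm₂ := hm₁.of_frame hf₂ (hlt₂ hm₁.lt) (by decide)
  obtain ⟨hinv₂, horg₂⟩ := h₂
  have hcur₂ : m₂.reg cur = 0 := by rw [hf₂ _ (by decide), hcur₁]
  have hfr₂ : m₂.reg fr = m.reg fr := by rw [hf₂ _ (by decide), hfr₁]
  have hx₂ : m₂.reg x = z := by rw [hf₂ _ (by decide), hx₁]
  refine WP.seq_frame (t₁ := 1) (t₂ := 6 * E.w + 8) (P := fun m' =>
    Inv E.graph E.w (topNode E.graph 0 s) τ m' ∧ m'.reg cur = z)
    (WP.ins rfl hinv₂ ?_ le_rfl) (fun m₃ h₃ hf₃ hlt₃ hc₃ => ?_) (by omega)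
  · have hxm : m₂.reg x % 2 ^ E.w = z := by rw [Nat.mod_eq_of_lt (hm₂.lt _), hx₂]
    refine ⟨⟨?_, ?_, ?_⟩, by simp [hxm]⟩
    · intro y _ hy
      refine hinv₂.untouched y (fun _ => hcur₂) ?_
      simpa using hy
    · intro y hy hy' hne
      simp only [St.exec_copy, St.set_reg, St.set_cat, reduceCtorEq, if_false] at hy' ⊢
      exact hinv₂.done y hy hy' (by rw [hcur₂]; exact hy.pos hn)
    · intro _
      simp only [St.exec_copy, St.set_reg, reduceCtorEq, if_true, if_false, hxm, hfr₂]
      exact ⟨hact, horg₂, fun y hy hy' => hgap y hy hy'⟩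
  have hm₃ := hm₂.of_frame hf₃ (hlt₃ hm₂.lt) (by decide)
  obtain ⟨hinv₃, hcur₃⟩ := h₃
  have hx₃ : m₃.reg x = z := by rw [hf₃ _ (by decide), hx₂]
  have hfr₃ : m₃.reg fr = m.reg fr := by rw [hf₃ _ (by decide), hfr₂]
  have hcurr₃ := hinv₃.current (by rw [hcur₃]; exact hx0)
  rw [hcur₃] at hcurr₃
  -- Move the frontier.
  refine WP.seq_frame (t₁ := 1) (t₂ := 6 * E.w + 7) (P := fun m' =>
    Inv E.graph E.w (topNode E.graph 0 s) τ m' ∧ m'.reg fr = z)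
    (WP.ins rfl hinv₃ ?_ le_rfl) (fun m₄ h₄ hf₄ hlt₄ hc₄ => ?_) (by omega)
  · have hxm : m₃.reg x % 2 ^ E.w = z := by rw [Nat.mod_eq_of_lt (hm₃.lt _), hx₃]
    refine ⟨⟨?_, ?_, ?_⟩, by simp [hxm]⟩
    · intro y hy hy'
      simp only [St.exec_copy, St.set_reg, St.set_cat, reduceCtorEq, if_true, if_false, hxm]
        at hy hy' ⊢
      refine hinv₃.untouched y hy fun h => hy' ⟨h.1, ?_⟩
      have h1 := hgap y h.1 (by rw [← hfr₃]; exact h.2)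
      refine lt_of_le_of_ne h1 fun h2 => hx0 ?_
      rw [← hcur₃]; exact hy (by rw [hcur₃]; exact h2)
    · intro y hy hy' hne
      simp only [St.exec_copy, St.set_reg, St.set_cat, reduceCtorEq, if_true, if_false, hxm]
        at hy' hne ⊢
      exact hinv₃.done y hy (by omega) hne
    · intro _
      simp only [St.exec_copy, St.set_reg, reduceCtorEq, if_true, if_false, hxm, hcur₃]
      exact ⟨hact, hcurr₃.2.1, fun y h1 h2 => h2.le⟩
  have hm₄ := hm₃.of_frame hf₄ (hlt₄ hm₃.lt) (by decide)
  obtain ⟨hinv₄, hfr₄⟩ := h₄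
  have hx₄ : m₄.reg x = z := by rw [hf₄ _ (by decide), hx₃]
  have hcur₄ : m₄.reg cur = z := by rw [hf₄ _ (by decide), hcur₃]
  refine WP.seq_frame (t₁ := 6 * E.w + 5) (t₂ := 2) (writeWord_spec hfit.lt_pow hfit.pos hm₄.one_eq
    hm₄.two_eq hm₄.wl_eq (by rw [hx₄]; exact node_mul_le hfit hact.2.1) (hm₄.lt _) ?_)
    (fun m₅ h₅ hf₅ hlt₅ _ => ?_) (by omega)
  · intro m' h1 h2
    refine hinv₄.overwrite hn (by rw [hcur₄]; exact hact) (fun r hr => h1 r ?_)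
      (by rw [hcur₄, ← hx₄]; exact h2)
    revert r; decide
  have hm₅ := hm₄.of_frame hf₅ (hlt₅ hm₄.lt) (by decide)
  obtain ⟨hinv₅, -, hoth₅, hwr₅⟩ := h₅
  rw [hx₄] at hwr₅ hoth₅
  rw [hf₄ _ (by decide), hf₃ _ (by decide), hf₂ _ (by decide), hnw₁] at hwr₅
  have hcur₅ : m₅.reg cur = z := by rw [hf₅ _ (by decide), hcur₄]
  have hfr₅ : m₅.reg fr = z := by rw [hf₅ _ (by decide), hfr₄]
  refine WP.ins rfl hinv₅ ⟨⟨?_, ?_, ?_⟩, by simp [hm₅.zero_eq], by simp [hfr₅]⟩ (by omega)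
  · intro y _ hy'
    simp only [St.exec_copy, St.set_reg, St.set_cat, reduceCtorEq, if_false] at hy' ⊢
    by_cases hy : y = z
    · rw [hy, hwr₅]
    · exact hinv₅.untouched y (fun h => absurd (h.trans hcur₅) hy) hy'
  · intro y hy hy' _
    simp only [St.exec_copy, St.set_reg, St.set_cat, reduceCtorEq, if_false] at hy' ⊢
    exact hinv₅.done y hy hy' (by rw [hcur₅]; omega)
  · simp [hm₅.zero_eq]

/-- The words `g` are those of the tape `τ` after the whole network has been processed. -/
def Processed (G : OracleDigraph n) (w rnd p dl sn : ℕ) (τ : Fin W → Bool) (g : ℕ → ℕ) : Prop :=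
  (∀ y, ¬ Active G y → g y = word w τ y) ∧
    ∀ y, Active G y → g y = (word w τ y + addend G w rnd p dl sn g y) % 2 ^ w

theorem topNode_lt (G : OracleDigraph n) {i v : ℕ} (hi : i < n) (hv : v < n) :
    topNode G i v < n ^ 3 := by
  have hd := G.inDeg_lt (by omega) v
  have h1 : i * n + v + 1 ≤ n ^ 2 := by nlinarith
  unfold topNode
  nlinarith

/-- The earlier result is moved to `prv`, so that after two passes both target values are available
for the final comparison. -/
theorem readTarget_spec (hfit : Fits n W E.w) (hm : Ready E s t m) (ht : t < n) :
    WP E (fun _ => True) readTarget (6 * E.w + 15) m fun m' => m'.reg prv = m.reg res ∧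
      m'.reg res = nodeValue E.w (m.reg rnd) (m.reg p) (m.reg dl) (topNode E.graph 0 s)
        (word E.w m.cat) (topNode E.graph (n - 1) t) % 2 ^ E.w := by
  have htn := node_mul_le hfit (topNode_lt E.graph (i := n - 1) (by omega) ht)
  rw [Nat.succ_mul] at htn
  refine WP.seq_frame (t₁ := 3) (t₂ := 6 * E.w + 12) (P := fun m' => m'.reg prv = m.reg res ∧
    m'.reg y = topNode E.graph (n - 1) t ∧ m'.reg sum = 0)
    (WP.block _ rfl ?_ le_rfl) (fun m₁ h₁ hf₁ hlt₁ hc₁ => ?_) (by omega)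
  · have h1 := Nat.mod_eq_of_lt (hm.lt res)
    have h2 := Nat.mod_eq_of_lt (hm.lt tn)
    rw [hm.tn_eq] at h2
    simp [hm.zero_eq, hm.tn_eq, h1, h2]
  have hm₁ := hm.of_frame hf₁ (hlt₁ hm.lt) (by decide)
  refine WP.seq_frame (t₁ := 6 * E.w + 11) (t₂ := 1) (addValue_spec hfit.lt_pow hm₁.one_eq
    hm₁.zero_eq hm₁.wl_eq (by rw [h₁.2.1]; omega))
    (fun m₂ h₂ hf₂ hlt₂ hc₂ => ?_) (by omega)
  refine WP.block _ rfl ?_ le_rfl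
  have hp := hf₂ prv (by decide)
  rw [h₁.2.2, h₁.2.1, hc₁ rfl, hf₁ rnd (by decide), hf₁ p (by decide), hf₁ dl (by decide),
    hm₁.sn_eq] at h₂
  simp [hp, h₁.1, h₂]

theorem pass_spec (hfit : Fits n W E.w) (hm : Ready E s t m) (ht : t < n)
    (hinv : Inv E.graph E.w (topNode E.graph 0 s) τ m) (hcur : m.reg cur = 0)
    (hfr : m.reg fr = n ^ 2) :
    WP E (Inv E.graph E.w (topNode E.graph 0 s) τ) pass
      (numActive E.graph * (48 * E.w + 190) + 6 * E.w + 20) m fun m' =>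
      Ready E s t m' ∧ Inv E.graph E.w (topNode E.graph 0 s) τ m' ∧ m'.reg cur = 0 ∧
      m'.reg fr = n ^ 2 ∧ (∀ r ∈ [Reg.rnd, .p, .dl], m'.reg r = m.reg r) ∧
      m'.reg prv = m.reg res ∧ ∃ g, Processed E.graph E.w (m.reg rnd) (m.reg p) (m.reg dl)
        (topNode E.graph 0 s) τ g ∧ m'.reg res = nodeValue E.w (m.reg rnd) (m.reg p) (m.reg dl)
          (topNode E.graph 0 s) g (topNode E.graph (n - 1) t) % 2 ^ E.w := by
  have hn : 0 < n := by have := hfit.two_le; omega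
  have hn23 : n ^ 2 ≤ n ^ 3 := Nat.pow_le_pow_right hn (by omega)
  have ht1 : numActive E.graph * (48 * E.w + 190) =
    numActive E.graph * (24 * E.w + 90 + 2) + numActive E.graph * (24 * E.w + 90 + 2) +
      numActive E.graph * 6 := by ring
  refine WP.seq (t₁ := numActive E.graph * (24 * E.w + 90 + 2) + 2)
    (t₂ := 6 * E.w + 15 + (numActive E.graph * (24 * E.w + 90 + 2) + 2)) ?_ (by omega)
  have hsame : ∀ m' m'', Same m m' → Same m' m'' → Same m m'' := fun m' m'' h1 h2 r hr =>
    (h2 r hr).trans (h1 r hr)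
  refine WP.loop_measure (fun m' => Ready E s t m' ∧ Inv E.graph E.w (topNode E.graph 0 s) τ m' ∧
    m'.reg cur = 0 ∧ Stop E.graph (m'.reg fr) ∧ Same m m')
    (fun m' => numFrom E.graph (m'.reg fr)) (24 * E.w + 90) (fun m' h => h.2.1) ?_ ?_
    (numActive E.graph) m (numFrom_le _)
    ⟨hm, hinv, hcur, by rw [hfr]; exact stop_sq hfit.two_le, fun r _ => rfl⟩ le_rfl
  · rintro m' ⟨hm', hinv', hcur', hfront, hs⟩ hlt
    have hact : Active E.graph (m'.reg fr) := by
      rcases hfront with h | h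
      · exact h
      · rw [h, hm'.n3_eq] at hlt; omega
    refine (forwardStep_spec hfit hm' hinv' hcur' hact).imp le_rfl ?_
    rintro m'' ⟨h1, h2, h3, h4, h5⟩
    refine ⟨⟨h1, h2, h3, ?_, hsame _ _ hs h5⟩, ?_⟩
    · rw [h4]; exact stop_nextNode hn hact
    · rw [h4]; exact numFrom_nextNode hn hact
  rintro m₁ ⟨hm₁, hinv₁, hcur₁, hfront₁, hs₁⟩ hge
  have hfr₁ : m₁.reg fr = n ^ 3 := by
    rcases hfront₁ with h | h
    · have := h.2.1
      rw [hm₁.n3_eq] at hge; omega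
    · exact h
  have hp₁ := hs₁ p (by decide)
  have hr₁ := hs₁ rnd (by decide)
  have hd₁ := hs₁ dl (by decide)
  refine WP.seq (t₁ := 6 * E.w + 15) (t₂ := numActive E.graph * (24 * E.w + 90 + 2) + 2) ?_ le_rfl
  refine ((readTarget_spec hfit hm₁ ht).pure hinv₁ rfl (by decide)).imp le_rfl ?_
  rintro m₂ ⟨⟨hprv₂, hres₂⟩, hinv₂, hc₂, hf₂, hlt₂⟩
  have hm₂ := hm₁.of_frame hf₂ (hlt₂ hm₁.lt) (by decide)
  -- With the frontier at `n ^ 3` and `cur = 0`, the invariant says precisely that every active node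
  -- has been processed. The words of this moment serve as the witness `g`.
  have hproc : Processed E.graph E.w (m.reg rnd) (m.reg p) (m.reg dl) (topNode E.graph 0 s) τ
      (word E.w m₁.cat) := by
    refine ⟨fun y hy => hinv₁.untouched y (fun _ => hcur₁) fun h => hy h.1, fun y hy => ?_⟩
    rw [← hp₁, ← hr₁, ← hd₁]
    exact hinv₁.done y hy (by rw [hfr₁]; exact hy.2.1) (by rw [hcur₁]; exact hy.pos hn)
  rw [hp₁, hr₁, hd₁] at hres₂
  refine WP.loop_measure (fun m' => Ready E s t m' ∧ Inv E.graph E.w (topNode E.graph 0 s) τ m' ∧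
    m'.reg cur = 0 ∧ Stop E.graph (m'.reg fr) ∧ n ^ 2 ≤ m'.reg fr ∧ Same m₂ m')
    (fun m' => numBefore E.graph (m'.reg fr)) (24 * E.w + 90) (fun m' h => h.2.1) ?_ ?_
    (numActive E.graph) m₂ (numBefore_le _)
    ⟨hm₂, hinv₂, by rw [hf₂ _ (by decide), hcur₁], by rw [hf₂ _ (by decide)]; exact hfront₁,
      by rw [hf₂ _ (by decide), hfr₁]; exact hn23, fun r _ => rfl⟩ le_rfl
  · rintro m' ⟨hm', hinv', hcur', hfront, hge, hs⟩ hlt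
    rw [hm'.n2_eq] at hlt
    refine (backwardStep_spec hfit hm' hinv' hcur' hfront hlt).imp le_rfl ?_
    rintro m'' ⟨h1, h2, h3, h4, h5⟩
    obtain ⟨g1, g2, -⟩ := prevNode_spec hfit.two_le hfront hlt
    refine ⟨⟨h1, h2, h3, ?_, ?_, fun r hr => (h5 r hr).trans (hs r hr)⟩, ?_⟩
    · rw [h4]; exact .inl g1
    · rw [h4]; exact g1.1
    · rw [h4]; exact numBefore_lt g1 g2
  rintro m₃ ⟨hm₃, hinv₃, hcur₃, -, hge₃, hs₃⟩ hle₃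
  rw [hm₃.n2_eq] at hle₃
  refine ⟨hm₃, hinv₃, hcur₃, by omega, ?_, ?_, _, hproc, ?_⟩
  · intro r hr
    rw [hs₃ r (by revert r; decide), hf₂ r (by revert r; decide), hs₁ r (by revert r; decide)]
  · rw [hs₃ _ (by decide), hprv₂, hs₁ _ (by decide)]
  · rw [hs₃ _ (by decide), hres₂]

end Passes

/-! ### Sampling, the modulus, and the main program as a whole -/

section Main

variable {n W : ℕ} {E : Env n} {m : St Reg W} {s t : ℕ} {τ : Fin W → Bool}

/-- The number formed by the coins tossed in `i` rounds of the sampling loop. -/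
def sampled (ω : ℕ → Bool) (k : ℕ) : ℕ → ℕ
  | 0 => 0
  | i + 1 => 2 * sampled ω k i + (ω (k + 6 * i)).toNat

theorem sampled_succ (ω : ℕ → Bool) (k i : ℕ) :
    sampled ω k (i + 1) = 2 * sampled ω k i + (ω (k + 6 * i)).toNat := rfl

theorem sampled_lt (ω : ℕ → Bool) (k : ℕ) : ∀ i, sampled ω k i < 2 ^ i
  | 0 => by simp [sampled]
  | i + 1 => by
    have := sampled_lt ω k i
    have := Bool.toNat_lt (ω (k + 6 * i))
    rw [sampled, pow_succ]; omega

/-- Here the final memory depends on the coins, so an exact `Run` replaces `WP`. Each round takes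
six steps, four instructions and two jumps, and the first toss is at time `k + 2`; this explains the
times at which `sampled` reads `ω`. -/
theorem sample_run (hm : Ready E s t m) (hr : m.reg rnd = 0) (hcat : m.cat = τ)
    (hcur : m.reg cur = 0) (hfr : m.reg fr = 0) (sn : ℕ) (ω : ℕ → Bool) (k : ℕ) :
    ∃ m', Run E ω (Inv E.graph E.w sn τ) sample k m (k + (6 * E.w + 3)) m' ∧
      m'.reg rnd = sampled ω (k + 2) E.w := by
  have hI : ∀ m' : St Reg W, m'.cat = m.cat →
      (∀ r, r ∉ [Reg.j, .b, .rnd] → m'.reg r = m.reg r) → Inv E.graph E.w sn τ m' := by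
    intro m' h1 h2
    refine Inv.of_start (fun y => by rw [h1, hcat]) ?_ ?_
    · rw [h2 _ (by decide), hcur]
    · rw [h2 _ (by decide), hfr]; omega
  suffices H : ∃ m', Run E ω (fun _ => True) sample k m (k + (6 * E.w + 3)) m' ∧
      m'.reg rnd = sampled ω (k + 2) E.w by
    obtain ⟨m', h1, h2⟩ := H
    exact ⟨m', h1.strengthen rfl (L := [Reg.j, .b, .rnd]) (by decide) hI, h2⟩
  have hwlt : E.w < 2 ^ E.w := Nat.lt_two_pow_self
  have hloop : ∀ d i (m' : St Reg W), i + d = E.w → m'.reg j = i → m'.reg wl = E.w →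
      m'.reg one = 1 → m'.reg rnd = sampled ω (k + 2) i → ∃ m'',
        Run E ω (fun _ => True) (.loop j wl (.ins (.coin b) ;; .ins (.arith .add rnd rnd rnd) ;;
          .ins (.arith .add rnd rnd b) ;; .ins (.arith .add j j one)))
          (k + 1 + 6 * i) m' (k + (6 * E.w + 3)) m'' ∧ m''.reg rnd = sampled ω (k + 2) E.w := by
    intro d
    induction d with
    | zero =>
      intro i m' hi hj hwl ho hr
      obtain rfl : i = E.w := by omega
      refine ⟨m', ?_, hr⟩
      rw [show k + (6 * E.w + 3) = k + 1 + 6 * E.w + 2 by ring]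
      exact .loopFalse (by omega) trivial
    | succ d ih =>
      intro i m' hi hj hwl ho hr
      set k₁ := k + 1 + 6 * i + 1 with hk₁
      set m₁ := (((m'.exec E (ω k₁) (.coin b)).exec E (ω (k₁ + 1)) (.arith .add rnd rnd rnd)).exec E
        (ω (k₁ + 2)) (.arith .add rnd rnd b)).exec E (ω (k₁ + 3)) (.arith .add j j one) with hm₁
      have hbody : Run E ω (fun _ => True) (.ins (.coin b) ;; .ins (.arith .add rnd rnd rnd) ;;
          .ins (.arith .add rnd rnd b) ;; .ins (.arith .add j j one)) k₁ m' (k₁ + 4) m₁ :=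
        .seq (.ins _ _ _ rfl trivial) (.seq (.ins _ _ _ rfl trivial)
          (.seq (.ins _ _ _ rfl trivial) (.ins _ _ _ rfl trivial)))
      have hs := sampled_lt ω (k + 2) (i + 1)
      have hle : 2 ^ (i + 1) ≤ 2 ^ E.w := Nat.pow_le_pow_right (by omega) (by omega)
      have hrnd : (sampled ω (k + 2) i + sampled ω (k + 2) i +
          (ω k₁).toNat) % 2 ^ E.w = sampled ω (k + 2) (i + 1) := by
        rw [hk₁, show k + 1 + 6 * i + 1 = k + 2 + 6 * i by ring, ← two_mul,
          ← sampled_succ, Nat.mod_eq_of_lt (by omega)]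
      have hi1 : (i + 1) % 2 ^ E.w = i + 1 := Nat.mod_eq_of_lt (by omega)
      obtain ⟨m'', h1, h2⟩ := ih (i + 1) m₁ (by omega) (by simp [hm₁, hj, ho, hi1])
        (by simp [hm₁, hwl]) (by simp [hm₁, ho]) (by simp [hm₁, hr, hrnd])
      refine ⟨m'', .loopTrue (by omega) trivial hbody trivial ?_, h2⟩
      rw [hk₁, show k + 1 + 6 * i + 1 + 4 + 1 = k + 1 + 6 * (i + 1) by ring]
      exact h1
  obtain ⟨m'', h1, h2⟩ := hloop E.w 0 (m.exec E (ω k) (.copy j zero)) (by omega)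
    (by simp [hm.zero_eq]) (by simp [hm.wl_eq]) (by simp [hm.one_eq]) (by simp [hr, sampled])
  exact ⟨m'', .seq (.ins _ _ _ rfl trivial) h1, h2⟩

theorem iter_square {I : St Reg W → Prop} (hI : ∀ m' : St Reg W, m'.cat = m.cat →
      (∀ r, r ∉ [big] → m'.reg r = m.reg r) → I m') {c : ℕ} (hbig : m.reg big = c) :
    ∀ k, c ^ 2 ^ k < 2 ^ E.w → 0 < c →
      WP E I (.iter (.ins (.arith .mul big big big)) k) k m fun m' =>
        m'.reg big = c ^ 2 ^ k ∧ m'.cat = m.cat ∧ ∀ r, r ∉ [big] → m'.reg r = m.reg r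
  | 0, _, _ => WP.skip (by simp [hbig])
  | k + 1, hlt, hc => by
    have hle : c ^ 2 ^ k ≤ c ^ 2 ^ (k + 1) :=
      Nat.pow_le_pow_right hc (Nat.pow_le_pow_right (by omega) (by omega))
    refine WP.seq (t₁ := k) (t₂ := 1) ((iter_square hI hbig k (by omega) hc).imp le_rfl ?_) le_rfl
    rintro m' ⟨h1, h2, h3⟩
    refine WP.ins rfl (hI m' h2 h3) ⟨?_, h2, ?_⟩ le_rfl
    · have : c ^ 2 ^ k * c ^ 2 ^ k = c ^ 2 ^ (k + 1) := by rw [← pow_add]; congr 1; ring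
      simp [h1, this, Nat.mod_eq_of_lt hlt]
    · intro r hr
      rw [← h3 r hr]
      simp at hr
      simp [hr]

/-- Ten squarings turn `n` into `n ^ 1024`; the final `+ 1` keeps the modulus positive. -/
theorem computeModulus_spec (hfit : Fits n W E.w) (hm : Ready E s t m) :
    WP E (fun _ => True) computeModulus 13 m fun m' =>
      m'.reg p = m.reg rnd % n ^ 1024 + 1 := by
  have hn : 0 < n := by have := hfit.two_le; omega
  have hbig := hfit.big_lt
  have hpos : 0 < n ^ 1024 := Nat.pow_pos hn
  refine WP.seq_frame (t₁ := 1) (t₂ := 12) (P := fun m' => m'.reg big = n)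
    (WP.block _ rfl ?_ le_rfl) (fun m₁ h₁ hf₁ hlt₁ hc₁ => ?_) (by omega)
  · have h1 := Nat.mod_eq_of_lt (hm.lt Reg.n)
    rw [hm.n_eq] at h1
    simp [hm.n_eq, h1]
  refine WP.seq (t₁ := 10) (t₂ := 2) ((iter_square (fun _ _ _ => trivial) h₁ 10 ?_ hn).imp le_rfl
    ?_) (by omega)
  · rw [show (2 ^ 10 : ℕ) = 1024 from rfl]; exact hbig
  rintro m₂ ⟨h2, hc₂, hf₂⟩
  rw [show (2 ^ 10 : ℕ) = 1024 from rfl] at h2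
  refine WP.block _ rfl ?_ le_rfl
  have e1 : m₂.reg rnd = m.reg rnd := by rw [hf₂ _ (by decide), hf₁ _ (by decide)]
  have e2 : m₂.reg one = 1 := by rw [hf₂ _ (by decide), hf₁ _ (by decide), hm.one_eq]
  have e3 := Nat.mod_lt (m.reg rnd) hpos
  have e4 : (m.reg rnd % n ^ 1024 + 1) % 2 ^ E.w = m.reg rnd % n ^ 1024 + 1 :=
    Nat.mod_eq_of_lt (by omega)
  simp [e1, e2, h2, e4]

/-- The main program: timing, local revertibility invariant, restoration of the tape, and the
values of the target in the two passes. -/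
theorem mainCmd_run (s₀ t₀ : Fin n) (hfit : Fits n W E.w) (hn : E.args.getD 0 0 = n)
    (hs : E.args.getD 1 0 = s₀) (ht : E.args.getD 2 0 = t₀) (τ : Fin W → Bool) :
    ∃ k₀, k₀ ≤ 6 * E.w + 20 ∧ ∀ ω, ∃ k m',
      k ≤ numActive E.graph * (96 * E.w + 380) + 24 * E.w + 100 ∧
      Run E ω (Inv E.graph E.w (topNode E.graph 0 s₀) τ) mainCmd 0 ⟨fun _ => 0, τ⟩ k m' ∧
      Inv E.graph E.w (topNode E.graph 0 s₀) τ m' ∧ m'.cat = τ ∧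
      ∃ r q g₀ g₁, r = sampled ω k₀ E.w ∧ q = r % n ^ 1024 + 1 ∧
        Processed E.graph E.w r q 0 (topNode E.graph 0 s₀) τ g₀ ∧
        Processed E.graph E.w r q 1 (topNode E.graph 0 s₀) τ g₁ ∧
        m'.reg prv = nodeValue E.w r q 0 (topNode E.graph 0 s₀) g₀
          (topNode E.graph (n - 1) t₀) % 2 ^ E.w ∧
        m'.reg res = nodeValue E.w r q 1 (topNode E.graph 0 s₀) g₁
          (topNode E.graph (n - 1) t₀) % 2 ^ E.w := by
  obtain ⟨d₁, m₁, hd₁, ⟨hm₁, hI₁, hc₁, hf₁, hlt₁⟩, hrun₁⟩ := (setup_spec (E := E)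
    (m := ⟨fun _ => 0, τ⟩) s₀ t₀ hfit hn hs ht rfl rfl rfl (fun _ => by positivity)).pure
      (Inv.of_start (G := E.graph) (w := E.w) (sn := topNode E.graph 0 s₀) (τ := τ)
      (fun _ => rfl) rfl (Nat.zero_le _)) rfl (by decide)
  -- `d₁`, the duration of `setup`, does not depend on the coins. Hence the positions of the tosses
  -- that form `r` are fixed in advance, as uniformity of `r` requires.
  refine ⟨d₁ + 2, by omega, fun ω => ?_⟩
  obtain ⟨m₂, hrun₂, hr₂⟩ := sample_run (E := E) (τ := τ) hm₁ (hf₁ _ (by decide)) hc₁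
    (hf₁ _ (by decide)) (hf₁ _ (by decide)) (topNode E.graph 0 s₀) ω d₁
  have hf₂ := hrun₂.frame
  have hc₂ : m₂.cat = τ := (hrun₂.cat_eq rfl).trans hc₁
  have hm₂ := hm₁.of_frame hf₂ (hrun₂.reg_lt hm₁.lt) (by decide)
  have hcur₂ : m₂.reg cur = 0 := by rw [hf₂ _ (by decide), hf₁ _ (by decide)]
  have hfr₂ : m₂.reg fr = 0 := by rw [hf₂ _ (by decide), hf₁ _ (by decide)]
  have hdl₂ : m₂.reg dl = 0 := by rw [hf₂ _ (by decide), hf₁ _ (by decide)]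
  obtain ⟨d₃, m₃, hd₃, ⟨⟨hp₃, hI₃⟩, hf₃, hlt₃, hc₃⟩, hrun₃⟩ := ((computeModulus_spec hfit
    hm₂).strengthen (I := Inv E.graph E.w (topNode E.graph 0 s₀) τ) rfl (L := computeModulus.writes)
    (fun _ h => h) (fun m' h1 h2 => Inv.of_start (fun y => by rw [h1, hc₂])
      (by rw [h2 _ (by decide), hcur₂])
      (by rw [h2 _ (by decide), hfr₂]; exact Nat.zero_le _))).frame
  have hm₃ := hm₂.of_frame hf₃ (hlt₃ hm₂.lt) (by decide)
  have hc₃' : m₃.cat = τ := (hc₃ rfl).trans hc₂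
  have hcur₃ : m₃.reg cur = 0 := by rw [hf₃ _ (by decide), hcur₂]
  have hdl₃ : m₃.reg dl = 0 := by rw [hf₃ _ (by decide), hdl₂]
  have hrnd₃ : m₃.reg rnd = sampled ω (d₁ + 2) E.w := by rw [hf₃ _ (by decide), hr₂]
  rw [hr₂] at hp₃
  have htail : WP E (Inv E.graph E.w (topNode E.graph 0 s₀) τ) (.ins (.copy fr n2) ;; pass ;;
      .ins (.copy dl one) ;; pass)
      (numActive E.graph * (96 * E.w + 380) + 12 * E.w + 50) m₃ fun m' =>
      Inv E.graph E.w (topNode E.graph 0 s₀) τ m' ∧ m'.cat = τ ∧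
      ∃ g₀ g₁,
        Processed E.graph E.w (m₃.reg rnd) (m₃.reg p) 0 (topNode E.graph 0 s₀) τ g₀ ∧
        Processed E.graph E.w (m₃.reg rnd) (m₃.reg p) 1 (topNode E.graph 0 s₀) τ g₁ ∧
        m'.reg prv = nodeValue E.w (m₃.reg rnd) (m₃.reg p) 0 (topNode E.graph 0 s₀) g₀
          (topNode E.graph (n - 1) t₀) % 2 ^ E.w ∧
        m'.reg res = nodeValue E.w (m₃.reg rnd) (m₃.reg p) 1 (topNode E.graph 0 s₀) g₁
          (topNode E.graph (n - 1) t₀) % 2 ^ E.w := by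
    have e : numActive E.graph * (96 * E.w + 380) =
      numActive E.graph * (48 * E.w + 190) + numActive E.graph * (48 * E.w + 190) := by ring
    refine WP.seq_frame (t₁ := 1) (t₂ := numActive E.graph * (96 * E.w + 380) + 12 * E.w + 49)
      (P := fun m' => m'.reg fr = n ^ 2)
      (WP.ins rfl hI₃ ?_ le_rfl) (fun m₄ hfr₄ hf₄ hlt₄ hc₄ => ?_) (by omega)
    · have h1 := Nat.mod_eq_of_lt (hm₃.lt n2)
      rw [hm₃.n2_eq] at h1
      simp [hm₃.n2_eq, h1]
    have hm₄ := hm₃.of_frame hf₄ (hlt₄ hm₃.lt) (by decide)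
    have hcur₄ : m₄.reg cur = 0 := by rw [hf₄ _ (by decide), hcur₃]
    have hI₄ : Inv E.graph E.w (topNode E.graph 0 s₀) τ m₄ :=
      Inv.of_start (fun y => by rw [hc₄ rfl, hc₃']) hcur₄ hfr₄.le
    refine WP.seq (t₁ := numActive E.graph * (48 * E.w + 190) + 6 * E.w + 20)
      (t₂ := numActive E.graph * (48 * E.w + 190) + 6 * E.w + 21) ?_ (by omega)
    refine (pass_spec hfit hm₄ t₀.2 hI₄ hcur₄ hfr₄).imp le_rfl ?_
    rintro m₅ ⟨hm₅, hI₅, hcur₅, hfr₅, hpar₅, -, g₀, hg₀, hres₅⟩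
    rw [hf₄ rnd (by decide), hf₄ p (by decide), hf₄ dl (by decide), hdl₃] at hg₀ hres₅
    refine WP.seq_frame (t₁ := 1) (t₂ := numActive E.graph * (48 * E.w + 190) + 6 * E.w + 20)
      (P := fun m' => m'.reg dl = 1) (WP.ins rfl hI₅ ?_ le_rfl)
      (fun m₆ hdl₆ hf₆ hlt₆ hc₆ => ?_) (by omega)
    · have h1 := Nat.mod_eq_of_lt (hm₅.lt one)
      rw [hm₅.one_eq] at h1
      simp [hm₅.one_eq, h1]
    have hm₆ := hm₅.of_frame hf₆ (hlt₆ hm₅.lt) (by decide)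
    have hcur₆ : m₆.reg cur = 0 := by rw [hf₆ _ (by decide), hcur₅]
    have hfr₆ : m₆.reg fr = n ^ 2 := by rw [hf₆ _ (by decide), hfr₅]
    -- The first pass has undone everything, so no processed word depends on the old value of `dl`,
    -- and changing it is harmless.
    have hI₆ : Inv E.graph E.w (topNode E.graph 0 s₀) τ m₆ :=
      Inv.of_start (fun y => by rw [hc₆ rfl]; exact hI₅.word_eq hcur₅ hfr₅.le y) hcur₆ hfr₆.le
    refine (pass_spec hfit hm₆ t₀.2 hI₆ hcur₆ hfr₆).imp le_rfl ?_
    rintro m₇ ⟨hm₇, hI₇, hcur₇, hfr₇, hpar₇, hprv₇, g₁, hg₁, hres₇⟩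
    rw [hf₆ rnd (by decide), hf₆ p (by decide), hdl₆, hpar₅ _ (by decide), hpar₅ _ (by decide),
      hf₄ rnd (by decide), hf₄ p (by decide)] at hg₁ hres₇
    refine ⟨hI₇, cat_eq_of_word_eq hfit.pos (hI₇.word_eq hcur₇ hfr₇.le), g₀, g₁, hg₀, hg₁, ?_, hres₇⟩
    rw [hprv₇, hf₆ _ (by decide), hres₅]
  obtain ⟨d₄, m₄, hd₄, ⟨h1, h2, g₀, g₁, h3⟩, hrun₄⟩ := htail
  refine ⟨0 + d₁ + (6 * E.w + 3) + d₃ + d₄, m₄, by omega, ?_, h1, h2, _, _, g₀, g₁, hrnd₃, ?_, h3⟩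
  · refine .seq (hrun₁ ω 0) (.seq ?_ (.seq (hrun₃ ω _) (hrun₄ ω _)))
    simpa using hrun₂
  · rw [hp₃, hrnd₃]

end Main

/-! ### The query routine -/

section Query

variable {n W : ℕ} {E : Env n} {m : St Reg W} {τ : Fin W → Bool}

/-- The nested tests follow the cases of `Inv`: a word in layer 0, at or beyond the frontier,
outside the network, or at an inactive position is untouched; the word at `cur` is in `org`; any
other has its addend subtracted. One addend costs `O(w)` steps, so no rewinding is needed. -/
theorem queryCmd_spec (s₀ t₀ : Fin n) (hfit : Fits n W E.w) (hn : E.args.getD 0 0 = n)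
    (hs : E.args.getD 1 0 = s₀) (ht : E.args.getD 2 0 = t₀) {i : Fin W}
    (hi : E.args.getD 3 0 = i) (hwl₀ : m.reg wl = 0) (hm₀ : m.reg m1 = 0)
    (hz₀ : m.reg zero = 0) (hlt₀ : ∀ r, m.reg r < 2 ^ E.w)
    (hinv : Inv E.graph E.w (topNode E.graph 0 s₀) τ m) :
    WP E (fun _ => True) queryCmd (28 * E.w + 110) m fun m' =>
      m'.reg ow = (τ i).toNat ∧ m'.reg zero = 0 := by
  have hW := hfit.lt_pow
  have hw := hfit.pos
  have h2n := hfit.two_le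
  have hi2 := i.2
  set y₀ := (i : ℕ) / E.w with hy₀
  set b₀ := (i : ℕ) % E.w with hb₀
  have hb : b₀ < E.w := Nat.mod_lt _ hw
  have hyb : y₀ * E.w + b₀ = i := Nat.div_add_mod' _ _
  have hyle : y₀ ≤ i := Nat.div_le_self _ _
  have hble : b₀ ≤ i := Nat.mod_le _ _
  have hmod : ∀ z, z ≤ W → z % 2 ^ E.w = z := fun z hz => Nat.mod_eq_of_lt (by omega)
  have htest : (word E.w τ y₀).testBit b₀ = τ i := by
    rw [testBit_word hb, hyb]; simp [St.bit]
  refine WP.seq_frame (t₁ := 6 * E.w + 18) (t₂ := 22 * E.w + 92)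
    (setup_spec s₀ t₀ hfit hn hs ht hwl₀ hm₀ hz₀ hlt₀) (fun m₁ hm₁ hf₁ _ hc₁ => ?_) (by omega)
  refine WP.seq_frame (t₁ := 4) (t₂ := 22 * E.w + 88)
    (P := fun m' => m'.reg x = y₀ ∧ m'.reg y = y₀ ∧ m'.reg qb = b₀)
    (WP.block _ rfl ?_ le_rfl) (fun m₂ h₂ hf₂ hlt₂ hc₂ => ?_) (by omega)
  · have e1 := hmod i hi2.le
    have e2 := hmod y₀ (by omega)
    have e3 := hmod b₀ (by omega)
    simp only [List.getD_eq_getElem?_getD] at hi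
    simp [hi, hm₁.wl_eq, e1, ← hy₀, ← hb₀, e2, e3]
  have hm₂ := hm₁.of_frame hf₂ (hlt₂ hm₁.lt) (by decide)
  refine WP.seq_frame (t₁ := 6 * E.w + 5) (t₂ := 16 * E.w + 83)
    (readWord_spec hW hm₂.one_eq hm₂.zero_eq hm₂.wl_eq (by rw [h₂.2.1]; omega))
    (fun m₃ hacc hf₃ hlt₃ hc₃ => ?_) (by omega)
  have hm₃ := hm₂.of_frame hf₃ (hlt₃ hm₂.lt) (by decide)
  refine WP.seq_frame (t₁ := 1) (t₂ := 16 * E.w + 82)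
    (P := fun m' => m'.reg ow = word E.w m.cat y₀)
    (WP.block _ rfl ?_ le_rfl) (fun m₄ how hf₄ hlt₄ hc₄ => ?_) (by omega)
  · simp [hacc, h₂.2.1, hc₂ rfl, hc₁ rfl, Nat.mod_eq_of_lt (word_lt _ _ _)]
  have hm₄ := hm₃.of_frame hf₄ (hlt₄ hm₃.lt) (by decide)
  have hc₄' : m₄.cat = m.cat := by rw [hc₄ rfl, hc₃ rfl, hc₂ rfl, hc₁ rfl]
  have hx₄ : m₄.reg x = y₀ := by rw [hf₄ _ (by decide), hf₃ _ (by decide), h₂.1]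
  have hqb₄ : m₄.reg qb = b₀ := by rw [hf₄ _ (by decide), hf₃ _ (by decide), h₂.2.2]
  have hreg₄ : ∀ r ∈ invRegs, m₄.reg r = m.reg r := by
    intro r hr
    rw [hf₄ r (by revert r; decide), hf₃ r (by revert r; decide), hf₂ r (by revert r; decide),
      hf₁ r (by revert r; decide)]
  have hinv₄ : Inv E.graph E.w (topNode E.graph 0 s₀) τ m₄ := hinv.congr hc₄' hreg₄
  rw [← hc₄'] at how
  clear_value y₀ b₀
  refine WP.seq_frame (t₁ := 12 * E.w + 70) (t₂ := 4 * E.w + 12)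
    (P := fun m' => m'.reg ow = word E.w τ y₀) ?_ (fun m₅ how₅ hf₅ hlt₅ hc₅ => ?_) (by omega)
  · have hunt : ¬ (Active E.graph y₀ ∧ y₀ < m₄.reg fr) → (y₀ = m₄.reg cur → m₄.reg cur = 0) →
        m₄.reg ow = word E.w τ y₀ := fun h1 h2 => by rw [how]; exact hinv₄.untouched _ h2 h1
    have hcurpos : m₄.reg cur ≠ 0 → n ^ 2 ≤ m₄.reg cur := fun h => (hinv₄.current h).1.1
    -- Layer 0 is split off first. Otherwise a query to node 0 would match the idle value `cur = 0`
    -- and return the meaningless content of `org`.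
    refine WP.ite (t := 12 * E.w + 68) trivial (fun h => WP.skip ?_) (fun h => ?_) le_rfl
    · rw [Cond.holds_lt, hm₄.n2_eq, hx₄] at h
      refine hunt (fun h' => ?_) (fun h' => ?_)
      · have := h'.1.1; omega
      · by_contra h0
        have := hcurpos h0; omega
    rw [Cond.holds_lt, hm₄.n2_eq, hx₄, not_lt] at h
    have hy0 : y₀ ≠ 0 := by
      have : 0 < n ^ 2 := by positivity
      omega
    refine WP.imp (t := 12 * E.w + 68) (Q := fun m' => m'.reg ow = word E.w τ y₀) ?_ le_rfl
      fun _ h => ⟨trivial, h⟩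
    refine WP.ite (t := 12 * E.w + 66) trivial (fun h' => WP.block _ rfl ?_ (by simp)) (fun h' => ?_)
      le_rfl
    · rw [Cond.holds_eq, hx₄] at h'
      have := (hinv₄.current (by omega)).2.1
      rw [← h'] at this
      simp [this, Nat.mod_eq_of_lt (word_lt _ _ _)]
    rw [Cond.holds_eq, hx₄] at h'
    refine WP.imp (t := 12 * E.w + 66) (Q := fun m' => m'.reg ow = word E.w τ y₀) ?_ le_rfl
      fun _ h => ⟨trivial, h⟩
    refine WP.ite (t := 12 * E.w + 64) trivial (fun h₃ => ?_) (fun h₃ => WP.skip ⟨trivial, ?_⟩)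
      le_rfl
    swap
    · rw [Cond.holds_lt, hx₄] at h₃
      exact hunt (fun h => h₃ h.2) fun h => absurd h h'
    rw [Cond.holds_lt, hx₄] at h₃
    refine WP.imp (t := 12 * E.w + 64) (Q := fun m' => m'.reg ow = word E.w τ y₀) ?_ le_rfl
      fun _ h => h
    refine WP.ite (t := 12 * E.w + 62) trivial (fun h₇ => ?_) (fun h₇ => WP.skip ⟨trivial, ?_⟩)
      le_rfl
    swap
    · rw [Cond.holds_lt, hm₄.n3_eq, hx₄] at h₇
      exact hunt (fun h => h₇ h.1.2.1) fun h => absurd h h'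
    rw [Cond.holds_lt, hm₄.n3_eq, hx₄] at h₇
    have hdm := hmod (y₀ / n) ((Nat.div_le_self _ _).trans (by omega))
    have hdm2 := hmod (y₀ / n % n) ((Nat.mod_le _ _).trans ((Nat.div_le_self _ _).trans (by omega)))
    have hjm := hmod (y₀ % n) ((Nat.mod_le _ _).trans (by omega))
    have hdeg := E.graph.inDeg_lt (by omega) (y₀ / n % n)
    have hn3 : n ^ 3 * 1 ≤ W := (Nat.mul_le_mul_left _ hfit.pos).trans hfit.cube_le
    have hnn : n ≤ n ^ 3 := Nat.le_self_pow (by omega) n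
    have hdm3 := hmod (E.graph.inDeg (y₀ / n % n)) (by omega)
    refine WP.seq_frame (t₁ := 4) (t₂ := 12 * E.w + 58) (P := fun m' =>
      m'.reg j = y₀ % n ∧ m'.reg d = E.graph.inDeg (y₀ / n % n))
      (WP.block _ rfl ?_ le_rfl) (fun m₅ h₅ hf₅ hlt₅ hc₅ => ?_) (by omega)
    · simp [hx₄, hm₄.n_eq, hdm, hdm2, hjm, hdm3]
    have hm₅ := hm₄.of_frame hf₅ (hlt₅ hm₄.lt) (by decide)
    have how₅ : m₅.reg ow = m₄.reg ow := hf₅ _ (by decide)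
    refine WP.ite (t := 12 * E.w + 56) trivial (fun h₆ => WP.skip ?_) (fun h₆ => ?_) le_rfl
    · rw [Cond.holds_lt, h₅.1, h₅.2] at h₆
      rw [how₅]
      refine hunt (fun h => ?_) fun h => absurd h h'
      have := h.1.2.2; omega
    rw [Cond.holds_lt, h₅.1, h₅.2, not_lt] at h₆
    refine WP.imp (t := 12 * E.w + 56) (Q := fun m' => m'.reg ow = word E.w τ y₀) ?_ le_rfl
      fun _ h => ⟨trivial, h⟩
    have hact : Active E.graph y₀ := ⟨h, h₇, h₆⟩
    have hx₅ : m₅.reg x = y₀ := by rw [hf₅ _ (by decide), hx₄]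
    refine WP.seq_frame (t₁ := 12 * E.w + 50) (t₂ := 2)
      (computeAddend_spec hfit hm₅ (by rw [hx₅]; exact hact))
      (fun m₆ hsum hf₆ hlt₆ hc₆ => WP.block _ rfl ?_ le_rfl) (by omega)
    have hm₆ := hm₅.of_frame hf₆ (hlt₆ hm₅.lt) (by decide)
    rw [hx₅, hc₅ rfl, hf₅ rnd (by decide), hf₅ p (by decide), hf₅ dl (by decide)] at hsum
    have how₆ : m₆.reg ow = (word E.w τ y₀ + addend E.graph E.w (m₄.reg rnd) (m₄.reg p)
        (m₄.reg dl) (topNode E.graph 0 s₀) (word E.w m₄.cat) y₀) % 2 ^ E.w := by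
      rw [hf₆ _ (by decide), how₅, how, hinv₄.done _ hact h₃ h']
    simp only [List.foldl_cons, List.foldl_nil, St.exec_mul, St.exec_add, St.set_reg, reduceCtorEq,
      if_true, if_false, hsum, how₆, hm₆.m1_eq]
    exact add_sub_word (word_lt _ _ _)
  have hm₅ := hm₄.of_frame hf₅ (hlt₅ hm₄.lt) (by decide)
  have hqb₅ : m₅.reg qb = b₀ := by rw [hf₅ _ (by decide), hqb₄]
  refine WP.seq (t₁ := 4 * E.w + 2) (t₂ := 1) ?_ (by omega)
  -- Halving `b₀` times moves the requested bit to the units place.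
  refine WP.loop (fun k m' => k ≤ b₀ ∧ m'.reg qb = k ∧ m'.reg ow = word E.w τ y₀ / 2 ^ (b₀ - k) ∧
    m'.reg one = 1 ∧ m'.reg two = 2 ∧ m'.reg zero = 0) 2 ?_ ?_ b₀ _ ?_ (by omega)
  · rintro k m' ⟨hk, hq, ho, h1, h2, h0⟩
    refine ⟨trivial, by omega, WP.block _ rfl ⟨trivial, by omega, ?_, ?_, ?_, ?_, ?_⟩ le_rfl⟩
    · have := hmod k (by omega)
      simp [hq, h1, this]
    · have e : word E.w τ y₀ / 2 ^ (b₀ - (k + 1)) / 2 = word E.w τ y₀ / 2 ^ (b₀ - k) := by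
        rw [Nat.div_div_eq_div_mul, ← pow_succ]
        congr 2; omega
      simp only [List.foldl_cons, List.foldl_nil, St.exec_div, St.exec_sub, St.set_reg,
        reduceCtorEq, if_true, if_false, ho, h2, e]
      exact Nat.mod_eq_of_lt ((Nat.div_le_self _ _).trans_lt (word_lt _ _ _))
    · simp [h1]
    · simp [h2]
    · simp [h0]
  · rintro m' ⟨-, hq, ho, h1, h2, h0⟩
    refine ⟨trivial, by omega, WP.block _ rfl ⟨?_, ?_⟩ le_rfl⟩
    · simp only [List.foldl_cons, List.foldl_nil, St.exec_mod, St.set_reg, if_true, ho, h2,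
        Nat.sub_zero]
      rw [← htest, Nat.toNat_testBit]
      exact Nat.mod_eq_of_lt (by omega)
    · simp [h0]
  · simp [how₅, hqb₅, hm₅.one_eq, hm₅.two_eq, hm₅.zero_eq]

end Query

end Catalytic

namespace Catalytic

/-! ### Few small numbers divide a given number -/

section NumberTheory

open Real Finset

theorem log_primorial (k : ℕ) :
    log (primorial k) = ∑ q ∈ (range (k + 1)).filter Nat.Prime, log q := by
  rw [primorial, Nat.cast_prod, log_prod]
  intro q hq
  have := (Finset.mem_filter.1 hq).2.pos
  positivity

/-- Dyadic form of Chebyshev's bound: for primes in `(2 ^ J, 2 ^ (J + 1)]` the sum is at most `log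
(primorial (2 ^ (J + 1))) / 2 ^ J`, and `primorial k ≤ 4 ^ k` bounds this by `4 * log 2`. -/
theorem sum_log_div_prime_le (J : ℕ) :
    ∑ q ∈ (range (2 ^ J + 1)).filter Nat.Prime, log q / q ≤ 4 * J * log 2 := by
  induction J with
  | zero =>
    have : (range (2 ^ 0 + 1)).filter Nat.Prime = ∅ := by decide
    rw [this]; simp
  | succ J ih =>
    have hsub : (range (2 ^ J + 1)).filter Nat.Prime ⊆
        (range (2 ^ (J + 1) + 1)).filter Nat.Prime := by
      apply Finset.filter_subset_filter
      apply Finset.range_subset_range.2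
      have : 2 ^ J ≤ 2 ^ (J + 1) := Nat.pow_le_pow_right (by omega) (by omega)
      omega
    rw [← Finset.sum_sdiff hsub]
    have h1 : ∑ q ∈ (range (2 ^ (J + 1) + 1)).filter Nat.Prime \
        (range (2 ^ J + 1)).filter Nat.Prime, log q / q ≤ 4 * log 2 := by
      calc _ ≤ ∑ q ∈ (range (2 ^ (J + 1) + 1)).filter Nat.Prime \
              (range (2 ^ J + 1)).filter Nat.Prime, log q / 2 ^ J := by
            refine Finset.sum_le_sum fun q hq => ?_
            simp only [mem_sdiff, Finset.mem_filter, Finset.mem_range, not_and] at hq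
            have h2 : 2 ^ J < q := by
              by_contra h
              exact hq.2 (by omega) hq.1.2
            have h3 : (2 : ℝ) ^ J ≤ q := by exact_mod_cast h2.le
            have h4 : 0 ≤ log q := log_natCast_nonneg q
            gcongr
        _ ≤ ∑ q ∈ (range (2 ^ (J + 1) + 1)).filter Nat.Prime, log q / 2 ^ J := by
            refine Finset.sum_le_sum_of_subset_of_nonneg Finset.sdiff_subset fun q _ _ => ?_
            have h4 : 0 ≤ log q := log_natCast_nonneg q
            positivity
        _ = log (primorial (2 ^ (J + 1))) / 2 ^ J := by
            rw [log_primorial, Finset.sum_div]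
        _ ≤ log (4 ^ 2 ^ (J + 1)) / 2 ^ J := by
            gcongr
            · exact_mod_cast primorial_pos _
            · exact_mod_cast primorial_le_four_pow _
        _ = 4 * log 2 := by
            rw [log_pow, show (4 : ℝ) = 2 ^ 2 by norm_num, log_pow]
            push_cast
            rw [pow_succ]
            field_simp
    push_cast
    linarith

/-- Prime factors up to `2 ^ J` are covered by the sum over all primes. The larger ones have product
at most `N`, so they contribute at most `log N / 2 ^ J ≤ log 2`. -/
theorem sum_log_div_primeFactors_le {N J : ℕ} (hN : N ≠ 0) (hNJ : N ≤ 2 ^ 2 ^ J) :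
    ∑ q ∈ N.primeFactors, log q / q ≤ (4 * J + 1) * log 2 := by
  rw [← Finset.sum_filter_add_sum_filter_not _ (fun q => q ≤ 2 ^ J)]
  have h1 : ∑ q ∈ N.primeFactors.filter (fun q => q ≤ 2 ^ J), log q / q ≤ 4 * J * log 2 := by
    refine le_trans (Finset.sum_le_sum_of_subset_of_nonneg ?_ fun q _ _ => ?_)
      (sum_log_div_prime_le J)
    · intro q hq
      simp only [Finset.mem_filter, Finset.mem_range] at hq ⊢
      exact ⟨by omega, Nat.prime_of_mem_primeFactors hq.1⟩
    · have h4 : 0 ≤ log q := log_natCast_nonneg q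
      positivity
  have h2 : ∑ q ∈ N.primeFactors.filter (fun q => ¬ q ≤ 2 ^ J), log q / q ≤ log 2 := by
    calc _ ≤ ∑ q ∈ N.primeFactors.filter (fun q => ¬ q ≤ 2 ^ J), log q / 2 ^ J := by
          refine Finset.sum_le_sum fun q hq => ?_
          simp only [Finset.mem_filter, not_le] at hq
          have h3 : (2 : ℝ) ^ J ≤ q := by exact_mod_cast hq.2.le
          have h4 : 0 ≤ log q := log_natCast_nonneg q
          gcongr
      _ ≤ ∑ q ∈ N.primeFactors, log q / 2 ^ J := by
          refine Finset.sum_le_sum_of_subset_of_nonneg (Finset.filter_subset _ _) fun q _ _ => ?_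
          have h4 : 0 ≤ log q := log_natCast_nonneg q
          positivity
      _ = log ((∏ q ∈ N.primeFactors, q : ℕ) : ℝ) / 2 ^ J := by
          rw [← Finset.sum_div, Nat.cast_prod, log_prod]
          intro q hq
          have := (Nat.prime_of_mem_primeFactors hq).pos
          positivity
      _ ≤ log ((2 : ℝ) ^ 2 ^ J) / 2 ^ J := by
          gcongr
          · have : 0 < ∏ q ∈ N.primeFactors, q :=
              Finset.prod_pos fun q hq => (Nat.prime_of_mem_primeFactors hq).pos
            exact_mod_cast this
          · have := (Nat.le_of_dvd (Nat.pos_of_ne_zero hN) (Nat.prod_primeFactors_dvd N)).trans hNJ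
            exact_mod_cast this
      _ = log 2 := by
          rw [log_pow]; push_cast; field_simp
  linarith

/-- Legendre's formula gives the exponent at most `K / (q - 1)`, and `q ≤ 2 * (q - 1)`. -/
theorem factorization_factorial_mul_le {K q : ℕ} (hq : q.Prime) :
    K.factorial.factorization q * q ≤ 2 * K := by
  have := Fact.mk hq
  have h1 := sub_one_mul_padicValNat_factorial (p := q) K
  rw [← Nat.factorization_def _ hq] at h1
  have h2 := hq.two_le
  have h3 : (q - 1) * K.factorial.factorization q ≤ K := by rw [h1]; exact Nat.sub_le _ _
  obtain ⟨c, rfl⟩ : ∃ c, q = c + 2 := ⟨q - 2, by omega⟩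
  rw [show c + 2 - 1 = c + 1 by omega] at h3
  nlinarith

/-- The product of the distinct numbers in `S` divides `K!`, which limits its exponent at each prime
`q` to `2 * K / q`; and only primes dividing `N` occur. -/
theorem sum_log_le {N K : ℕ} {S : Finset ℕ} (hN : N ≠ 0)
    (hS : ∀ p ∈ S, 1 ≤ p ∧ p ≤ K ∧ p ∣ N) :
    ∑ p ∈ S, log p ≤ 2 * K * ∑ q ∈ N.primeFactors, log q / q := by
  set m := ∏ p ∈ S, p with hm
  have hm0 : m ≠ 0 := Finset.prod_ne_zero_iff.2 fun p hp => by have := (hS p hp).1; omega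
  have hmK : m ∣ K.factorial := by
    rw [← Finset.prod_Ico_id_eq_factorial]
    refine Finset.prod_dvd_prod_of_subset _ _ _ fun p hp => ?_
    have := hS p hp
    exact Finset.mem_Ico.2 ⟨this.1, by omega⟩
  have hpf : m.primeFactors ⊆ N.primeFactors := by
    intro q hq
    have hqp := Nat.prime_of_mem_primeFactors hq
    obtain ⟨p, hp, hqd⟩ := (hqp.prime.dvd_finsetProd_iff _).1 (Nat.dvd_of_mem_primeFactors hq)
    exact Nat.mem_primeFactors.2 ⟨hqp, hqd.trans (hS p hp).2.2, hN⟩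
  have h1 : ∑ p ∈ S, log p = log m := by
    rw [hm, Nat.cast_prod, log_prod]
    intro p hp
    have := (hS p hp).1
    positivity
  rw [h1, log_nat_eq_sum_factorization, Finsupp.sum, Nat.support_factorization, Finset.mul_sum]
  calc ∑ q ∈ m.primeFactors, (m.factorization q : ℝ) * log q
      ≤ ∑ q ∈ m.primeFactors, 2 * K * (log q / q) := by
        refine Finset.sum_le_sum fun q hq => ?_
        have hqp := Nat.prime_of_mem_primeFactors hq
        have hq0 : (0 : ℝ) < q := by exact_mod_cast hqp.pos
        have h2 : m.factorization q ≤ K.factorial.factorization q :=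
          (Nat.factorization_le_iff_dvd hm0 (Nat.factorial_ne_zero K)).2 hmK q
        have h3 : m.factorization q * q ≤ 2 * K :=
          (Nat.mul_le_mul_right _ h2).trans (factorization_factorial_mul_le hqp)
        have h3' : (m.factorization q : ℝ) * q ≤ 2 * K := by exact_mod_cast h3
        have h4 : 0 ≤ log q := log_natCast_nonneg q
        rw [show (2 : ℝ) * K * (log q / q) = (2 * K) / q * log q by ring]
        refine mul_le_mul_of_nonneg_right ?_ h4
        rwa [le_div_iff₀ hq0]
    _ ≤ _ := by
        refine Finset.sum_le_sum_of_subset_of_nonneg hpf fun q _ _ => ?_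
        have h4 : 0 ≤ log q := log_natCast_nonneg q
        positivity

/-- Fewer than an eighth of the numbers up to `K` divide `N`, if `K` is large compared with the
number of bits of `N`. -/
theorem card_divisors_le_lt {N J K : ℕ} (hN : N ≠ 0) (hNJ : N ≤ 2 ^ 2 ^ J)
    (hK : 2 ^ (128 * J + 36) < K) :
    8 * ((Icc 1 K).filter (· ∣ N)).card < K := by
  set S := (Icc 1 K).filter (· ∣ N) with hS
  by_contra! hcard
  have hKpos : (0 : ℝ) < K := by
    have : 0 < K := Nat.zero_lt_of_lt hK
    exact_mod_cast this
  have h16 : (16 : ℝ) < K := by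
    have : 2 ^ 4 ≤ 2 ^ (128 * J + 36) := Nat.pow_le_pow_right (by omega) (by omega)
    have : 16 < K := by omega
    exact_mod_cast this
  have hup := sum_log_le (S := S) (K := K) hN fun p hp => by
    simp only [hS, Finset.mem_filter, Finset.mem_Icc] at hp
    exact ⟨hp.1.1, hp.1.2, hp.2⟩
  have hup2 := sum_log_div_primeFactors_le hN hNJ
  -- At most `K / 16` members of `S` are at most `K / 16`. If `S` has at least `K / 8` members, `K /
  -- 16` of them are larger, and their logarithms give a lower bound for the sum.
  set S' := S.filter (fun p => K < 16 * p) with hS'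
  have hcard' : K ≤ 16 * S'.card := by
    have h1 : (S.filter fun p => ¬ K < 16 * p).card ≤ K / 16 := by
      have : (S.filter fun p => ¬ K < 16 * p) ⊆ Icc 1 (K / 16) := by
        intro p hp
        simp only [hS, Finset.mem_filter, Finset.mem_Icc] at hp ⊢
        omega
      simpa using Finset.card_le_card this
    have h2 : S'.card + (S.filter fun p => ¬ K < 16 * p).card = S.card :=
      Finset.card_filter_add_card_filter_not fun p => K < 16 * p
    omega
  have hlow : (K / 16 : ℝ) * log (K / 16) ≤ ∑ p ∈ S, log p := by
    have hl : 0 ≤ log ((K : ℝ) / 16) := log_nonneg (by linarith)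
    have hc : (K / 16 : ℝ) ≤ S'.card := by
      have : (K : ℝ) ≤ 16 * S'.card := by exact_mod_cast hcard'
      linarith
    calc (K / 16 : ℝ) * log (K / 16) ≤ S'.card * log (K / 16) :=
          mul_le_mul_of_nonneg_right hc hl
      _ = ∑ p ∈ S', log ((K : ℝ) / 16) := by simp
      _ ≤ ∑ p ∈ S', log p := by
          refine Finset.sum_le_sum fun p hp => ?_
          simp only [hS', Finset.mem_filter] at hp
          have : (K : ℝ) ≤ 16 * p := by exact_mod_cast hp.2.le
          gcongr
          linarith
      _ ≤ _ := Finset.sum_le_sum_of_subset_of_nonneg (Finset.filter_subset _ _)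
          fun p _ _ => log_natCast_nonneg p
  have hlogK : ((128 * J + 36 : ℕ) : ℝ) * log 2 < log K := by
    rw [← log_pow]
    refine log_lt_log (by positivity) ?_
    exact_mod_cast hK
  have e : log ((K : ℝ) / 16) = log K - 4 * log 2 := by
    rw [log_div hKpos.ne' (by norm_num), show (16 : ℝ) = 2 ^ 4 by norm_num, log_pow]
    norm_num
  -- Dividing by `K / 16` gives `log K - 4 * log 2 ≤ 32 * (4 * J + 1) * log 2`, that is `log K ≤
  -- (128 * J + 36) * log 2`, against `hK`. This is the source of the exponent `128 * J + 36`.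
  have h5 : (K / 16 : ℝ) * log (K / 16) ≤ 2 * K * ((4 * J + 1) * log 2) :=
    hlow.trans (hup.trans (mul_le_mul_of_nonneg_left hup2 (by positivity)))
  rw [e] at h5
  push_cast at hlogK
  nlinarith

end NumberTheory

/-! ### Counting random words -/

section Counting

open Finset

/-- Each residue modulo `K` occurs at most `M / K + 1` times below `M`. -/
theorem card_mod_dvd_le {N K M : ℕ} (hK : 0 < K) :
    ((range M).filter fun r => (r % K + 1) ∣ N).card ≤
      ((Icc 1 K).filter (· ∣ N)).card * (M / K + 1) := by
  rw [← Finset.card_range (M / K + 1), ← Finset.card_product]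
  refine Finset.card_le_card_of_injOn (fun r => (r % K + 1, r / K)) ?_ ?_
  · intro r hr
    simp only [Finset.coe_filter, Set.mem_ofPred_eq, Finset.mem_range] at hr
    have h1 := Nat.mod_lt r hK
    have h2 := Nat.div_le_div_right (c := K) hr.1.le
    simp only [Finset.coe_product, Set.mem_prod, Finset.coe_filter, Set.mem_ofPred_eq,
      Finset.mem_Icc, Finset.coe_range, Set.mem_Iio]
    exact ⟨⟨⟨by omega, by omega⟩, hr.2⟩, by omega⟩
  · intro r _ r' _ h
    simp only [Prod.mk.injEq] at h
    rw [← Nat.div_add_mod r K, ← Nat.div_add_mod r' K, h.2, show r % K = r' % K by omega]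

/-- A cyclic shift is injective on `range M`, and only `L` values lie within `L` of the top. -/
theorem card_shift_le {M L : ℕ} (a : ℕ) :
    ((range M).filter fun r => M ≤ (a + r) % M + L).card ≤ L := by
  rcases Nat.eq_zero_or_pos M with rfl | hM
  · simp
  have h : ((range M).filter fun r => M ≤ (a + r) % M + L).card ≤ (Ico (M - L) M).card := by
    refine Finset.card_le_card_of_injOn (fun r => (a + r) % M) ?_ ?_
    · intro r hr
      simp only [Finset.coe_filter, Set.mem_ofPred_eq, Finset.mem_range] at hr
      have := Nat.mod_lt (a + r) hM
      simp only [Finset.coe_Ico, Set.mem_Ico]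
      omega
    · intro r hr r' hr' h
      simp only [Finset.coe_filter, Set.mem_ofPred_eq, Finset.mem_range] at hr hr'
      have h1 : a + r ≡ a + r' [MOD M] := h
      have h2 := Nat.ModEq.add_left_cancel' a h1
      rwa [Nat.ModEq, Nat.mod_eq_of_lt hr.1, Nat.mod_eq_of_lt hr'.1] at h2
  refine h.trans ?_
  rw [Nat.card_Ico]
  omega

theorem card_exists_shift_le {M L X : ℕ} (f : ℕ → ℕ) :
    ((range M).filter fun r => ∃ x < X, M ≤ (f x + r) % M + L).card ≤ X * L := by
  have h : ((range M).filter fun r => ∃ x < X, M ≤ (f x + r) % M + L) ⊆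
      (range X).biUnion fun x => (range M).filter fun r => M ≤ (f x + r) % M + L := by
    intro r hr
    simp only [Finset.mem_filter, Finset.mem_range, Finset.mem_biUnion] at hr ⊢
    obtain ⟨h1, x, h2, h3⟩ := hr
    exact ⟨x, h2, h1, h3⟩
  refine (Finset.card_le_card h).trans (Finset.card_biUnion_le.trans ?_)
  refine (Finset.sum_le_card_nsmul _ _ L fun x _ => card_shift_le _).trans ?_
  simp

/-- Flipping the selected coins by a fixed pattern maps one fibre bijectively onto another, so all
`2 ^ w` fibres have the same size. -/
theorem card_fiber_comp {T w : ℕ} {e : Fin w → Fin T} (he : Function.Injective e)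
    (b : Fin w → Bool) :
    (univ.filter fun ω : Fin T → Bool => ω ∘ e = b).card * 2 ^ w = 2 ^ T := by
  have heq : ∀ b' : Fin w → Bool, (univ.filter fun ω : Fin T → Bool => ω ∘ e = b').card =
      (univ.filter fun ω : Fin T → Bool => ω ∘ e = b).card := by
    intro b'
    let c : Fin T → Bool := Function.extend e (fun i => xor (b i) (b' i)) fun _ => false
    have hc : ∀ i, c (e i) = xor (b i) (b' i) := fun i => he.extend_apply _ _ _
    refine Finset.card_bij' (fun ω _ i => xor (ω i) (c i)) (fun ω _ i => xor (ω i) (c i)) ?_ ?_ ?_ ?_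
    · intro ω hω
      simp only [Finset.mem_filter, Finset.mem_univ, true_and] at hω ⊢
      funext i
      have := congrFun hω i
      simp only [Function.comp] at this ⊢
      rw [hc, this]
      cases b i <;> cases b' i <;> rfl
    · intro ω hω
      simp only [Finset.mem_filter, Finset.mem_univ, true_and] at hω ⊢
      funext i
      have := congrFun hω i
      simp only [Function.comp] at this ⊢
      rw [hc, this]
      cases b i <;> cases b' i <;> rfl
    · intro ω _; funext i; simp
    · intro ω _; funext i; simp
  have h := Finset.card_eq_sum_card_fiberwise (f := fun ω : Fin T → Bool => ω ∘ e) (s := univ)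
    (t := univ) fun _ _ => Finset.mem_univ _
  rw [Finset.sum_congr rfl fun b' _ => heq b'] at h
  simp only [Finset.sum_const, Finset.card_univ, Fintype.card_fun, Fintype.card_bool,
    Fintype.card_fin, smul_eq_mul] at h
  rw [mul_comm, ← h]

theorem sampled_congr {ω ω' : ℕ → Bool} {k k' : ℕ} : ∀ {w : ℕ},
    (∀ i < w, ω (k + 6 * i) = ω' (k' + 6 * i)) → sampled ω k w = sampled ω' k' w
  | 0, _ => rfl
  | w + 1, h => by
    rw [sampled_succ, sampled_succ, sampled_congr fun i hi => h i (by omega), h w (by omega)]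

theorem sampled_inj {ω ω' : ℕ → Bool} {k : ℕ} : ∀ {w : ℕ}, sampled ω k w = sampled ω' k w →
    ∀ i < w, ω (k + 6 * i) = ω' (k + 6 * i)
  | 0, _ => by simp
  | w + 1, h => by
    rw [sampled_succ, sampled_succ] at h
    have h1 := Bool.toNat_lt (ω (k + 6 * w))
    have h2 := Bool.toNat_lt (ω' (k + 6 * w))
    intro i hi
    rcases Nat.lt_succ_iff_lt_or_eq.1 hi with hi | rfl
    · exact sampled_inj (by omega) i hi
    · have : (ω (k + 6 * i)).toNat = (ω' (k + 6 * i)).toNat := by omega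
      revert this
      cases ω (k + 6 * i) <;> cases ω' (k + 6 * i) <;> simp

/-- The sampled word is uniformly distributed: a set of at most half of the words is hit with
probability at most one half. -/
theorem card_sampled_le {T w k : ℕ} (hT : k + 6 * w ≤ T) (bad : ℕ → Prop) [DecidablePred bad]
    (hbad : 2 * ((range (2 ^ w)).filter bad).card ≤ 2 ^ w) :
    2 * (univ.filter fun ω : Fin T → Bool =>
      bad (sampled (fun j => if h : j < T then ω ⟨j, h⟩ else false) k w)).card ≤ 2 ^ T := by
  let e : Fin w → Fin T := fun i => ⟨k + 6 * i, by have := i.2; omega⟩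
  have he : Function.Injective e := fun i i' h => by
    simp only [e, Fin.mk.injEq] at h
    exact Fin.ext (by omega)
  -- The sampled word as a function of the `w` relevant coins alone. `sampled` looks at every sixth
  -- position, hence `j / 6`.
  let num : (Fin w → Bool) → ℕ := fun b =>
    sampled (fun j => if h : j / 6 < w then b ⟨j / 6, h⟩ else false) 0 w
  have hnum : ∀ ω : Fin T → Bool,
      sampled (fun j => if h : j < T then ω ⟨j, h⟩ else false) k w = num (ω ∘ e) := by
    intro ω
    refine sampled_congr fun i hi => ?_
    have h1 : k + 6 * i < T := by omega
    have h2 : (0 + 6 * i) / 6 = i := by omega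
    simp [h1, hi, e]
  have hinj : Function.Injective num := by
    intro b b' h
    funext i
    have := sampled_inj h i i.2
    simpa using this
  have hcard : (univ.filter fun b : Fin w → Bool => bad (num b)).card ≤
      ((range (2 ^ w)).filter bad).card := by
    refine Finset.card_le_card_of_injOn num ?_ hinj.injOn
    intro b hb
    simp only [Finset.coe_filter, Finset.mem_univ, true_and, Set.mem_ofPred_eq] at hb
    simp only [Finset.coe_filter, Finset.mem_range, Set.mem_ofPred_eq]
    exact ⟨sampled_lt _ _ _, hb⟩
  have hfib := Finset.card_eq_sum_card_fiberwise (f := fun ω : Fin T → Bool => ω ∘ e)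
    (s := univ.filter fun ω : Fin T → Bool =>
      bad (sampled (fun j => if h : j < T then ω ⟨j, h⟩ else false) k w))
    (t := univ.filter fun b : Fin w → Bool => bad (num b)) (by
      intro ω hω
      simp only [Finset.coe_filter, Finset.mem_univ, true_and, Set.mem_ofPred_eq] at hω ⊢
      rwa [← hnum])
  have hle : (univ.filter fun ω : Fin T → Bool =>
      bad (sampled (fun j => if h : j < T then ω ⟨j, h⟩ else false) k w)).card * 2 ^ w ≤
      (univ.filter fun b : Fin w → Bool => bad (num b)).card * 2 ^ T := by
    rw [hfib, Finset.sum_mul]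
    refine (Finset.sum_le_card_nsmul _ _ (2 ^ T) fun b _ => ?_).trans (by simp)
    rw [← card_fiber_comp he b]
    refine Nat.mul_le_mul_right _ (Finset.card_le_card fun ω hω => ?_)
    simp only [Finset.mem_filter, Finset.mem_univ, true_and] at hω ⊢
    exact hω.2
  have hpos : 0 < 2 ^ w := by positivity
  refine Nat.le_of_mul_le_mul_right ?_ hpos
  calc _ = 2 * ((univ.filter fun ω : Fin T → Bool =>
        bad (sampled (fun j => if h : j < T then ω ⟨j, h⟩ else false) k w)).card * 2 ^ w) := by ring
    _ ≤ 2 * (((range (2 ^ w)).filter bad).card * 2 ^ T) :=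
        Nat.mul_le_mul_left _ (hle.trans (Nat.mul_le_mul_right _ hcard))
    _ = 2 * ((range (2 ^ w)).filter bad).card * 2 ^ T := by ring
    _ ≤ 2 ^ w * 2 ^ T := Nat.mul_le_mul_right _ hbad
    _ = _ := by ring

end Counting

/-! ### Counting walks -/

section Walks

variable {n : ℕ} (G : OracleDigraph n) (s : Fin n)

/-- The number of walks with `i` steps from `s` to a vertex, where a step may also stay in place. -/
def walks : ℕ → Fin n → ℕ
  | 0, v => if v = s then 1 else 0
  | i + 1, v => walks i v + ((G.inList v).map (walks i)).sum

/-- A vertex has at most `n - 1` in-neighbours; staying in place is one further choice. -/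
theorem walks_le (i : ℕ) (v : Fin n) : walks G s i v ≤ n ^ i := by
  induction i generalizing v with
  | zero => simp only [walks]; split <;> simp
  | succ i ih =>
    have h1 : ((G.inList v).map (walks G s i)).sum ≤ (G.inList v).length * n ^ i := by
      have := List.sum_le_card_nsmul ((G.inList v).map (walks G s i)) (n ^ i)
        (by simpa using fun u (_ : u ∈ G.inList v) => ih u)
      simpa using this
    have h2 := G.inDeg_lt (Fin.pos v) v
    simp only [OracleDigraph.inDeg, Fin.is_lt, dif_pos, Fin.eta] at h2
    have h3 := ih v
    have h4 : ((G.inList v).length + 1) * n ^ i ≤ n * n ^ i := Nat.mul_le_mul_right _ h2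
    simp only [walks]
    rw [pow_succ, mul_comm (n ^ i)]
    linarith

variable {G s}

theorem walks_pos_succ {i : ℕ} {v : Fin n} (h : 0 < walks G s i v) : 0 < walks G s (i + 1) v :=
  Nat.lt_of_lt_of_le h (Nat.le_add_right _ _)

theorem walks_pos_of_adj {i : ℕ} {u v : Fin n} (huv : G.Adj u v) (h : 0 < walks G s i u) :
    0 < walks G s (i + 1) v := by
  have h1 : walks G s i u ≤ ((G.inList v).map (walks G s i)).sum :=
    List.single_le_sum (fun _ _ => Nat.zero_le _) _
      (List.mem_map_of_mem ((G.mem_inList u v).2 huv))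
  simp only [walks]
  omega

/-- The sets `S i` of vertices with a positive count increase. Until one is closed under edges, each
gains a vertex, so `S (n - 1)` is closed or contains everything. -/
theorem walks_pos_of_reaches {t : Fin n} (h : G.Reaches s t) : 0 < walks G s (n - 1) t := by
  have hs : ∀ i, 0 < walks G s i s := fun i => by
    induction i with
    | zero => simp [walks]
    | succ i ih => exact walks_pos_succ ih
  let S : ℕ → Finset (Fin n) := fun i => Finset.univ.filter fun v => 0 < walks G s i v
  have hmem : ∀ i v, v ∈ S i ↔ 0 < walks G s i v := fun i v => by simp [S]
  have hgrow : ∀ i, (∀ u v, G.Adj u v → u ∈ S i → v ∈ S i) ∨ i + 1 ≤ (S i).card := by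
    intro i
    induction i with
    | zero => exact Or.inr (Finset.card_pos.2 ⟨s, (hmem _ _).2 (hs 0)⟩)
    | succ i ih =>
      have hsub : S i ⊆ S (i + 1) := fun v hv =>
        (hmem _ _).2 (walks_pos_succ ((hmem _ _).1 hv))
      rcases hsub.eq_or_ssubset with heq | hss
      · refine Or.inl fun u v huv hu => ?_
        rw [← heq, hmem] at hu
        exact (hmem _ _).2 (walks_pos_of_adj huv hu)
      · rcases ih with hcl | hcard
        · have heq : S (i + 1) ⊆ S i := by
            intro v hv
            have h1 := (hmem _ _).1 hv
            simp only [walks] at h1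
            rcases Nat.eq_zero_or_pos (walks G s i v) with h0 | h0
            · rw [h0, zero_add] at h1
              obtain ⟨x, hx, hx0⟩ : ∃ x ∈ (G.inList v).map (walks G s i), x ≠ 0 := by
                by_contra! hall
                exact h1.ne' (List.sum_eq_zero hall)
              obtain ⟨u, hu, rfl⟩ := List.mem_map.1 hx
              exact hcl u v ((G.mem_inList u v).1 hu) ((hmem _ _).2 (Nat.pos_of_ne_zero hx0))
            · exact (hmem _ _).2 h0
          exact absurd heq hss.2
        · have := Finset.card_lt_card hss
          exact Or.inr (by omega)
  rw [← hmem]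
  rcases hgrow (n - 1) with hcl | hcard
  · induction h with
    | refl => exact (hmem _ _).2 (hs _)
    | tail _ huv ih => exact hcl _ _ huv ih
  · have h1 := Fin.pos t
    have : S (n - 1) = Finset.univ := Finset.eq_univ_of_card _ (by
      have := Finset.card_le_univ (S (n - 1))
      simp only [Fintype.card_fin] at this ⊢
      omega)
    rw [this]
    exact Finset.mem_univ _

end Walks

/-! ### The values at the nodes -/

section Values

variable {n W w r q d : ℕ} {G : OracleDigraph n} {s : Fin n} {τ : Fin W → Bool} {g g₀ g₁ : ℕ → ℕ}

theorem node_coords {i v j : ℕ} (hv : v < n) (hj : j < n) :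
    ((i * n + v) * n + j) % n = j ∧ ((i * n + v) * n + j) / n = i * n + v ∧
      ((i * n + v) * n + j) / n % n = v ∧ ((i * n + v) * n + j) / n ^ 2 = i := by
  have hn : 0 < n := by omega
  have h1 : ((i * n + v) * n + j) / n = i * n + v := by
    rw [add_comm, Nat.add_mul_div_right _ _ hn, Nat.div_eq_of_lt hj, zero_add]
  have h2 : (i * n + v) / n = i := by
    rw [add_comm, Nat.add_mul_div_right _ _ hn, Nat.div_eq_of_lt hv, zero_add]
  refine ⟨?_, h1, ?_, ?_⟩
  · rw [add_comm, Nat.add_mul_mod_self_right, Nat.mod_eq_of_lt hj]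
  · rw [h1, add_comm, Nat.add_mul_mod_self_right, Nat.mod_eq_of_lt hv]
  · rw [sq, ← Nat.div_div_eq_div_mul, h1, h2]

theorem inDeg_fin (v : Fin n) : G.inDeg v = (G.inList v).length := by
  simp [OracleDigraph.inDeg]

theorem active_node {i j : ℕ} (hi : i + 1 < n) (v : Fin n) (hj : j ≤ (G.inList v).length) :
    Active G (((i + 1) * n + v) * n + j) := by
  rw [← inDeg_fin] at hj
  have hjn := hj.trans_lt (G.inDeg_lt (Fin.pos v) v)
  obtain ⟨h1, -, h2, -⟩ := node_coords (i := i + 1) v.2 hjn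
  refine ⟨by nlinarith, ?_, by rw [h1, h2]; exact hj⟩
  have h3 : (i + 1) * n + v + 1 ≤ n * n := by have := v.2; nlinarith
  nlinarith

theorem source_node_zero {i : ℕ} (v : Fin n) :
    source G (((i + 1) * n + v) * n + 0) = topNode G i v := by
  obtain ⟨h1, -, h2, h3⟩ := node_coords (i := i + 1) v.2 (Fin.pos v)
  simp only [source, h1, h2, h3, lt_irrefl, if_false, topNode, Nat.add_sub_cancel]
  ring

theorem source_node_succ {i j : ℕ} (v : Fin n) (hj : j < (G.inList v).length) :
    source G (((i + 1) * n + v) * n + (j + 1)) = topNode G i (G.inList v)[j] := by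
  have hjn : j + 1 < n := Nat.lt_of_le_of_lt (by rw [inDeg_fin]; exact hj)
    (G.inDeg_lt (Fin.pos v) v)
  obtain ⟨h1, -, h2, h3⟩ := node_coords (i := i + 1) v.2 hjn
  have h4 : G.inNbr v j = (G.inList v)[j] := by simp [OracleDigraph.inNbr, hj]
  simp only [source, h1, h2, h3, Nat.succ_pos, if_true, topNode, Nat.add_sub_cancel, h4]
  ring

theorem topNode_zero_inj {u v : Fin n} : topNode G 0 u = topNode G 0 v ↔ u = v := by
  refine ⟨fun h => ?_, fun h => h ▸ rfl⟩
  have h1 := (node_coords (i := 0) u.2 (G.inDeg_lt (Fin.pos u) u)).2.2.1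
  have h2 := (node_coords (i := 0) v.2 (G.inDeg_lt (Fin.pos v) v)).2.2.1
  rw [topNode, topNode] at h
  rw [h] at h1
  exact Fin.ext (h1.symm.trans h2)

theorem topNode_zero_lt (v : Fin n) : topNode G 0 v < n ^ 2 := by
  have h1 := G.inDeg_lt (Fin.pos v) v
  have h2 := v.2
  unfold topNode
  nlinarith

theorem Active.ne_topNode_zero {x : ℕ} (hx : Active G x) (v : Fin n) : x ≠ topNode G 0 v := by
  have := topNode_zero_lt (G := G) v
  have := hx.1
  omega

theorem Processed.nodeValue_topNode_zero (h : Processed G w r q d (topNode G 0 s) τ g)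
    (v : Fin n) : nodeValue w r q d (topNode G 0 s) g (topNode G 0 v) =
      (word w τ (topNode G 0 v) + r) % 2 ^ w % q + if v = s then d else 0 := by
  simp only [nodeValue, topNode_zero_inj]
  rw [h.1]
  exact fun ha => absurd ha.1 (by have := topNode_zero_lt (G := G) v; omega)

/-- The random shift and the addend meet under a single reduction modulo `2 ^ w`, so wraparound can
be judged on the shifted original word. -/
theorem Processed.nodeValue_active (h : Processed G w r q d (topNode G 0 s) τ g) {x : ℕ}
    (hx : Active G x) : nodeValue w r q d (topNode G 0 s) g x =
      (word w τ x + r + addend G w r q d (topNode G 0 s) g x) % 2 ^ w % q := by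
  rw [nodeValue, if_neg (hx.ne_topNode_zero s), h.2 x hx, Nat.mod_add_mod, add_zero]
  congr 2
  ring

theorem addend_node_zero {i : ℕ} (v : Fin n) :
    addend G w r q d (topNode G 0 s) g (((i + 1) * n + v) * n + 0) =
      nodeValue w r q d (topNode G 0 s) g (topNode G i v) := by
  rw [addend, source_node_zero, (node_coords v.2 (Fin.pos v)).1]
  simp

theorem addend_node_succ {i j : ℕ} (v : Fin n) (hj : j < (G.inList v).length) :
    addend G w r q d (topNode G 0 s) g (((i + 1) * n + v) * n + (j + 1)) =
      nodeValue w r q d (topNode G 0 s) g (((i + 1) * n + v) * n + j) +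
        nodeValue w r q d (topNode G 0 s) g (topNode G i (G.inList v)[j]) := by
  have hjn : j + 1 < n := Nat.lt_of_le_of_lt (by rw [inDeg_fin]; exact hj)
    (G.inDeg_lt (Fin.pos v) v)
  rw [addend, source_node_succ v hj, (node_coords v.2 hjn).1]
  simp

/-- Vertices that are not reachable from `s` do not notice what is added at `s`. -/
theorem Processed.nodeValue_eq (h₀ : Processed G w r q 0 (topNode G 0 s) τ g₀)
    (h₁ : Processed G w r q 1 (topNode G 0 s) τ g₁) {i : ℕ} (hi : i < n) {v : Fin n}
    (hv : ¬ G.Reaches s v) :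
    nodeValue w r q 1 (topNode G 0 s) g₁ (topNode G i v) =
      nodeValue w r q 0 (topNode G 0 s) g₀ (topNode G i v) := by
  induction i generalizing v with
  | zero =>
    have hne : v ≠ s := fun h => hv (h ▸ Relation.ReflTransGen.refl)
    rw [h₀.nodeValue_topNode_zero, h₁.nodeValue_topNode_zero, if_neg hne, if_neg hne]
  | succ i ih =>
    -- All nodes of the chain agree, because every in-neighbour of `v` is unreachable too. The
    -- addends agree exactly, so no assumption on overflow is needed; hence a no-instance is never
    -- accepted.
    have key : ∀ j ≤ (G.inList v).length,
        nodeValue w r q 1 (topNode G 0 s) g₁ (((i + 1) * n + v) * n + j) =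
          nodeValue w r q 0 (topNode G 0 s) g₀ (((i + 1) * n + v) * n + j) := by
      intro j hj
      have ha := active_node hi v hj
      rw [h₀.nodeValue_active ha, h₁.nodeValue_active ha]
      congr 3
      induction j with
      | zero => rw [addend_node_zero, addend_node_zero, ih (by omega) hv]
      | succ j ihj =>
        have ha' := active_node hi v (Nat.le_of_succ_le hj)
        have hu : ¬ G.Reaches s (G.inList v)[j] := fun h =>
          hv (h.tail ((G.mem_inList _ _).1 (List.getElem_mem hj)))
        rw [addend_node_succ v hj, addend_node_succ v hj, ih (by omega) hu,
          h₀.nodeValue_active ha', h₁.nodeValue_active ha', ihj (Nat.le_of_succ_le hj) ha']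
    have := key _ le_rfl
    rwa [← inDeg_fin] at this

theorem nodeValue_le (hd : d ≤ 1) (hq : 0 < q) (x y : ℕ) : nodeValue w r q d x g y ≤ q := by
  have := Nat.mod_lt ((g y + r) % 2 ^ w) hq
  unfold nodeValue
  split <;> omega

theorem addend_le (hd : d ≤ 1) (hq : 0 < q) (x y : ℕ) : addend G w r q d x g y ≤ 2 * q := by
  have h1 := nodeValue_le (w := w) (r := r) (g := g) hd hq x (source G y)
  have h2 := nodeValue_le (w := w) (r := r) (g := g) hd hq x (y - 1)
  unfold addend
  split <;> omega

/-- If no word is close to overflowing, then modulo `q`, adding `1` at `s` changes the value of a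
vertex by the number of walks from `s` to this vertex. -/
theorem Processed.nodeValue_modEq (h₀ : Processed G w r q 0 (topNode G 0 s) τ g₀)
    (h₁ : Processed G w r q 1 (topNode G 0 s) τ g₁) (hq : 0 < q)
    (hno : ∀ x < n ^ 3, (word w τ x + r) % 2 ^ w + 2 * q < 2 ^ w)
    {i : ℕ} (hi : i < n) (v : Fin n) :
    nodeValue w r q 1 (topNode G 0 s) g₁ (topNode G i v) ≡
      nodeValue w r q 0 (topNode G 0 s) g₀ (topNode G i v) + walks G s i v [MOD q] := by
  -- An addend is at most `2 * q`, so `hno` excludes wraparound. The reduction modulo `2 ^ w` then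
  -- disappears and a value is linear in its addend modulo `q`.
  have hact : ∀ {d g}, d ≤ 1 → Processed G w r q d (topNode G 0 s) τ g → ∀ {x}, Active G x →
      nodeValue w r q d (topNode G 0 s) g x ≡
        (word w τ x + r) % 2 ^ w + addend G w r q d (topNode G 0 s) g x [MOD q] := by
    intro d g hd h x hx
    have h1 := hno x hx.2.1
    have h2 := addend_le (G := G) (w := w) (r := r) (g := g) hd hq (topNode G 0 s) x
    rw [h.nodeValue_active hx, ← Nat.mod_add_mod, Nat.mod_eq_of_lt (by omega : _ < 2 ^ w)]
    exact Nat.mod_modEq _ _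
  induction i generalizing v with
  | zero =>
    rw [h₀.nodeValue_topNode_zero, h₁.nodeValue_topNode_zero, walks]
    simp [Nat.ModEq.refl]
  | succ i ih =>
    -- Position `j` of the chain has accumulated the lazy step from `v` and the steps from the first
    -- `j` in-neighbours.
    have key : ∀ j ≤ (G.inList v).length,
        nodeValue w r q 1 (topNode G 0 s) g₁ (((i + 1) * n + v) * n + j) ≡
          nodeValue w r q 0 (topNode G 0 s) g₀ (((i + 1) * n + v) * n + j) +
            (walks G s i v + (((G.inList v).take j).map (walks G s i)).sum) [MOD q] := by
      intro j hj
      have ha := active_node hi v hj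
      refine (hact le_rfl h₁ ha).trans (Nat.ModEq.trans ?_
        ((hact (Nat.zero_le _) h₀ ha).symm.add_right _))
      rw [add_assoc]
      refine Nat.ModEq.add_left _ ?_
      induction j with
      | zero =>
        rw [addend_node_zero, addend_node_zero]
        simpa using ih (by omega) v
      | succ j ihj =>
        have ha' := active_node hi v (Nat.le_of_succ_le hj)
        have h3 := (hact le_rfl h₁ ha').trans (Nat.ModEq.trans
          (by
            have := (ihj (Nat.le_of_succ_le hj) ha').add_left
              ((word w τ (((i + 1) * n + v) * n + j) + r) % 2 ^ w)
            rwa [← add_assoc] at this)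
          ((hact (Nat.zero_le _) h₀ ha').symm.add_right _))
        rw [addend_node_succ v hj, addend_node_succ v hj]
        refine (h3.add (ih (by omega) (G.inList v)[j])).trans ?_
        rw [List.take_add_one, List.getElem?_eq_getElem hj]
        simp only [Option.toList_some, List.map_append, List.map_cons, List.map_nil,
          List.sum_append, List.sum_cons, List.sum_nil]
        rw [show ∀ a b c d e : ℕ, a + (b + c) + (d + e) = a + d + (b + (c + (e + 0))) by intros; ring]
    have := key _ le_rfl
    rwa [List.take_length, ← inDeg_fin] at this

end Values

end Catalytic

namespace Catalytic

/-! ### The algorithm -/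

section Algorithm

/-- A pause can occur anywhere, so this is stated for arbitrary programs and times. It ensures that
copying a paused register loses nothing. -/
theorem Program.run_reg_lt {R : Type} [DecidableEq R] {n W : ℕ} (P : Program R) (E : Env n)
    (ω : ℕ → Bool) {c : Config R W} (hc : ∀ r, c.reg r < 2 ^ E.w) (j : ℕ) (r : R) :
    (P.run E ω c j).reg r < 2 ^ E.w := by
  induction j generalizing r with
  | zero => exact hc r
  | succ j ih =>
    have : 0 < 2 ^ E.w := by positivity
    rw [Program.run, Program.step]
    generalize P.run E ω c j = c' at ih ⊢
    cases P[c'.pc]? with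
    | none => exact ih r
    | some i =>
      cases i <;> simp only [Instr.exec, Config.put, Function.update_apply] <;>
        (try split_ifs) <;> first | exact Nat.mod_lt _ this | exact ih r

/-- The registers in the order in which they are declared. -/
def Reg.index (r : Reg) : Fin 39 := ⟨r.ctorIdx, by cases r <;> decide⟩

theorem Reg.index_injective : Function.Injective Reg.index := by
  intro r r' h
  have h' : r.ctorIdx = r'.ctorIdx := congrArg Fin.val h
  rw [← Reg.ofNat_ctorIdx r, h', Reg.ofNat_ctorIdx]

/-- The query routine on two copies of the registers. -/
def copyQueryCmd : Cmd (Reg ⊕ Reg) :=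
  .block (invRegs.map fun r => .copy (.inr r) (.inl r)) ;; queryCmd.map Sum.inr

/-- Directed reachability by counting walks modulo a random number. -/
def reachability : Algorithm where
  wordFactor := 1100
  mainRegs := 39
  queryRegs := 39
  main := (mainCmd.map Reg.index).toProgram (Reg.index .res) (Reg.index .prv)
  query := (copyQueryCmd.map (Sum.map Reg.index Reg.index)).toProgram
    (.inr (Reg.index .ow)) (.inr (Reg.index .zero))

open Reg

variable {n W : ℕ}

/-- The query runs on a second set of registers and only imports those on which `Inv` depends, so
the paused registers are preserved without being saved and restored. -/
theorem copyQueryCmd_spec {E : Env n} {S : St (Reg ⊕ Reg) W} {τ : Fin W → Bool} (s₀ t₀ : Fin n)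
    (hfit : Fits n W E.w) (hn : E.args.getD 0 0 = n) (hs : E.args.getD 1 0 = s₀)
    (ht : E.args.getD 2 0 = t₀) {i : Fin W} (hi : E.args.getD 3 0 = i)
    (hl : ∀ r, S.reg (.inl r) < 2 ^ E.w) (hr : ∀ r, S.reg (.inr r) = 0)
    (hinv : Inv E.graph E.w (topNode E.graph 0 s₀) τ (S.comap Sum.inl)) :
    WP E (fun _ => True) copyQueryCmd (28 * E.w + 116) S fun S' =>
      S'.reg (.inr ow) = (τ i).toNat ∧ S'.reg (.inr zero) = 0 ∧
        (∀ r, S'.reg (.inl r) = S.reg (.inl r)) ∧ S'.cat = S.cat := by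
  have hlt : ∀ r, S.reg r < 2 ^ E.w := fun r => by
    rcases r with r | r
    · exact hl r
    · rw [hr]; positivity
  have hcopy : WP E (fun _ => True)
      (.block (invRegs.map fun r => .copy (.inr r) (.inl r))) 6 S fun S' =>
      (∀ r ∈ invRegs, S'.reg (.inr r) = S.reg (.inl r)) ∧
        (∀ r, S'.reg (.inl r) = S.reg (.inl r)) := by
    refine .block _ rfl ?_ le_rfl
    simp [invRegs, Nat.mod_eq_of_lt (hl _)]
  have hcat : copyQueryCmd.all Instr.NoWrite = true := by decide
  refine WP.imp (WP.frame (Q := fun S' => S'.reg (.inr ow) = (τ i).toNat ∧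
    S'.reg (.inr zero) = 0 ∧ ∀ r, S'.reg (.inl r) = S.reg (.inl r)) ?_) le_rfl
    fun S' ⟨h1, _, _, h2⟩ => ⟨h1.1, h1.2.1, h1.2.2, h2 hcat⟩
  refine hcopy.seq_frame (t₁ := 6) (t₂ := 28 * E.w + 110)
    (fun S₁ ⟨h1, h2⟩ h3 h4 h5 => ?_) (by omega)
  have hc := h5 (by decide)
  have h0 : ∀ r, r ∉ invRegs → S₁.reg (.inr r) = 0 := fun r hr' => by
    refine (h3 _ ?_).trans (hr r)
    simpa [invRegs, Cmd.block, Cmd.writes, Instr.writes] using hr'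
  have hq := queryCmd_spec (E := E) (m := S₁.comap Sum.inr) s₀ t₀ hfit hn hs ht hi
    (h0 wl (by decide)) (h0 m1 (by decide)) (h0 zero (by decide)) (fun r => h4 hlt _)
    (hinv.congr hc h1)
  refine (hq.map Sum.inr_injective).imp le_rfl fun S' ⟨h6, h7⟩ => ⟨h6.1, h6.2, fun r => ?_⟩
  rw [h7 _ (by simp), h2]

variable {ℓ : ℕ}

/-- The tape length is below `2 ^ (23 * ℓ)`, up to equality, and so is `1100 * ℓ`. Thus the address
bounds have ample room, and `1100 > 1024` leaves space for `n ^ 1024`. -/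
theorem fits_of_le (hn : 2 ≤ n) (hℓ : n ≤ 2 ^ ℓ) (hℓ1 : 1 ≤ ℓ) :
    Fits n (300000 * n ^ 3 * ℓ) (1100 * ℓ) := by
  have h1 : n ^ 3 ≤ 2 ^ (3 * ℓ) := by
    rw [mul_comm, pow_mul]; exact Nat.pow_le_pow_left hℓ 3
  have h2 : ℓ < 2 ^ ℓ := Nat.lt_two_pow_self
  refine ⟨hn, by nlinarith [Nat.zero_le (n ^ 3 * ℓ)], ?_, ?_, by omega⟩
  · have h3 : 2 ^ 19 * 2 ^ (3 * ℓ) * 2 ^ ℓ ≤ 2 ^ (23 * ℓ) := by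
      rw [← pow_add, ← pow_add]; exact Nat.pow_le_pow_right (by omega) (by omega)
    have h4 : 300000 * n ^ 3 * ℓ ≤ 2 ^ 19 * 2 ^ (3 * ℓ) * 2 ^ ℓ :=
      Nat.mul_le_mul (Nat.mul_le_mul (by norm_num) h1) h2.le
    have h5 : 2 ^ 11 * 2 ^ ℓ ≤ 2 ^ (23 * ℓ) := by
      rw [← pow_add]; exact Nat.pow_le_pow_right (by omega) (by omega)
    have h6 : 2 * 2 ^ (23 * ℓ) ≤ 2 ^ (1100 * ℓ) := by
      rw [← pow_succ']; exact Nat.pow_le_pow_right (by omega) (by omega)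
    have h7 : 1100 * ℓ < 2 ^ 11 * 2 ^ ℓ := by omega
    omega
  · calc n ^ 1024 ≤ (2 ^ ℓ) ^ 1024 := Nat.pow_le_pow_left hℓ _
      _ = 2 ^ (1024 * ℓ) := by rw [← pow_mul, mul_comm]
      _ < 2 ^ (1100 * ℓ) := Nat.pow_lt_pow_right (by omega) (by omega)

variable (G : OracleDigraph n) (s t : Fin n)

/-- The outcome of the main program: the answer compares the values at the target for the two
ways of processing the network. -/
theorem mainAt_spec (hfit : Fits n W (reachability.wordLen n)) (τ : Fin W → Bool) :
    ∃ k₀, k₀ ≤ 6 * reachability.wordLen n + 20 ∧ ∀ ω, ∃ r q g₀ g₁,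
      r = sampled ω k₀ (reachability.wordLen n) ∧ q = r % n ^ 1024 + 1 ∧
      Processed G (reachability.wordLen n) r q 0 (topNode G 0 s) τ g₀ ∧
      Processed G (reachability.wordLen n) r q 1 (topNode G 0 s) τ g₁ ∧
      (∀ T, numActive G * (96 * reachability.wordLen n + 380) +
          24 * reachability.wordLen n + 101 ≤ T →
        reachability.result G s t τ ω T = some (decide
          (nodeValue (reachability.wordLen n) r q 1 (topNode G 0 s) g₁ (topNode G (n - 1) t) %
              2 ^ reachability.wordLen n ≠
            nodeValue (reachability.wordLen n) r q 0 (topNode G 0 s) g₀ (topNode G (n - 1) t) %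
              2 ^ reachability.wordLen n)) ∧
        (reachability.mainAt G s t τ ω T).cat = τ) ∧
      ∀ j, Inv G (reachability.wordLen n) (topNode G 0 s) τ
        ⟨fun r => (reachability.mainAt G s t τ ω j).reg r.index,
          (reachability.mainAt G s t τ ω j).cat⟩ := by
  obtain ⟨k₀, hk₀, h⟩ := mainCmd_run (E := ⟨G, [n, s, t], reachability.wordLen n⟩) s t hfit rfl rfl
    rfl τ
  refine ⟨k₀, hk₀, fun ω => ?_⟩
  obtain ⟨k, m', hk, hrun, hinv, hcat, r, q, g₀, g₁, hr, hq, h₀, h₁, hprv, hres⟩ := h ω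
  obtain ⟨S', hrun', rfl, -⟩ := hrun.map Reg.index_injective (S := ⟨fun _ => 0, τ⟩) rfl
  obtain ⟨hend, hall⟩ := hrun'.toProgram (Reg.index .res) (Reg.index .prv) hinv
  refine ⟨r, q, g₀, g₁, hr, hq, h₀, h₁, fun T hT => ?_, fun j => ?_⟩
  · obtain ⟨e1, -, e2⟩ := hend T (by simp only at hk; omega)
    refine ⟨e1.trans ?_, e2.trans hcat⟩
    rw [← hprv, ← hres]
    rfl
  · obtain ⟨s₁, pc, hI, e⟩ := hall j
    have e' : reachability.mainAt G s t τ ω j = s₁.withPc pc := e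
    rw [e']
    exact hI

/-- `mainAt_spec` supplies the invariant at every time, also during setup and after halting, so one
query specification serves all pauses. -/
theorem reachability_locallyRevertible (hfit : Fits n W (reachability.wordLen n)) {q : ℕ}
    (hq : 28 * reachability.wordLen n + 117 ≤ q) :
    reachability.LocallyRevertible G s t W q := by
  intro τ ω j i ω'
  dsimp only
  obtain ⟨k₀, -, h⟩ := mainAt_spec G s t hfit τ
  obtain ⟨-, -, -, -, -, -, -, -, -, hinv⟩ := h ω
  have hlt : ∀ r, (reachability.mainAt G s t τ ω j).reg r < 2 ^ reachability.wordLen n :=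
    fun r => Program.run_reg_lt _ _ _ (fun _ => by positivity) _ _
  replace hinv := hinv j
  simp only [Algorithm.queryAt]
  generalize reachability.mainAt G s t τ ω j = c at hinv hlt
  have hmap : Function.Injective (Sum.map Reg.index Reg.index) :=
    Sum.map_injective.2 ⟨Reg.index_injective, Reg.index_injective⟩
  let S : St (Fin 39 ⊕ Fin 39) W := ⟨Sum.elim c.reg fun _ => 0, c.cat⟩
  have hspec := copyQueryCmd_spec
    (E := ⟨G, [n, s, t, i, c.pc], reachability.wordLen n⟩)
    (S := S.comap (Sum.map Reg.index Reg.index)) (τ := τ) s t hfit rfl rfl rfl (i := i) rfl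
    (fun r => hlt _) (fun _ => rfl) hinv
  obtain ⟨k, S', hk, ⟨⟨h1, h2, h3, h4⟩, h5⟩, hrun⟩ := hspec.map hmap
  have hrun' := hrun ω' 0
  rw [zero_add] at hrun'
  obtain ⟨hend, -⟩ := hrun'.toProgram (.inr (Reg.index .ow)) (.inr (Reg.index .zero)) trivial
  obtain ⟨e1, e2, e3⟩ := hend q (by simp only at hk; omega)
  refine ⟨e1.trans ?_, fun r => ?_, e3.trans h4⟩
  · have h1' : S'.reg (.inr (Reg.index .ow)) = (τ i).toNat := h1
    have h2' : S'.reg (.inr (Reg.index .zero)) = 0 := h2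
    rw [h1', h2']
    cases τ i <;> rfl
  · refine (congrFun e2 _).trans ?_
    by_cases hr : (Sum.inl r : Fin 39 ⊕ Fin 39) ∈ Set.range (Sum.map Reg.index Reg.index)
    · obtain ⟨r' | r', hr'⟩ := hr
      · have h6 := h3 r'
        simp only [St.comap, hr'] at h6
        exact h6
      · simp at hr'
    · exact h5 _ hr

/-- Each of the two bad events has at most a quarter of all words. The exponent `1024` makes the
range of moduli large enough for `card_divisors_le_lt`, and the word length makes that range, times
the `n ^ 3` nodes, small against `2 ^ w`. -/
theorem card_bad_le (hn : 2 ≤ n) (hℓ : n ≤ 2 ^ ℓ) (hℓ1 : 1 ≤ ℓ) (hℓ2 : 2 ^ ℓ < n ^ 2) {N : ℕ}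
    (hN0 : N ≠ 0) (hN : N ≤ n ^ (n - 1)) (f : ℕ → ℕ) (bad : ℕ → Prop) [DecidablePred bad]
    (hbad : ∀ r, bad r → (r % n ^ 1024 + 1) ∣ N ∨
      ∃ z < n ^ 3, 2 ^ (1100 * ℓ) ≤ (f z + r) % 2 ^ (1100 * ℓ) + 2 * n ^ 1024) :
    2 * ((Finset.range (2 ^ (1100 * ℓ))).filter bad).card ≤ 2 ^ (1100 * ℓ) := by
  have hNJ : N ≤ 2 ^ 2 ^ (2 * ℓ) := by
    refine hN.trans ((Nat.pow_le_pow_left hℓ _).trans ?_)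
    rw [← pow_mul]
    refine Nat.pow_le_pow_right (by omega) ?_
    rw [two_mul, pow_add]
    exact Nat.mul_le_mul Nat.lt_two_pow_self.le (by omega)
  -- `36 ≤ 256 * ℓ`, so the exponent is at most `512 * ℓ`; then `2 ^ ℓ < n ^ 2` is used.
  have hK : 2 ^ (128 * (2 * ℓ) + 36) < n ^ 1024 := by
    calc 2 ^ (128 * (2 * ℓ) + 36) ≤ 2 ^ (ℓ * 512) := Nat.pow_le_pow_right (by omega) (by omega)
      _ = (2 ^ ℓ) ^ 512 := pow_mul _ _ _
      _ < (n ^ 2) ^ 512 := Nat.pow_lt_pow_left hℓ2 (by omega)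
      _ = n ^ 1024 := by rw [← pow_mul]
  have hKM : 8 * n ^ 3 * n ^ 1024 ≤ 2 ^ (1100 * ℓ) := by
    calc 8 * n ^ 3 * n ^ 1024 ≤ 2 ^ 3 * (2 ^ ℓ) ^ 3 * (2 ^ ℓ) ^ 1024 :=
          Nat.mul_le_mul (Nat.mul_le_mul le_rfl (Nat.pow_le_pow_left hℓ _))
            (Nat.pow_le_pow_left hℓ _)
      _ = 2 ^ (3 + ℓ * 3 + ℓ * 1024) := by rw [pow_add, pow_add, pow_mul, pow_mul]
      _ ≤ 2 ^ (1100 * ℓ) := Nat.pow_le_pow_right (by omega) (by omega)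
  have hD := card_divisors_le_lt hN0 hNJ hK
  have h1 := card_mod_dvd_le (N := N) (M := 2 ^ (1100 * ℓ)) (Nat.zero_lt_of_lt hK)
  have h2 := card_exists_shift_le (M := 2 ^ (1100 * ℓ)) (L := 2 * n ^ 1024) (X := n ^ 3) f
  have h3 : ((Finset.range (2 ^ (1100 * ℓ))).filter bad).card ≤
      ((Finset.range (2 ^ (1100 * ℓ))).filter fun r => (r % n ^ 1024 + 1) ∣ N).card +
      ((Finset.range (2 ^ (1100 * ℓ))).filter fun r =>
        ∃ z < n ^ 3, 2 ^ (1100 * ℓ) ≤ (f z + r) % 2 ^ (1100 * ℓ) + 2 * n ^ 1024).card := by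
    refine (Finset.card_le_card fun r hr => ?_).trans (Finset.card_union_le _ _)
    simp only [Finset.mem_filter, Finset.mem_union] at hr ⊢
    rcases hbad r hr.2 with h | h
    · exact Or.inl ⟨hr.1, h⟩
    · exact Or.inr ⟨hr.1, h⟩
  generalize ((Finset.range (2 ^ (1100 * ℓ))).filter bad).card = c at *
  generalize ((Finset.range (2 ^ (1100 * ℓ))).filter fun r => (r % n ^ 1024 + 1) ∣ N).card = c1 at *
  generalize ((Finset.range (2 ^ (1100 * ℓ))).filter fun r =>
        ∃ z < n ^ 3, 2 ^ (1100 * ℓ) ≤ (f z + r) % 2 ^ (1100 * ℓ) + 2 * n ^ 1024).card = c2 at *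
  generalize ((Finset.Icc 1 (n ^ 1024)).filter (· ∣ N)).card = D at *
  have hn3 : 1 ≤ n ^ 3 := Nat.one_le_pow _ _ (by omega)
  clear hK
  generalize n ^ 1024 = K at *
  generalize 2 ^ (1100 * ℓ) = M at *
  generalize n ^ 3 = X at *
  have h4 := Nat.mul_div_le M K
  have h5 : 8 * (D * (M / K + 1)) ≤ K * (M / K) + K := by
    calc 8 * (D * (M / K + 1)) = 8 * D * (M / K + 1) := by ring
      _ ≤ K * (M / K + 1) := Nat.mul_le_mul_right _ hD.le
      _ = _ := by ring
  have h6 : K ≤ M := by nlinarith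
  have h7 : 4 * (X * (2 * K)) ≤ M := by rw [← mul_assoc, ← mul_assoc] at *; nlinarith
  omega

theorem acceptProb_ge {T : ℕ} (hn : 2 ≤ n) (hfit : Fits n W (reachability.wordLen n))
    (hst : G.Reaches s t) (τ : Fin W → Bool)
    (hT : numActive G * (96 * reachability.wordLen n + 380) +
      24 * reachability.wordLen n + 101 ≤ T) :
    1 / 2 ≤ reachability.acceptProb G s t τ T := by
  classical
  set ℓ := Nat.clog 2 n with hℓ
  have hw : reachability.wordLen n = 1100 * ℓ := rfl
  have hℓ1 : 1 ≤ ℓ := Nat.clog_pos (by omega) hn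
  have hnℓ : n ≤ 2 ^ ℓ := Nat.le_pow_clog (by omega) n
  -- Rounding up the logarithm costs less than a factor `2 ≤ n`.
  have hℓ2 : 2 ^ ℓ < n ^ 2 := by
    have h1 : 2 ^ (ℓ - 1) < n := Nat.pow_pred_clog_lt_self (by omega) (by omega)
    obtain ⟨ℓ', h2⟩ : ∃ ℓ', ℓ = ℓ' + 1 := ⟨ℓ - 1, by omega⟩
    rw [h2] at h1 ⊢
    rw [Nat.add_sub_cancel] at h1
    rw [pow_succ]
    nlinarith
  obtain ⟨k₀, hk₀, h⟩ := mainAt_spec G s t hfit τ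
  have hbig := hfit.big_lt
  rw [hw] at hk₀ h hT hbig
  have hN0 := walks_pos_of_reaches hst
  let bad : ℕ → Prop := fun r => (r % n ^ 1024 + 1) ∣ walks G s (n - 1) t ∨
    ∃ z < n ^ 3, 2 ^ (1100 * ℓ) ≤ (word (1100 * ℓ) τ z + r) % 2 ^ (1100 * ℓ) + 2 * n ^ 1024
  have hbad := card_bad_le hn hnℓ hℓ1 hℓ2 hN0.ne' (walks_le G s (n - 1) t)
    (word (1100 * ℓ) τ) bad fun _ => id
  have hcard := card_sampled_le (T := T) (k := k₀) (by omega) bad hbad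
  have hgood : ∀ ω, ¬ bad (sampled ω k₀ (1100 * ℓ)) →
      reachability.result G s t τ ω T = some true := by
    intro ω hω
    obtain ⟨r, q, g₀, g₁, hr, hq, h₀, h₁, hres, -⟩ := h ω
    rw [(hres T hT).1, Option.some_inj, decide_eq_true_iff]
    rw [← hr] at hω
    simp only [bad, not_or, not_exists, not_and, not_le, ← hq] at hω
    have hK : 0 < n ^ 1024 := Nat.pow_pos (by omega)
    have hqK : q ≤ n ^ 1024 := by have := Nat.mod_lt r hK; omega
    have hq0 : 0 < q := hq ▸ Nat.succ_pos _
    have hmod := h₀.nodeValue_modEq h₁ hq0 (fun z hz => by have := hω.2 z hz; omega)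
      (i := n - 1) (by omega) t
    have hle₀ := nodeValue_le (w := 1100 * ℓ) (r := r) (g := g₀) (Nat.zero_le 1) hq0
      (topNode G 0 s) (topNode G (n - 1) t)
    have hle₁ := nodeValue_le (w := 1100 * ℓ) (r := r) (g := g₁) le_rfl hq0
      (topNode G 0 s) (topNode G (n - 1) t)
    rw [Nat.mod_eq_of_lt (by omega), Nat.mod_eq_of_lt (by omega)]
    -- Both values are at most `q < 2 ^ w`, so equality of the compared words is equality of the
    -- values, and it would force `q` to divide the number of walks.
    intro heq
    rw [heq] at hmod
    refine hω.1 ((Nat.modEq_zero_iff_dvd).1 ?_)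
    exact (Nat.ModEq.add_left_cancel' _ (by rwa [add_zero])).symm
  have hcompl : 2 ^ T ≤ 2 * (Finset.univ.filter fun ω : Fin T → Bool =>
      reachability.result G s t τ (fun j => if h : j < T then ω ⟨j, h⟩ else false) T =
        some true).card := by
    have h1 := Finset.card_filter_add_card_filter_not (s := Finset.univ)
      fun ω : Fin T → Bool =>
        bad (sampled (fun j => if h : j < T then ω ⟨j, h⟩ else false) k₀ (1100 * ℓ))
    have h2 : (Finset.univ.filter fun ω : Fin T → Bool =>
        ¬ bad (sampled (fun j => if h : j < T then ω ⟨j, h⟩ else false) k₀ (1100 * ℓ))).card ≤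
        (Finset.univ.filter fun ω : Fin T → Bool =>
          reachability.result G s t τ (fun j => if h : j < T then ω ⟨j, h⟩ else false) T =
            some true).card := by
      refine Finset.card_le_card fun ω hω => ?_
      simp only [Finset.mem_filter, Finset.mem_univ, true_and] at hω ⊢
      exact hgood _ hω
    simp only [Finset.card_univ, Fintype.card_fun, Fintype.card_bool, Fintype.card_fin] at h1
    omega
  rw [Algorithm.acceptProb, div_le_div_iff₀ (by norm_num) (by positivity), one_mul, mul_comm]
  exact_mod_cast hcompl

end Algorithm

end Catalytic

/-! ### The constants, and the four claims together -/

theorem theorem3 :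
    ∃ (A : Catalytic.Algorithm) (C k : ℕ),
      (∀ n : ℕ, A.workspace n ≤ C * Nat.clog 2 n) ∧
      ∀ (n m : ℕ) (G : Catalytic.OracleDigraph n) (s t : Fin n),
        G.numEdges = m → n ≤ m →
        ∀ W T q : ℕ,
          W = C * n ^ 3 * Nat.clog 2 n ^ k →
          T = C * (n * m) * Nat.clog 2 n ^ k →
          q = C * Nat.clog 2 n ^ k →
          A.IsCatalytic G s t W T ∧
          (¬ G.Reaches s t →
            ∀ (τ : Fin W → Bool) (ω : ℕ → Bool), A.result G s t τ ω T = some false) ∧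
          (G.Reaches s t → ∀ τ : Fin W → Bool, 1 / 2 ≤ A.acceptProb G s t τ T) ∧
          A.LocallyRevertible G s t W q := by
  -- One logarithm suffices as polylogarithmic factor. The constant is dictated by the running time:
  -- `2 * (96 * 1100 + 380) + 24 * 1100 + 101` is below `300000`.
  refine ⟨Catalytic.reachability, 300000, 1, fun n => ?_, ?_⟩
  · have h : Catalytic.reachability.workspace n = (39 + 39) * (1100 * Nat.clog 2 n) := rfl
    omega
  intro n m G s t hm hnm W T q hW hT hq
  rw [pow_one] at hW hT hq
  -- A loopless graph on one vertex has no edge, so `n ≤ m` excludes it. This matters because the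
  -- word length would be `0` there.
  have hn : 2 ≤ n := by
    by_contra hlt
    have h1 : n = 1 := by have := Fin.pos s; omega
    subst h1
    have h2 : G.numEdges = 0 := by
      rw [Catalytic.OracleDigraph.numEdges, Set.ncard_eq_zero]
      refine Set.eq_empty_of_forall_notMem fun e he => G.loopless e.1 ?_
      have h3 : G.Adj e.1 e.2 := he
      rwa [Subsingleton.elim e.2 e.1] at h3
    omega
  have hℓ1 : 1 ≤ Nat.clog 2 n := Nat.clog_pos (by omega) hn
  have hw : Catalytic.reachability.wordLen n = 1100 * Nat.clog 2 n := rfl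
  have hfit : Catalytic.Fits n W (Catalytic.reachability.wordLen n) := by
    rw [hW, hw]
    exact Catalytic.fits_of_le hn (Nat.le_pow_clog (by omega) n) hℓ1
  have hTle : Catalytic.numActive G * (96 * Catalytic.reachability.wordLen n + 380) +
      24 * Catalytic.reachability.wordLen n + 101 ≤ T := by
    -- The hypothesis `n ≤ m` absorbs the `n` nodes per layer that stand for staying in place.
    have h1 : Catalytic.numActive G ≤ 2 * (n * m) := by
      have := Catalytic.numActive_le (G := G) (by omega)
      rw [hm] at this
      nlinarith
    have h2 : 1 ≤ n * m := Nat.mul_pos (by omega) (by omega)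
    rw [hT, hw]
    generalize Nat.clog 2 n = ℓ at hℓ1
    have h3 : Catalytic.numActive G * (96 * (1100 * ℓ) + 380) ≤ 2 * (n * m) * (105980 * ℓ) :=
      Nat.mul_le_mul h1 (by omega)
    have h4 : ℓ ≤ n * m * ℓ := Nat.le_mul_of_pos_left _ h2
    have h5 : 300000 * (n * m) * ℓ = 300000 * (n * m * ℓ) := by ring
    have h6 : 2 * (n * m) * (105980 * ℓ) = 211960 * (n * m * ℓ) := by ring
    linarith
  refine ⟨fun τ ω => ?_, fun hst τ ω => ?_, fun hst τ =>
    Catalytic.acceptProb_ge G s t hn hfit hst τ hTle,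
    Catalytic.reachability_locallyRevertible G s t hfit (by omega)⟩
  · obtain ⟨_, -, h⟩ := Catalytic.mainAt_spec G s t hfit τ
    obtain ⟨_, _, _, _, -, -, -, -, hres, -⟩ := h ω
    rw [(hres T hTle).1]
    exact ⟨rfl, (hres T hTle).2⟩
  · obtain ⟨_, -, h⟩ := Catalytic.mainAt_spec G s t hfit τ
    obtain ⟨r, q, g₀, g₁, -, -, h₀, h₁, hres, -⟩ := h ω
    rw [(hres T hTle).1, h₀.nodeValue_eq h₁ (by omega) hst]
    simp
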